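/- Let $n\ge 1$. A rectangular box in $\mathbb{R}^n$ is a product $\mathcal{B}=\prod_{i=1}^n (a_i,b_i)$ of bounded nonempty open intervals, and a cube is a box whose edges all have the same length. For $\alpha\in\mathbb{R}$ let $\lambda_2(\mathcal{B};\alpha)$ denote the second eigenvalue (counted with multiplicity) of the Robin Laplacian on $\mathcal{B}$, that is, of the problem $-\Delta u=\lambda u$ in $\mathcal{B}$, $\frac{\partial u}{\partial \nu}+\alpha u=0$ on $\partial\mathcal{B}$, given by the minimax formula \[ \lambda_2(\mathcal{B};\alpha)=\min_{U}\ \max_{u\in U\setminus\{0\}}\ \frac{\int_{\mathcal{B}}|\nabla u|^2\,dx+\alpha\int_{\partial\mathcal{B}}u^2\,dS}{\int_{\mathcal{B}}u^2\,dx}, \] where $U$ ranges over all $2$-dimensional subspaces of the Sobolev space $H^1(\mathcal{B})$ and boundary values are taken in the sense of traces. \textbf{Theorem} (Maximizing the second Robin eigenvalue on rectangular boxes). Let $\alpha\le 0$. Among rectangular boxes of given volume, $\lambda_2(\mathcal{B};\alpha)$ is maximal for the cube and only the cube: if $\mathcal{C}$ is a cube in $\mathbb{R}^n$ and $\mathcal{B}$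 is a rectangular box in $\mathbb{R}^n$ with the same volume as $\mathcal{C}$, then $\lambda_2(\mathcal{B};\alpha)\le\lambda_2(\mathcal{C};\alpha)$, with equality if and only if $\mathcal{B}$ is a cube. -/

import Mathlib

open MeasureTheory Set
open scoped ContDiff

namespace RobinBox

noncomputable section

/- A rectangular box in `ℝⁿ` is a Cartesian product of `n` nonempty bounded open intervals.  Boxes are
encoded by Mathlib's `BoxIntegral.Box (Fin n)`, that is, by their end points
`B.lower i < B.upper i`; the open box itself is `BoxIntegral.Box.Ioo B`. -/

/-- A cube is a box all of whose edges have the same length. -/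
def IsCube {n : ℕ} (B : BoxIntegral.Box (Fin n)) : Prop :=
  ∃ l : ℝ, ∀ i, B.upper i - B.lower i = l

/-- Lebesgue measure on the open box. -/
def boxMeasure {n : ℕ} (B : BoxIntegral.Box (Fin n)) : Measure (Fin n → ℝ) :=
  volume.restrict (BoxIntegral.Box.Ioo B)

/-- `(n-1)`-dimensional Lebesgue measure on the (relatively open) part of the hyperplane `x i = c`
whose other coordinates lie in the edges of the box.  For `c = B.lower i` and `c = B.upper i`
it is the surface measure on one of the two faces of the box orthogonal to the `i`-th axis. -/
def faceMeasure {n : ℕ} (B : BoxIntegral.Box (Fin n)) (i : Fin n) (c : ℝ) :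
    Measure (Fin n → ℝ) :=
  Measure.pi (Function.update
    (fun j => (volume : Measure ℝ).restrict (Ioo (B.lower j) (B.upper j))) i (Measure.dirac c))

/-- Surface measure `dS` on the boundary of the box: the sum over its `2n` faces (the lower
dimensional edges are null sets).  For `n = 1` it is the counting measure of the two end points. -/
def surfaceMeasure {n : ℕ} (B : BoxIntegral.Box (Fin n)) : Measure (Fin n → ℝ) :=
  ∑ i, (faceMeasure B i (B.lower i) + faceMeasure B i (B.upper i))

/-- The real Hilbert space `L²` of the box. -/
abbrev L2 {n : ℕ} (B : BoxIntegral.Box (Fin n)) : Type :=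
  Lp ℝ 2 (boxMeasure B)

/-- The real Hilbert space `L²` of the boundary of the box. -/
abbrev L2Boundary {n : ℕ} (B : BoxIntegral.Box (Fin n)) : Type :=
  Lp ℝ 2 (surfaceMeasure B)

/-- `g = (g 0, …, g (n-1))` is the weak (distributional) gradient of `u` in the open box. -/
def IsWeakGradient {n : ℕ} {B : BoxIntegral.Box (Fin n)} (u : L2 B) (g : Fin n → L2 B) : Prop :=
  ∀ (i : Fin n) (φ : (Fin n → ℝ) → ℝ), ContDiff ℝ ∞ φ → HasCompactSupport φ →
    tsupport φ ⊆ BoxIntegral.Box.Ioo B →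
    ∫ x, u x * fderiv ℝ φ x (Pi.single i 1) ∂(boxMeasure B)
      = - ∫ x, g i x * φ x ∂(boxMeasure B)

/-- Membership in the Sobolev space `H¹` of the box: `u` is in `L²` and has a weak gradient
in `L²`. -/
def MemH1 {n : ℕ} {B : BoxIntegral.Box (Fin n)} (u : L2 B) : Prop :=
  ∃ g : Fin n → L2 B, IsWeakGradient u g

open Classical in
/-- The weak gradient of an `H¹` function (it is unique; the value is `0` outside `H¹`). -/
def weakGradient {n : ℕ} {B : BoxIntegral.Box (Fin n)} (u : L2 B) : Fin n → L2 B :=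
  if h : ∃ g : Fin n → L2 B, IsWeakGradient u g then h.choose else 0

/-- `T` is the boundary trace of the `H¹` function `u`: the Gauss–Green formula
`∫_B u ∂ᵢφ dx + ∫_B (∂ᵢu) φ dx = ∫_{∂B} T φ νᵢ dS` holds for every `i` and every smooth function
`φ` on `ℝⁿ`.  The component `νᵢ` of the outer unit normal is `1` on the upper and `-1` on the
lower face orthogonal to the `i`-th axis, and `0` on all other faces. -/
def IsTrace {n : ℕ} {B : BoxIntegral.Box (Fin n)} (u : L2 B) (T : L2Boundary B) : Prop :=
  ∀ (i : Fin n) (φ : (Fin n → ℝ) → ℝ), ContDiff ℝ ∞ φ →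
    ∫ x, u x * fderiv ℝ φ x (Pi.single i 1) ∂(boxMeasure B)
        + ∫ x, weakGradient u i x * φ x ∂(boxMeasure B)
      = ∫ x, T x * φ x ∂(faceMeasure B i (B.upper i))
        - ∫ x, T x * φ x ∂(faceMeasure B i (B.lower i))

open Classical in
/-- The boundary trace of an `H¹` function (every `H¹` function on a box has exactly one trace). -/
def trace {n : ℕ} {B : BoxIntegral.Box (Fin n)} (u : L2 B) : L2Boundary B :=
  if h : ∃ T : L2Boundary B, IsTrace u T then h.choose else 0

/-- The Robin Rayleigh quotient
`(∫_B |∇u|² dx + α ∫_{∂B} u² dS) / ∫_B u² dx`. -/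
def rayleigh {n : ℕ} {B : BoxIntegral.Box (Fin n)} (α : ℝ) (u : L2 B) : ℝ :=
  ((∑ i, ∫ x, (weakGradient u i x) ^ 2 ∂(boxMeasure B))
      + α * ∫ x, (trace u x) ^ 2 ∂(surfaceMeasure B))
    / ∫ x, (u x) ^ 2 ∂(boxMeasure B)

/-- The `k`-th eigenvalue (`k ≥ 1`, counted with multiplicity) of the Robin Laplacian on the box
with Robin parameter `α`, by the minimax formula: the least value, over all `k`-dimensional
subspaces `U` of `H¹`, of the maximum of the Rayleigh quotient on `U \ {0}`. -/
def robinEigenvalue {n : ℕ} (k : ℕ) (B : BoxIntegral.Box (Fin n)) (α : ℝ) : ℝ :=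
  sInf {M : ℝ | ∃ U : Submodule ℝ (L2 B), (∀ u ∈ U, MemH1 u) ∧ Module.finrank ℝ U = k ∧
    IsGreatest {r : ℝ | ∃ u ∈ U, u ≠ 0 ∧ r = rayleigh α u} M}

end

end RobinBox

/-! Write α = -a with a ≥ 0. On an interval of half-length L the even ground state is cosh (k x),
with energy -k² where k tanh (k L) = a (`IsGroundRate`). The first odd mode has some eigenvalue μ,
and μ > -k² (`IsOddMode`, `gap_pos`). By separation of variables the ground energy of a box is -∑
k_i². Exciting direction j alone gives the value -∑ k_i² + (μ_j + k_j²), and the second eigenvalue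
is the least of these.

Upper bound, for every box and every j: the ground state and the mode excited in direction j span an
admissible trial plane (`IsEdgeData.mem_minimaxSet`).

Lower bound, needed only for cubes, where all gaps agree: on each line parallel to an axis the Robin
energy is at least -k_i² times the squared norm plus the gap times the squared distance to the
ground state (`interval_inequality`). The projections P_i onto the ground state in the i-th variable
commute, so ‖v‖² - ‖P_1 ⋯ P_n v‖² ≤ ∑ (‖v‖² - ‖P_i v‖²) (`defect_prod_le`). If v is orthogonal to
the ground state of the box, the product kills v and the gap survives in full (`gap_inequality`).
Any plane in H¹ contains a nonzero vector of this kind. Passing from smooth to Sobolev functions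
uses density, obtained from completeness of cosine products (`IsWeakGradient.exists_approx`), and a
trace inequality (`exists_isTrace`).

Comparison: let the cube have half-edge M, ground rate q and odd eigenvalue μ. A box of equal volume
that is not this cube up to translation has an edge j with L_j > M. Two facts decide. The odd
eigenvalue strictly decreases with the length (`eigenvalue_lt`), so μ_j < μ. As a function of log L,
the ground energy lies below its tangent at log M, whose slope c is nonnegative (`exists_tangent`).
Equal volume means ∑ (log L_i - log M) = 0, so summing the tangent bound over i ≠ j gives -∑_{i≠j}
k_i² ≤ -(n-1) q² - c (log L_j - log M) ≤ -(n-1) q². Together the trial value for direction j is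
strictly below the second eigenvalue of the cube (`robinEigenvalue_two_lt`). -/

namespace RobinBox

noncomputable section

/-! ### Product measures, slices, and the Gauss–Green formula on a box -/

/-- Lebesgue measure on the `i`-th edge of the box. -/
def edgeMeasure {n : ℕ} (B : BoxIntegral.Box (Fin n)) (i : Fin n) : Measure ℝ :=
  (volume : Measure ℝ).restrict (Ioo (B.lower i) (B.upper i))

instance {n : ℕ} (B : BoxIntegral.Box (Fin n)) (i : Fin n) : IsFiniteMeasure (edgeMeasure B i) := by
  unfold edgeMeasure; infer_instance

theorem boxMeasure_eq_pi {n : ℕ} (B : BoxIntegral.Box (Fin n)) :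
    boxMeasure B = Measure.pi (edgeMeasure B) := by
  have : (BoxIntegral.Box.Ioo B : Set (Fin n → ℝ))
      = univ.pi fun i => Ioo (B.lower i) (B.upper i) := rfl
  rw [boxMeasure, this, volume_pi, Measure.restrict_pi_pi]
  rfl

theorem isFiniteMeasure_update {n : ℕ} (μ : Fin n → Measure ℝ) [∀ i, IsFiniteMeasure (μ i)]
    (i : Fin n) (η : Measure ℝ) [IsFiniteMeasure η] (j : Fin n) :
    IsFiniteMeasure (Function.update μ i η j) := by
  rcases eq_or_ne j i with rfl | h
  · rw [Function.update_self]; infer_instance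
  · rw [Function.update_of_ne h]; infer_instance

theorem faceMeasure_eq {n : ℕ} (B : BoxIntegral.Box (Fin n)) (i : Fin n) (c : ℝ) :
    faceMeasure B i c = Measure.pi (Function.update (edgeMeasure B) i (Measure.dirac c)) := rfl

/-- Overwriting coordinate i forgets the factor `δ`, and total mass 1 makes this harmless. With a
Dirac mass for `δ`, an edge measure for `η` yields Fubini, while a Dirac mass for `η` moves a face
along its axis. -/
theorem pi_update_eq_map {n : ℕ} (μ : Fin n → Measure ℝ) [∀ i, IsFiniteMeasure (μ i)]
    (i : Fin n) (η δ : Measure ℝ) [IsFiniteMeasure η] [IsProbabilityMeasure δ] :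
    MeasurePreserving (fun p : (Fin n → ℝ) × ℝ => Function.update p.1 i p.2)
      ((Measure.pi (Function.update μ i δ)).prod η) (Measure.pi (Function.update μ i η)) := by
  have h1 := isFiniteMeasure_update μ i η
  have h2 := isFiniteMeasure_update μ i δ
  have hm : Measurable (fun p : (Fin n → ℝ) × ℝ => Function.update p.1 i p.2) := by
    rw [measurable_pi_iff]
    intro j
    rcases eq_or_ne j i with rfl | h
    · simpa using measurable_snd
    · simp only [Function.update_of_ne h]
      exact (measurable_pi_apply j).comp measurable_fst
  refine ⟨hm, (Measure.pi_eq fun s hs => ?_).symm⟩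
  rw [Measure.map_apply hm (MeasurableSet.univ_pi hs)]
  have : (fun p : (Fin n → ℝ) × ℝ => Function.update p.1 i p.2) ⁻¹' (univ.pi s)
      = (univ.pi (Function.update s i univ)) ×ˢ s i := by
    ext ⟨x, t⟩
    simp only [mem_preimage, mem_pi, mem_univ, true_imp_iff, mem_prod]
    constructor
    · intro h
      refine ⟨fun j => ?_, by simpa using h i⟩
      rcases eq_or_ne j i with rfl | hj
      · simp
      · simpa [Function.update_of_ne hj] using h j
    · rintro ⟨h, ht⟩ j
      rcases eq_or_ne j i with rfl | hj
      · simpa using ht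
      · simpa [Function.update_of_ne hj] using h j
  rw [this, Measure.prod_prod, Measure.pi_pi,
    ← Finset.mul_prod_erase _ _ (Finset.mem_univ i),
    ← Finset.mul_prod_erase _ (fun j => (Function.update μ i η j) (s j)) (Finset.mem_univ i)]
  simp only [Function.update_self, measure_univ, one_mul]
  rw [mul_comm]
  congr 1
  refine Finset.prod_congr rfl fun j hj => ?_
  have := Finset.ne_of_mem_erase hj
  simp [Function.update_of_ne this]

/-- The closed box. -/
def closedBox {n : ℕ} (B : BoxIntegral.Box (Fin n)) : Set (Fin n → ℝ) :=
  univ.pi fun i => Icc (B.lower i) (B.upper i)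

theorem isCompact_closedBox {n : ℕ} (B : BoxIntegral.Box (Fin n)) : IsCompact (closedBox B) :=
  isCompact_univ_pi fun _ => isCompact_Icc

/-- A finite measure that is carried by the closed box. -/
structure Carried {n : ℕ} (B : BoxIntegral.Box (Fin n)) (μ : Measure (Fin n → ℝ)) : Prop where
  finite : IsFiniteMeasure μ
  ae_mem : ∀ᵐ x ∂μ, x ∈ closedBox B

theorem carried_pi {n : ℕ} (B : BoxIntegral.Box (Fin n)) (μ : Fin n → Measure ℝ)
    [∀ i, IsFiniteMeasure (μ i)] (h : ∀ i, ∀ᵐ t ∂(μ i), t ∈ Icc (B.lower i) (B.upper i)) :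
    Carried B (Measure.pi μ) := by
  refine ⟨inferInstance, ?_⟩
  have : ∀ᵐ x ∂(Measure.pi μ), ∀ i, x i ∈ Icc (B.lower i) (B.upper i) := by
    rw [ae_all_iff]
    intro i
    exact Measure.tendsto_eval_ae_ae.eventually (h i)
  filter_upwards [this] with x hx i _ using hx i

theorem edgeMeasure_ae {n : ℕ} (B : BoxIntegral.Box (Fin n)) (i : Fin n) :
    ∀ᵐ t ∂(edgeMeasure B i), t ∈ Icc (B.lower i) (B.upper i) := by
  unfold edgeMeasure
  filter_upwards [ae_restrict_mem measurableSet_Ioo] with t ht using Ioo_subset_Icc_self ht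

theorem carried_box {n : ℕ} (B : BoxIntegral.Box (Fin n)) : Carried B (boxMeasure B) := by
  rw [boxMeasure_eq_pi]
  exact carried_pi B _ (edgeMeasure_ae B)

instance {n : ℕ} (B : BoxIntegral.Box (Fin n)) : IsFiniteMeasure (boxMeasure B) :=
  (carried_box B).finite

instance {n : ℕ} (B : BoxIntegral.Box (Fin n)) (i : Fin n) (c : ℝ) :
    IsFiniteMeasure (faceMeasure B i c) := by
  rw [faceMeasure_eq]
  have := isFiniteMeasure_update (edgeMeasure B) i (Measure.dirac c)
  infer_instance

theorem carried_face {n : ℕ} (B : BoxIntegral.Box (Fin n)) (i : Fin n) {c : ℝ}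
    (hc : c ∈ Icc (B.lower i) (B.upper i)) : Carried B (faceMeasure B i c) := by
  rw [faceMeasure_eq]
  have := isFiniteMeasure_update (edgeMeasure B) i (Measure.dirac c)
  refine carried_pi B _ fun j => ?_
  rcases eq_or_ne j i with rfl | h
  · rw [Function.update_self]; exact (ae_dirac_iff measurableSet_Icc).2 hc
  · rw [Function.update_of_ne h]; exact edgeMeasure_ae B j

theorem lower_mem {n : ℕ} (B : BoxIntegral.Box (Fin n)) (i : Fin n) :
    B.lower i ∈ Icc (B.lower i) (B.upper i) := left_mem_Icc.2 (B.lower_lt_upper i).le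

theorem upper_mem {n : ℕ} (B : BoxIntegral.Box (Fin n)) (i : Fin n) :
    B.upper i ∈ Icc (B.lower i) (B.upper i) := right_mem_Icc.2 (B.lower_lt_upper i).le

theorem carried_surface {n : ℕ} (B : BoxIntegral.Box (Fin n)) : Carried B (surfaceMeasure B) := by
  have hf : IsFiniteMeasure (surfaceMeasure B) := by
    unfold surfaceMeasure; infer_instance
  refine ⟨hf, ?_⟩
  rw [ae_iff, surfaceMeasure, Measure.finsetSum_apply]
  refine Finset.sum_eq_zero fun i _ => ?_
  rw [Measure.add_apply]
  have h1 := (carried_face B i (lower_mem B i)).ae_mem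
  have h2 := (carried_face B i (upper_mem B i)).ae_mem
  rw [ae_iff] at h1 h2
  rw [h1, h2, add_zero]

/-- A finite measure on a compact set sees a continuous function as bounded, so no growth condition
at infinity is needed. -/
theorem Carried.memLp {n : ℕ} {B : BoxIntegral.Box (Fin n)} {μ : Measure (Fin n → ℝ)}
    (h : Carried B μ) {f : (Fin n → ℝ) → ℝ} (hf : Continuous f) (p : ENNReal) : MemLp f p μ := by
  have := h.finite
  obtain ⟨C, hC⟩ := (isCompact_closedBox B).exists_bound_of_continuousOn hf.continuousOn
  refine MemLp.of_bound hf.aestronglyMeasurable C ?_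
  filter_upwards [h.ae_mem] with x hx using hC x hx

theorem Carried.integrable {n : ℕ} {B : BoxIntegral.Box (Fin n)} {μ : Measure (Fin n → ℝ)}
    (h : Carried B μ) {f : (Fin n → ℝ) → ℝ} (hf : Continuous f) : Integrable f μ :=
  memLp_one_iff_integrable.1 (h.memLp hf 1)

theorem integral_surfaceMeasure {n : ℕ} (B : BoxIntegral.Box (Fin n)) {f : (Fin n → ℝ) → ℝ}
    (hf : Integrable f (surfaceMeasure B)) :
    ∫ x, f x ∂(surfaceMeasure B)
      = ∑ i, (∫ x, f x ∂(faceMeasure B i (B.lower i)) + ∫ x, f x ∂(faceMeasure B i (B.upper i))) := by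
  unfold surfaceMeasure at hf ⊢
  rw [integrable_finsetSum_measure] at hf
  rw [integral_finsetSum_measure hf]
  refine Finset.sum_congr rfl fun i hi => ?_
  have := hf i hi
  rw [integrable_add_measure] at this
  rw [integral_add_measure this.1 this.2]

theorem faceMeasure_lower_le {n : ℕ} (B : BoxIntegral.Box (Fin n)) (i : Fin n) :
    faceMeasure B i (B.lower i) ≤ surfaceMeasure B := by
  unfold surfaceMeasure
  rw [← Finset.add_sum_erase _ _ (Finset.mem_univ i), add_assoc]
  exact Measure.le_add_right le_rfl

theorem faceMeasure_upper_le {n : ℕ} (B : BoxIntegral.Box (Fin n)) (i : Fin n) :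
    faceMeasure B i (B.upper i) ≤ surfaceMeasure B := by
  unfold surfaceMeasure
  rw [← Finset.add_sum_erase _ _ (Finset.mem_univ i),
    add_comm (faceMeasure B i (B.lower i)), add_assoc]
  exact Measure.le_add_right le_rfl

/-- Integration along the `i`-th coordinate over the edge of the box. -/
def sliceIntegral {n : ℕ} (B : BoxIntegral.Box (Fin n)) (i : Fin n) (f : (Fin n → ℝ) → ℝ)
    (x : Fin n → ℝ) : ℝ :=
  ∫ t in (B.lower i)..(B.upper i), f (Function.update x i t)

theorem continuous_update_prod {n : ℕ} (i : Fin n) :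
    Continuous (fun p : (Fin n → ℝ) × ℝ => Function.update p.1 i p.2) :=
  continuous_fst.update i continuous_snd

theorem continuous_sliceIntegral {n : ℕ} (B : BoxIntegral.Box (Fin n)) (i : Fin n)
    {f : (Fin n → ℝ) → ℝ} (hf : Continuous f) : Continuous (sliceIntegral B i f) :=
  intervalIntegral.continuous_parametric_intervalIntegral_of_continuous'
    (f := fun x t => f (Function.update x i t)) (hf.comp (continuous_update_prod i)) _ _

theorem integral_edgeMeasure {n : ℕ} (B : BoxIntegral.Box (Fin n)) (i : Fin n) (f : ℝ → ℝ) :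
    ∫ t, f t ∂(edgeMeasure B i) = ∫ t in (B.lower i)..(B.upper i), f t := by
  rw [intervalIntegral.integral_of_le (B.lower_lt_upper i).le, integral_Ioc_eq_integral_Ioo]
  rfl

/-- Fubini, with a face representing the other n - 1 coordinates. Its position `c` is arbitrary
because slicing overwrites the i-th coordinate. -/
theorem integral_boxMeasure {n : ℕ} (B : BoxIntegral.Box (Fin n)) (i : Fin n) (c : ℝ)
    {f : (Fin n → ℝ) → ℝ} (hf : Continuous f) :
    ∫ x, f x ∂(boxMeasure B) = ∫ x, sliceIntegral B i f x ∂(faceMeasure B i c) := by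
  have h := pi_update_eq_map (edgeMeasure B) i (edgeMeasure B i) (Measure.dirac c)
  rw [Function.update_eq_self, ← boxMeasure_eq_pi, ← faceMeasure_eq] at h
  have hi : Integrable f (boxMeasure B) := (carried_box B).integrable hf
  rw [← h.map_eq, integral_map h.measurable.aemeasurable hf.aestronglyMeasurable,
    integral_prod]
  · simp_rw [integral_edgeMeasure]; rfl
  · exact h.integrable_comp_of_integrable hi

theorem integral_faceMeasure {n : ℕ} (B : BoxIntegral.Box (Fin n)) (i : Fin n) (c d : ℝ)
    {f : (Fin n → ℝ) → ℝ} (hf : Continuous f) :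
    ∫ x, f x ∂(faceMeasure B i c)
      = ∫ x, f (Function.update x i c) ∂(faceMeasure B i d) := by
  have h := pi_update_eq_map (edgeMeasure B) i (Measure.dirac c) (Measure.dirac d)
  rw [← faceMeasure_eq, ← faceMeasure_eq] at h
  rw [← h.map_eq, integral_map h.measurable.aemeasurable hf.aestronglyMeasurable,
    Measure.prod_dirac, integral_map (by fun_prop)]
  exact (hf.comp (continuous_update_prod i)).aestronglyMeasurable

theorem hasDerivAt_comp_update {n : ℕ} {f : (Fin n → ℝ) → ℝ} (hf : Differentiable ℝ f) (i : Fin n)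
    (x : Fin n → ℝ) (t : ℝ) :
    HasDerivAt (fun s => f (Function.update x i s))
      (fderiv ℝ f (Function.update x i t) (Pi.single i 1)) t :=
  (hf _).hasFDerivAt.comp_hasDerivAt t (hasDerivAt_update x i t)

theorem continuous_partial {n : ℕ} {f : (Fin n → ℝ) → ℝ} (hf : ContDiff ℝ 1 f) (i : Fin n) :
    Continuous fun x => fderiv ℝ f x (Pi.single i 1) :=
  (hf.continuous_fderiv one_ne_zero).clm_apply continuous_const

/-- The fundamental theorem of calculus on each line parallel to the i-th axis, integrated over one
face. -/
theorem gauss_green {n : ℕ} (B : BoxIntegral.Box (Fin n)) (i : Fin n) {f : (Fin n → ℝ) → ℝ}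
    (hf : ContDiff ℝ 1 f) :
    ∫ x, fderiv ℝ f x (Pi.single i 1) ∂(boxMeasure B)
      = ∫ x, f x ∂(faceMeasure B i (B.upper i)) - ∫ x, f x ∂(faceMeasure B i (B.lower i)) := by
  have hc := hf.continuous
  have hu : ∀ s : ℝ, Continuous fun x : Fin n → ℝ => f (Function.update x i s) := fun s =>
    hc.comp (continuous_id.update i continuous_const)
  rw [integral_boxMeasure B i (B.lower i) (continuous_partial hf i),
    integral_faceMeasure B i (B.upper i) (B.lower i) hc,
    integral_faceMeasure B i (B.lower i) (B.lower i) hc,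
    ← integral_sub ((carried_face B i (lower_mem B i)).integrable (hu _))
      ((carried_face B i (lower_mem B i)).integrable (hu _))]
  refine integral_congr_ae (.of_forall fun x => ?_)
  refine intervalIntegral.integral_eq_sub_of_hasDerivAt
    (fun t _ => hasDerivAt_comp_update (hf.differentiable one_ne_zero) i x t) ?_
  exact ((continuous_partial hf i).comp (continuous_const.update i continuous_id)).intervalIntegrable _ _

theorem gauss_green_mul {n : ℕ} (B : BoxIntegral.Box (Fin n)) (i : Fin n)
    {f g : (Fin n → ℝ) → ℝ} (hf : ContDiff ℝ 1 f) (hg : ContDiff ℝ 1 g) :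
    ∫ x, f x * fderiv ℝ g x (Pi.single i 1) ∂(boxMeasure B)
        + ∫ x, fderiv ℝ f x (Pi.single i 1) * g x ∂(boxMeasure B)
      = ∫ x, f x * g x ∂(faceMeasure B i (B.upper i))
        - ∫ x, f x * g x ∂(faceMeasure B i (B.lower i)) := by
  rw [← gauss_green B i (hf.mul hg), ← integral_add]
  · refine integral_congr_ae (.of_forall fun x => ?_)
    have := fderiv_fun_mul (hf.differentiable one_ne_zero x) (hg.differentiable one_ne_zero x)
    simp only
    rw [this]
    simp
    ring
  · exact (carried_box B).integrable (hf.continuous.mul (continuous_partial hg i))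
  · exact (carried_box B).integrable ((continuous_partial hf i).mul hg.continuous)

end

noncomputable section

/-! ### Continuous functions as elements of `L²`; uniqueness of weak gradients and traces -/

/-- The class in `L²` of the box of a continuous function. -/
def boxLp {n : ℕ} (B : BoxIntegral.Box (Fin n)) (f : C(Fin n → ℝ, ℝ)) : L2 B :=
  ((carried_box B).memLp f.continuous 2).toLp f

/-- The class in `L²` of the boundary of a continuous function. -/
def bdryLp {n : ℕ} (B : BoxIntegral.Box (Fin n)) (f : C(Fin n → ℝ, ℝ)) : L2Boundary B :=
  ((carried_surface B).memLp f.continuous 2).toLp f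

theorem coeFn_boxLp {n : ℕ} (B : BoxIntegral.Box (Fin n)) (f : C(Fin n → ℝ, ℝ)) :
    boxLp B f =ᵐ[boxMeasure B] f := MemLp.coeFn_toLp _

theorem coeFn_bdryLp {n : ℕ} (B : BoxIntegral.Box (Fin n)) (f : C(Fin n → ℝ, ℝ)) :
    bdryLp B f =ᵐ[surfaceMeasure B] f := MemLp.coeFn_toLp _

theorem boxLp_add {n : ℕ} (B : BoxIntegral.Box (Fin n)) (f g : C(Fin n → ℝ, ℝ)) :
    boxLp B (f + g) = boxLp B f + boxLp B g := MemLp.toLp_add _ _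

theorem boxLp_sub {n : ℕ} (B : BoxIntegral.Box (Fin n)) (f g : C(Fin n → ℝ, ℝ)) :
    boxLp B (f - g) = boxLp B f - boxLp B g := MemLp.toLp_sub _ _

theorem boxLp_smul {n : ℕ} (B : BoxIntegral.Box (Fin n)) (c : ℝ) (f : C(Fin n → ℝ, ℝ)) :
    boxLp B (c • f) = c • boxLp B f := MemLp.toLp_const_smul _ _

theorem bdryLp_sub {n : ℕ} (B : BoxIntegral.Box (Fin n)) (f g : C(Fin n → ℝ, ℝ)) :
    bdryLp B (f - g) = bdryLp B f - bdryLp B g := MemLp.toLp_sub _ _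

theorem inner_eq_integral {X : Type*} [MeasurableSpace X] {μ : Measure X} (f g : Lp ℝ 2 μ) :
    inner ℝ f g = ∫ x, f x * g x ∂μ := by
  rw [L2.inner_def]
  refine integral_congr_ae (.of_forall fun x => ?_)
  simp [mul_comm]

theorem norm_sq_eq_integral {X : Type*} [MeasurableSpace X] {μ : Measure X} (f : Lp ℝ 2 μ) :
    ‖f‖ ^ 2 = ∫ x, (f x) ^ 2 ∂μ := by
  rw [← real_inner_self_eq_norm_sq, inner_eq_integral]
  simp_rw [sq]

theorem inner_boxLp_right {n : ℕ} {B : BoxIntegral.Box (Fin n)} (u : L2 B)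
    (f : C(Fin n → ℝ, ℝ)) : inner ℝ u (boxLp B f) = ∫ x, u x * f x ∂(boxMeasure B) := by
  rw [inner_eq_integral]
  refine integral_congr_ae ?_
  filter_upwards [coeFn_boxLp B f] with x hx
  rw [hx]

theorem inner_boxLp_boxLp {n : ℕ} (B : BoxIntegral.Box (Fin n)) (f g : C(Fin n → ℝ, ℝ)) :
    inner ℝ (boxLp B f) (boxLp B g) = ∫ x, f x * g x ∂(boxMeasure B) := by
  rw [inner_boxLp_right]
  refine integral_congr_ae ?_
  filter_upwards [coeFn_boxLp B f] with x hx
  rw [hx]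

theorem norm_boxLp_sq {n : ℕ} (B : BoxIntegral.Box (Fin n)) (f : C(Fin n → ℝ, ℝ)) :
    ‖boxLp B f‖ ^ 2 = ∫ x, f x ^ 2 ∂(boxMeasure B) := by
  rw [← real_inner_self_eq_norm_sq, inner_boxLp_boxLp]
  simp_rw [sq]

theorem norm_bdryLp_sq {n : ℕ} (B : BoxIntegral.Box (Fin n)) (f : C(Fin n → ℝ, ℝ)) :
    ‖bdryLp B f‖ ^ 2 = ∫ x, f x ^ 2 ∂(surfaceMeasure B) := by
  rw [norm_sq_eq_integral]
  refine integral_congr_ae ?_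
  filter_upwards [coeFn_bdryLp B f] with x hx
  rw [hx]

theorem L2.locallyIntegrable {X : Type*} [MeasurableSpace X] [TopologicalSpace X]
    {μ : Measure X} [IsFiniteMeasure μ] (u : Lp ℝ 2 μ) : LocallyIntegrable u μ :=
  ((Lp.memLp u).integrable one_le_two).locallyIntegrable

/-- The `i`-th partial derivative of a `C¹` function, as a continuous map. -/
def partialC {n : ℕ} (f : (Fin n → ℝ) → ℝ) (hf : ContDiff ℝ 1 f) (i : Fin n) :
    C(Fin n → ℝ, ℝ) :=
  ⟨fun x => fderiv ℝ f x (Pi.single i 1), continuous_partial hf i⟩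

/-- The difference of two candidates is orthogonal to all test functions supported in the open box,
so the fundamental lemma of the calculus of variations applies. -/
theorem isWeakGradient_unique {n : ℕ} {B : BoxIntegral.Box (Fin n)} {u : L2 B}
    {g g' : Fin n → L2 B} (h : IsWeakGradient u g) (h' : IsWeakGradient u g') : g = g' := by
  funext i
  have hopen : IsOpen (BoxIntegral.Box.Ioo B : Set (Fin n → ℝ)) :=
    isOpen_set_pi finite_univ fun _ _ => isOpen_Ioo
  have key := hopen.ae_eq_zero_of_integral_contDiff_smul_eq_zero (μ := boxMeasure B)
    (f := (g i - g' i : L2 B))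
    ((L2.locallyIntegrable (g i - g' i)).locallyIntegrableOn _) (fun φ hφ hc hs => by
      have e1 := h i φ hφ hc hs
      have e2 := h' i φ hφ hc hs
      have e3 : ∫ x, g i x * φ x ∂(boxMeasure B) = ∫ x, g' i x * φ x ∂(boxMeasure B) := by
        linarith
      let φc : C(Fin n → ℝ, ℝ) := ⟨φ, hφ.continuous⟩
      have e4 : inner ℝ (g i - g' i) (boxLp B φc) = 0 := by
        rw [inner_sub_left, inner_boxLp_right, inner_boxLp_right]
        exact sub_eq_zero.2 e3
      rw [inner_boxLp_right] at e4
      rw [← e4]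
      refine integral_congr_ae (.of_forall fun x => ?_)
      simp only [smul_eq_mul, φc, ContinuousMap.coe_mk]
      ring)
  have h0 : (g i - g' i : L2 B) = 0 := by
    rw [Lp.eq_zero_iff_ae_eq_zero]
    have hm : ∀ᵐ x ∂(boxMeasure B), x ∈ (BoxIntegral.Box.Ioo B : Set (Fin n → ℝ)) := by
      unfold boxMeasure
      exact ae_restrict_mem hopen.measurableSet
    filter_upwards [key, hm] with x hx hx' using hx hx'
  exact sub_eq_zero.1 h0

theorem weakGradient_eq {n : ℕ} {B : BoxIntegral.Box (Fin n)} {u : L2 B}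
    {g : Fin n → L2 B} (h : IsWeakGradient u g) : weakGradient u = g := by
  have hex : ∃ g : Fin n → L2 B, IsWeakGradient u g := ⟨g, h⟩
  rw [weakGradient, dif_pos hex]
  exact isWeakGradient_unique hex.choose_spec h

theorem faceMeasure_ae_eq {n : ℕ} (B : BoxIntegral.Box (Fin n)) (i : Fin n) (c : ℝ) :
    ∀ᵐ x ∂(faceMeasure B i c), x i = c := by
  rw [faceMeasure_eq]
  have := isFiniteMeasure_update (edgeMeasure B) i (Measure.dirac c)
  refine Measure.tendsto_eval_ae_ae.eventually (p := fun t => t = c) ?_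
  rw [Function.update_self]
  exact (ae_dirac_iff (measurableSet_singleton c)).2 rfl

theorem bdry_memLp_face {n : ℕ} {B : BoxIntegral.Box (Fin n)} (T : L2Boundary B)
    {μ : Measure (Fin n → ℝ)} (hμ : μ ≤ surfaceMeasure B) : MemLp T 2 μ :=
  (Lp.memLp T).mono_measure hμ

theorem bdry_integrable_mul {n : ℕ} {B : BoxIntegral.Box (Fin n)} (T : L2Boundary B)
    {μ : Measure (Fin n → ℝ)} (hμ : μ ≤ surfaceMeasure B) (f : C(Fin n → ℝ, ℝ)) :
    Integrable (fun x => T x * f x) μ :=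
  (bdry_memLp_face T hμ).integrable_mul
    (((carried_surface B).memLp f.continuous 2).mono_measure hμ)

/-- The trace identity determines the trace on each face separately. -/
theorem IsTrace.faces {n : ℕ} {B : BoxIntegral.Box (Fin n)} {u : L2 B} {T T' : L2Boundary B}
    (h : IsTrace u T) (h' : IsTrace u T') (i : Fin n) {φ : (Fin n → ℝ) → ℝ}
    (hφ : ContDiff ℝ ∞ φ) :
    ∫ x, T x * φ x ∂(faceMeasure B i (B.upper i))
        = ∫ x, T' x * φ x ∂(faceMeasure B i (B.upper i)) ∧
      ∫ x, T x * φ x ∂(faceMeasure B i (B.lower i))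
        = ∫ x, T' x * φ x ∂(faceMeasure B i (B.lower i)) := by
  have hlt := B.lower_lt_upper i
  have hne : B.upper i - B.lower i ≠ 0 := by linarith
  -- The affine weight is 1 on the upper face and 0 on the lower one. The trace identity sees only
  -- the difference of the two faces; testing with both `φ` and `ψ` separates them.
  let ψ : (Fin n → ℝ) → ℝ := fun x => φ x * ((x i - B.lower i) / (B.upper i - B.lower i))
  have hψ : ContDiff ℝ ∞ ψ := by
    refine hφ.mul ?_
    exact ((contDiff_apply ℝ ℝ i).sub contDiff_const).div_const _
  have hup : ∀ S : L2Boundary B, ∫ x, S x * ψ x ∂(faceMeasure B i (B.upper i))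
      = ∫ x, S x * φ x ∂(faceMeasure B i (B.upper i)) := fun S => by
    refine integral_congr_ae ?_
    filter_upwards [faceMeasure_ae_eq B i (B.upper i)] with x hx
    simp only [ψ, hx, div_self hne, mul_one]
  have hlo : ∀ S : L2Boundary B, ∫ x, S x * ψ x ∂(faceMeasure B i (B.lower i)) = 0 := fun S => by
    refine integral_eq_zero_of_ae ?_
    filter_upwards [faceMeasure_ae_eq B i (B.lower i)] with x hx
    simp [ψ, hx]
  have e1 := (h i φ hφ).symm.trans (h' i φ hφ)
  have e2 := (h i ψ hψ).symm.trans (h' i ψ hψ)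
  rw [hup, hup, hlo, hlo] at e2
  constructor <;> linarith

theorem ae_surfaceMeasure {n : ℕ} {B : BoxIntegral.Box (Fin n)} {p : (Fin n → ℝ) → Prop}
    (h : ∀ i, (∀ᵐ x ∂(faceMeasure B i (B.lower i)), p x) ∧
      ∀ᵐ x ∂(faceMeasure B i (B.upper i)), p x) : ∀ᵐ x ∂(surfaceMeasure B), p x := by
  rw [ae_iff, surfaceMeasure, Measure.finsetSum_apply]
  refine Finset.sum_eq_zero fun i _ => ?_
  rw [Measure.add_apply, ae_iff.1 (h i).1, ae_iff.1 (h i).2, add_zero]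

theorem isTrace_unique {n : ℕ} {B : BoxIntegral.Box (Fin n)} {u : L2 B} {T T' : L2Boundary B}
    (h : IsTrace u T) (h' : IsTrace u T') : T = T' := by
  have key : ∀ i : Fin n, (T =ᵐ[faceMeasure B i (B.lower i)] T') ∧
      (T =ᵐ[faceMeasure B i (B.upper i)] T') := by
    intro i
    have li : ∀ (S : L2Boundary B) (μ : Measure (Fin n → ℝ)) [IsFiniteMeasure μ],
        μ ≤ surfaceMeasure B → LocallyIntegrable S μ := fun S μ _ hμ =>
      ((bdry_memLp_face S hμ).integrable one_le_two).locallyIntegrable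
    constructor
    · refine ae_eq_of_integral_contDiff_smul_eq (li T _ (faceMeasure_lower_le B i))
        (li T' _ (faceMeasure_lower_le B i)) fun φ hφ _ => ?_
      simp only [smul_eq_mul, mul_comm (φ _)]
      exact (h.faces h' i hφ).2
    · refine ae_eq_of_integral_contDiff_smul_eq (li T _ (faceMeasure_upper_le B i))
        (li T' _ (faceMeasure_upper_le B i)) fun φ hφ _ => ?_
      simp only [smul_eq_mul, mul_comm (φ _)]
      exact (h.faces h' i hφ).1
  exact Lp.ext (ae_surfaceMeasure fun i => key i)

theorem trace_eq {n : ℕ} {B : BoxIntegral.Box (Fin n)} {u : L2 B} {T : L2Boundary B}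
    (h : IsTrace u T) : trace u = T := by
  have hex : ∃ T : L2Boundary B, IsTrace u T := ⟨T, h⟩
  rw [trace, dif_pos hex]
  exact isTrace_unique hex.choose_spec h

/-! ### Continuously differentiable functions: classical derivatives and boundary values are the
weak ones -/

theorem integral_boxLp_mul {n : ℕ} (B : BoxIntegral.Box (Fin n)) (f : C(Fin n → ℝ, ℝ))
    (φ : (Fin n → ℝ) → ℝ) :
    ∫ x, boxLp B f x * φ x ∂(boxMeasure B) = ∫ x, f x * φ x ∂(boxMeasure B) := by
  refine integral_congr_ae ?_
  filter_upwards [coeFn_boxLp B f] with x hx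
  rw [hx]

theorem integral_bdryLp_mul {n : ℕ} (B : BoxIntegral.Box (Fin n)) (f : C(Fin n → ℝ, ℝ))
    (φ : (Fin n → ℝ) → ℝ) {μ : Measure (Fin n → ℝ)} (hμ : μ ≤ surfaceMeasure B) :
    ∫ x, bdryLp B f x * φ x ∂μ = ∫ x, f x * φ x ∂μ := by
  refine integral_congr_ae ?_
  filter_upwards [(Measure.absolutelyContinuous_of_le hμ).ae_le (coeFn_bdryLp B f)] with x hx
  rw [hx]

theorem zero_on_faces_of_tsupport {n : ℕ} (B : BoxIntegral.Box (Fin n)) {φ : (Fin n → ℝ) → ℝ}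
    (hs : tsupport φ ⊆ BoxIntegral.Box.Ioo B) (i : Fin n) (f : (Fin n → ℝ) → ℝ) :
    ∫ x, f x * φ x ∂(faceMeasure B i (B.upper i)) = 0 ∧
      ∫ x, f x * φ x ∂(faceMeasure B i (B.lower i)) = 0 := by
  have h0 : ∀ x : Fin n → ℝ, x i ∉ Ioo (B.lower i) (B.upper i) → φ x = 0 := fun x hx => by
    refine image_eq_zero_of_notMem_tsupport fun hx' => hx ?_
    exact hs hx' i trivial
  constructor
  · refine integral_eq_zero_of_ae ?_
    filter_upwards [faceMeasure_ae_eq B i (B.upper i)] with x hx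
    simp [h0 x (by simp [hx])]
  · refine integral_eq_zero_of_ae ?_
    filter_upwards [faceMeasure_ae_eq B i (B.lower i)] with x hx
    simp [h0 x (by simp [hx])]

theorem isWeakGradient_boxLp {n : ℕ} (B : BoxIntegral.Box (Fin n)) (f : C(Fin n → ℝ, ℝ))
    (hf : ContDiff ℝ 1 f) : IsWeakGradient (boxLp B f) fun i => boxLp B (partialC f hf i) := by
  intro i φ hφ _ hs
  rw [integral_boxLp_mul, integral_boxLp_mul]
  have := gauss_green_mul B i hf (hφ.of_le (by exact_mod_cast le_top))
  rw [(zero_on_faces_of_tsupport B hs i f).1, (zero_on_faces_of_tsupport B hs i f).2] at this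
  simp only [partialC, ContinuousMap.coe_mk]
  linarith

theorem isTrace_boxLp {n : ℕ} (B : BoxIntegral.Box (Fin n)) (f : C(Fin n → ℝ, ℝ))
    (hf : ContDiff ℝ 1 f) : IsTrace (boxLp B f) (bdryLp B f) := by
  intro i φ hφ
  rw [weakGradient_eq (isWeakGradient_boxLp B f hf), integral_boxLp_mul, integral_boxLp_mul,
    integral_bdryLp_mul B f φ (faceMeasure_lower_le B i),
    integral_bdryLp_mul B f φ (faceMeasure_upper_le B i)]
  exact gauss_green_mul B i hf (hφ.of_le (by exact_mod_cast le_top))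

/-- `weakGradient` and `trace` are choices with default values; by uniqueness, any gradient and
trace at hand may replace them. -/
theorem rayleigh_eq {n : ℕ} {B : BoxIntegral.Box (Fin n)} (α : ℝ) {u : L2 B}
    {g : Fin n → L2 B} {T : L2Boundary B} (hg : IsWeakGradient u g) (hT : IsTrace u T) :
    rayleigh α u = (∑ i, ‖g i‖ ^ 2 + α * ‖T‖ ^ 2) / ‖u‖ ^ 2 := by
  rw [rayleigh, weakGradient_eq hg, trace_eq hT]
  simp_rw [norm_sq_eq_integral]

end

noncomputable section

/-! ### The Robin problem on a symmetric interval -/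

/-- `ψ` is the normalized first odd Robin mode on `(-L, L)`, with eigenvalue `μ`
and Robin parameter `-a`. -/
structure IsOddMode (a L μ : ℝ) (ψ : ℝ → ℝ) : Prop where
  contDiff : ContDiff ℝ ∞ ψ
  zero : ψ 0 = 0
  deriv_zero : deriv ψ 0 = 1
  ode : ∀ x, deriv (deriv ψ) x = -μ * ψ x
  pos : ∀ x, 0 < x → x ≤ L → 0 < ψ x
  robin : deriv ψ L = a * ψ L
  odd : ∀ x, ψ (-x) = -ψ x

/-- `cosh (k x)` is the Robin ground state on `(-L, L)` with Robin parameter `-a`. -/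
structure IsGroundRate (a L k : ℝ) : Prop where
  nonneg : 0 ≤ k
  robin : k * Real.sinh (k * L) = a * Real.cosh (k * L)

theorem exists_isGroundRate {a L : ℝ} (ha : 0 ≤ a) (hL : 0 < L) : ∃ k, IsGroundRate a L k := by
  let F : ℝ → ℝ := fun k => k * Real.sinh (k * L) - a * Real.cosh (k * L)
  have hF : Continuous F := by fun_prop
  -- The intermediate value theorem is applied on [0, a + 1/L]. With y = a L + 1, nonnegativity at
  -- the right end amounts to exp (2 y) ≥ 2 a L + 1, which follows from exp x ≥ 1 + x.
  have hK : 0 ≤ a + 1 / L := by positivity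
  have h0 : F 0 ≤ 0 := by simp [F, ha]
  have h1 : 0 ≤ F (a + 1 / L) := by
    have hy : (a + 1 / L) * L = a * L + 1 := by field_simp
    simp only [F, hy]
    have hs : 0 ≤ a * L := by positivity
    rw [Real.sinh_eq, Real.cosh_eq]
    have e1 : Real.exp (-(a * L + 1)) * Real.exp (2 * (a * L + 1)) = Real.exp (a * L + 1) := by
      rw [← Real.exp_add]; congr 1; ring
    have e2 := Real.add_one_le_exp (2 * (a * L + 1))
    have e3 := Real.exp_pos (-(a * L + 1))
    have e4 : (2 * (a * L) + 1) * Real.exp (-(a * L + 1)) ≤ Real.exp (a * L + 1) := by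
      rw [← e1]
      nlinarith
    have e5 : (a + 1 / L) * ((Real.exp (a * L + 1) - Real.exp (-(a * L + 1))) / 2)
        - a * ((Real.exp (a * L + 1) + Real.exp (-(a * L + 1))) / 2)
        = (Real.exp (a * L + 1) - (2 * (a * L) + 1) * Real.exp (-(a * L + 1))) / (2 * L) := by
      field_simp
      ring
    rw [e5]
    exact div_nonneg (by linarith) (by linarith)
  obtain ⟨k, hk, hk0⟩ := intermediate_value_Icc hK hF.continuousOn ⟨h0, h1⟩
  exact ⟨k, hk.1, by simpa [F, sub_eq_zero] using hk0⟩

/-- The Robin condition for sin (q x) / q is F q = 0. Since F also vanishes at 0, a nonzero root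
requires a start point where F > 0, supplied by the slope 1 - a L > 0 at 0. The root satisfies q L ≤
π/2, which keeps the sine positive. -/
theorem exists_isOddMode_sin {a L : ℝ} (ha : 0 ≤ a) (hL : 0 < L) (h : a * L < 1) :
    ∃ μ ψ, IsOddMode a L μ ψ := by
  let F : ℝ → ℝ := fun q => q * Real.cos (q * L) - a * Real.sin (q * L)
  have hF : Continuous F := by fun_prop
  have hF0 : HasDerivAt F (1 - a * L) 0 := by
    have h1 : HasDerivAt (fun q : ℝ => q * L) L 0 := by simpa using (hasDerivAt_id (0:ℝ)).mul_const L
    refine (((hasDerivAt_id (0:ℝ)).mul (h1.cos)).sub ((h1.sin).const_mul a)).congr_deriv ?_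
    simp
  have hR : 0 < Real.pi / 2 / L := by have := Real.pi_pos; positivity
  have h1 : F (Real.pi / 2 / L) ≤ 0 := by
    have : Real.pi / 2 / L * L = Real.pi / 2 := by field_simp
    simp [F, this, ha]
  obtain ⟨e, he0, heR, heF⟩ : ∃ e, 0 < e ∧ e < Real.pi / 2 / L ∧ 0 < F e := by
    have hs : Filter.Tendsto (slope F 0) (nhdsWithin 0 (Ioi 0)) (nhds (1 - a * L)) :=
      hF0.tendsto_slope.mono_left (nhdsWithin_mono _ fun x (hx : 0 < x) => hx.ne')
    have hev := hs.eventually (lt_mem_nhds (show 0 < 1 - a * L by linarith))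
    obtain ⟨e, he, he1, he2⟩ := (hev.and (Ioo_mem_nhdsGT hR)).exists
    refine ⟨e, he1, he2, ?_⟩
    rw [slope_def_field] at he
    have hz : F 0 = 0 := by simp [F]
    rw [hz, sub_zero, sub_zero] at he
    exact (div_pos_iff_of_pos_right he1).1 he
  obtain ⟨q, hq, hq0⟩ := intermediate_value_Icc' heR.le hF.continuousOn ⟨h1, heF.le⟩
  have hqpos : 0 < q := he0.trans_le hq.1
  have hd : ∀ x, HasDerivAt (fun x => Real.sin (q * x) / q) (Real.cos (q * x)) x := fun x => by
    have h1 : HasDerivAt (fun x : ℝ => q * x) q x := by simpa using (hasDerivAt_id x).const_mul q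
    refine (h1.sin.div_const q).congr_deriv ?_
    field_simp
  have hd' : deriv (fun x => Real.sin (q * x) / q) = fun x => Real.cos (q * x) :=
    funext fun x => (hd x).deriv
  refine ⟨q ^ 2, fun x => Real.sin (q * x) / q, ?_, by simp, by rw [hd']; simp, fun x => ?_,
    fun x hx hxL => ?_, ?_, fun x => ?_⟩
  · exact (Real.contDiff_sin.comp (contDiff_const.mul contDiff_id)).div_const _
  · rw [hd']
    have h1 : HasDerivAt (fun x : ℝ => q * x) q x := by simpa using (hasDerivAt_id x).const_mul q
    rw [h1.cos.deriv]
    field_simp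
  · refine div_pos (Real.sin_pos_of_pos_of_lt_pi (by positivity) ?_) hqpos
    have h2 : q * L ≤ Real.pi / 2 := by
      have := mul_le_mul_of_nonneg_right hq.2 hL.le
      rwa [div_mul_cancel₀ _ hL.ne'] at this
    have h3 : q * x ≤ q * L := by gcongr
    linarith [Real.pi_pos]
  · rw [hd']
    have : q * Real.cos (q * L) = a * Real.sin (q * L) := by simpa [F, sub_eq_zero] using hq0
    field_simp
    linarith
  · simp [neg_div]

/-- For a L > 1 the odd eigenvalue is negative and the mode hyperbolic. Now F has negative slope at
0, and F a ≥ 0 because sinh < cosh. -/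
theorem exists_isOddMode_sinh {a L : ℝ} (hL : 0 < L) (h : 1 < a * L) :
    ∃ μ ψ, IsOddMode a L μ ψ := by
  let F : ℝ → ℝ := fun q => q * Real.cosh (q * L) - a * Real.sinh (q * L)
  have hF : Continuous F := by fun_prop
  have ha : 0 < a := by
    by_contra hcon
    nlinarith
  have hF0 : HasDerivAt F (1 - a * L) 0 := by
    have h1 : HasDerivAt (fun q : ℝ => q * L) L 0 := by simpa using (hasDerivAt_id (0:ℝ)).mul_const L
    refine (((hasDerivAt_id (0:ℝ)).mul (h1.cosh)).sub ((h1.sinh).const_mul a)).congr_deriv ?_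
    simp
  have h1 : 0 ≤ F a := by
    have := (Real.sinh_lt_cosh (a * L)).le
    simp only [F]
    nlinarith
  obtain ⟨e, he0, heR, heF⟩ : ∃ e, 0 < e ∧ e < a ∧ F e < 0 := by
    have hs : Filter.Tendsto (slope F 0) (nhdsWithin 0 (Ioi 0)) (nhds (1 - a * L)) :=
      hF0.tendsto_slope.mono_left (nhdsWithin_mono _ fun x (hx : 0 < x) => hx.ne')
    have hev := hs.eventually (gt_mem_nhds (show 1 - a * L < 0 by linarith))
    obtain ⟨e, he, he1, he2⟩ := (hev.and (Ioo_mem_nhdsGT ha)).exists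
    refine ⟨e, he1, he2, ?_⟩
    rw [slope_def_field] at he
    have hz : F 0 = 0 := by simp [F]
    rw [hz, sub_zero, sub_zero] at he
    exact (div_neg_iff.1 he).elim (fun h => absurd h.2 he1.not_gt) (fun h => h.1)
  obtain ⟨q, hq, hq0⟩ := intermediate_value_Icc heR.le hF.continuousOn ⟨heF.le, h1⟩
  have hqpos : 0 < q := he0.trans_le hq.1
  have hd : ∀ x, HasDerivAt (fun x => Real.sinh (q * x) / q) (Real.cosh (q * x)) x := fun x => by
    have h1 : HasDerivAt (fun x : ℝ => q * x) q x := by simpa using (hasDerivAt_id x).const_mul q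
    refine (h1.sinh.div_const q).congr_deriv ?_
    field_simp
  have hd' : deriv (fun x => Real.sinh (q * x) / q) = fun x => Real.cosh (q * x) :=
    funext fun x => (hd x).deriv
  refine ⟨-q ^ 2, fun x => Real.sinh (q * x) / q, ?_, by simp, by rw [hd']; simp, fun x => ?_,
    fun x hx hxL => ?_, ?_, fun x => ?_⟩
  · exact (Real.contDiff_sinh.comp (contDiff_const.mul contDiff_id)).div_const _
  · rw [hd']
    have h1 : HasDerivAt (fun x : ℝ => q * x) q x := by simpa using (hasDerivAt_id x).const_mul q
    rw [h1.cosh.deriv]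
    field_simp
  · exact div_pos (Real.sinh_pos_iff.2 (by positivity)) hqpos
  · rw [hd']
    have : q * Real.cosh (q * L) = a * Real.sinh (q * L) := by simpa [F, sub_eq_zero] using hq0
    field_simp
    linarith
  · simp [neg_div]

theorem exists_isOddMode {a L : ℝ} (ha : 0 ≤ a) (hL : 0 < L) : ∃ μ ψ, IsOddMode a L μ ψ := by
  rcases lt_trichotomy (a * L) 1 with h | h | h
  · exact exists_isOddMode_sin ha hL h
  -- Threshold case: the odd mode is linear and its eigenvalue is 0.
  · have hd : deriv (fun x : ℝ => x) = fun _ => 1 := funext fun x => (hasDerivAt_id x).deriv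
    exact ⟨0, fun x => x, contDiff_id, rfl, by simp, fun x => by simp,
      fun x hx _ => hx, by simp [h], fun _ => rfl⟩
  · exact exists_isOddMode_sinh hL h

/-! ### Comparison arguments for the odd mode -/

namespace IsOddMode

variable {a L μ : ℝ} {ψ : ℝ → ℝ}

theorem hasDerivAt (h : IsOddMode a L μ ψ) (x : ℝ) : HasDerivAt ψ (deriv ψ x) x :=
  (h.contDiff.differentiable (by simp) x).hasDerivAt

theorem contDiff_deriv (h : IsOddMode a L μ ψ) : ContDiff ℝ ∞ (deriv ψ) :=
  (contDiff_infty_iff_deriv.1 h.contDiff).2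

theorem hasDerivAt_deriv (h : IsOddMode a L μ ψ) (x : ℝ) :
    HasDerivAt (deriv ψ) (-μ * ψ x) x := by
  rw [← h.ode]
  exact (h.contDiff_deriv.differentiable (by simp) x).hasDerivAt

/-- First integral of the equation, with value 1 from the normalization at the origin. It makes the
derivative of ψ'/ψ equal to -1/ψ², whatever the sign of μ. -/
theorem energy (h : IsOddMode a L μ ψ) (x : ℝ) : deriv ψ x ^ 2 + μ * ψ x ^ 2 = 1 := by
  have hd : ∀ x, HasDerivAt (fun x => deriv ψ x ^ 2 + μ * ψ x ^ 2) 0 x := fun x => by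
    refine (((h.hasDerivAt_deriv x).pow 2).add (((h.hasDerivAt x).pow 2).const_mul μ)).congr_deriv ?_
    norm_num
    ring
  have := is_const_of_deriv_eq_zero (fun x => (hd x).differentiableAt) (fun x => (hd x).deriv) x 0
  simpa [h.zero, h.deriv_zero] using this

theorem deriv_even (h : IsOddMode a L μ ψ) (x : ℝ) : deriv ψ (-x) = deriv ψ x := by
  have h1 : HasDerivAt (fun y => ψ (-y)) (-deriv ψ (-x)) x := by
    refine ((h.hasDerivAt (-x)).comp x (hasDerivAt_neg x)).congr_deriv ?_
    simp
  have h2 : HasDerivAt (fun y => ψ (-y)) (-deriv ψ x) x := by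
    simp_rw [h.odd]
    exact (h.hasDerivAt x).neg
  linarith [h1.unique h2]

/-- The logarithmic derivative of the odd mode is strictly decreasing. -/
theorem logDeriv_lt (h : IsOddMode a L μ ψ) {x y : ℝ} (hx : 0 < x) (hxy : x < y) (hy : y ≤ L) :
    deriv ψ y / ψ y < deriv ψ x / ψ x := by
  have hd : ∀ t ∈ Icc x y, HasDerivAt (fun t => deriv ψ t / ψ t) (-(1 / ψ t ^ 2)) t := by
    intro t ht
    have hp := h.pos t (hx.trans_le ht.1) (ht.2.trans hy)
    refine ((h.hasDerivAt_deriv t).div (h.hasDerivAt t) hp.ne').congr_deriv ?_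
    have := h.energy t
    field_simp
    linarith
  have hanti : StrictAntiOn (fun t => deriv ψ t / ψ t) (Icc x y) := by
    refine strictAntiOn_of_deriv_neg (convex_Icc x y)
      (fun t ht => (hd t ht).continuousAt.continuousWithinAt) fun t ht => ?_
    rw [interior_Icc] at ht
    rw [(hd t (Ioo_subset_Icc_self ht)).deriv]
    have hp := h.pos t (hx.trans ht.1) (ht.2.le.trans hy)
    have : 0 < 1 / ψ t ^ 2 := by positivity
    linarith
  exact hanti (left_mem_Icc.2 hxy.le) (right_mem_Icc.2 hxy.le) hxy

/-- The odd eigenvalue is strictly decreasing in the length of the interval. -/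
theorem eigenvalue_lt (h : IsOddMode a L μ ψ) {L' μ' : ℝ} {ψ' : ℝ → ℝ}
    (h' : IsOddMode a L' μ' ψ') (hL : 0 < L) (hLL : L < L') : μ' < μ := by
  by_contra hcon
  push Not at hcon
  -- Wronskian of the two modes. If μ ≤ μ', it is nondecreasing on [0, L] and starts at 0, so the
  -- logarithmic derivative of `ψ'` at L is at most a. But that quantity strictly decreases and
  -- equals a only at L' > L.
  have hd : ∀ t, HasDerivAt (fun t => deriv ψ t * ψ' t - ψ t * deriv ψ' t)
      ((μ' - μ) * (ψ t * ψ' t)) t := fun t => by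
    refine (((h.hasDerivAt_deriv t).mul (h'.hasDerivAt t)).sub
      ((h.hasDerivAt t).mul (h'.hasDerivAt_deriv t))).congr_deriv ?_
    ring
  have hmono : MonotoneOn (fun t => deriv ψ t * ψ' t - ψ t * deriv ψ' t) (Icc 0 L) := by
    refine monotoneOn_of_deriv_nonneg (convex_Icc 0 L)
      (fun t _ => (hd t).continuousAt.continuousWithinAt)
      (fun t _ => (hd t).differentiableAt.differentiableWithinAt) fun t ht => ?_
    rw [interior_Icc] at ht
    rw [(hd t).deriv]
    have hp := h.pos t ht.1 ht.2.le
    have hp' := h'.pos t ht.1 (ht.2.le.trans hLL.le)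
    exact mul_nonneg (by linarith) (by positivity)
  have hW := hmono (left_mem_Icc.2 hL.le) (right_mem_Icc.2 hL.le) hL.le
  simp only [h.zero, h'.zero, h.robin, mul_zero, zero_mul, sub_zero] at hW
  have hp := h.pos L hL le_rfl
  have hp' := h'.pos L hL hLL.le
  have hrho := h'.logDeriv_lt hL hLL le_rfl
  rw [h'.robin, mul_div_cancel_right₀ _ (h'.pos L' (hL.trans hLL) le_rfl).ne',
    lt_div_iff₀ hp'] at hrho
  nlinarith

/-- The gap between the first two eigenvalues is positive. -/
theorem gap_pos (h : IsOddMode a L μ ψ) {k : ℝ} (hk : IsGroundRate a L k) (hL : 0 < L) :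
    0 < μ + k ^ 2 := by
  by_contra hcon
  push Not at hcon
  -- Wronskian of the ground state and the odd mode: -1 at the origin and 0 at L by the Robin
  -- conditions. A nonpositive gap would make it nonincreasing.
  have hd : ∀ t, HasDerivAt (fun t => (k * Real.sinh (k * t)) * ψ t - Real.cosh (k * t) * deriv ψ t)
      ((μ + k ^ 2) * (Real.cosh (k * t) * ψ t)) t := fun t => by
    have h1 : HasDerivAt (fun x : ℝ => k * x) k t := by simpa using (hasDerivAt_id t).const_mul k
    refine (((h1.sinh.const_mul k).mul (h.hasDerivAt t)).sub
      (h1.cosh.mul (h.hasDerivAt_deriv t))).congr_deriv ?_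
    ring
  have hanti : AntitoneOn
      (fun t => (k * Real.sinh (k * t)) * ψ t - Real.cosh (k * t) * deriv ψ t) (Icc 0 L) := by
    refine antitoneOn_of_deriv_nonpos (convex_Icc 0 L)
      (fun t _ => (hd t).continuousAt.continuousWithinAt)
      (fun t _ => (hd t).differentiableAt.differentiableWithinAt) fun t ht => ?_
    rw [interior_Icc] at ht
    rw [(hd t).deriv]
    have hp := h.pos t ht.1 ht.2.le
    have := Real.cosh_pos (k * t)
    exact mul_nonpos_of_nonpos_of_nonneg hcon (by positivity)
  have hW := hanti (left_mem_Icc.2 hL.le) (right_mem_Icc.2 hL.le) hL.le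
  simp only [h.zero, h.deriv_zero, h.robin, hk.robin, mul_zero, Real.cosh_zero] at hW
  linarith

/-- Sharp inequality on the half interval, for functions vanishing at the origin. -/
theorem half_inequality (h : IsOddMode a L μ ψ) (hL : 0 < L) {f : ℝ → ℝ} (hf : ContDiff ℝ 1 f)
    (h0 : f 0 = 0) :
    μ * ∫ x in (0:ℝ)..L, f x ^ 2 ≤ (∫ x in (0:ℝ)..L, deriv f x ^ 2) - a * f L ^ 2 := by
  have hfd : ∀ x, HasDerivAt f (deriv f x) x := fun x =>
    (hf.differentiable one_ne_zero x).hasDerivAt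
  have hf' : Continuous (deriv f) := hf.continuous_deriv le_rfl
  -- Jacobi's identity: f'² - μ f² = (f² ψ'/ψ)' + (f' - f ψ'/ψ)², with boundary term a f(L)² at L.
  -- Factoring out f/ψ, which tends to f'(0) at the origin, shows that G is continuous there with
  -- value 0.
  let G : ℝ → ℝ := fun x => f x * deriv ψ x * (f x / ψ x)
  have hG : ∀ x, 0 < x → x ≤ L → HasDerivAt G
      ((deriv f x * deriv ψ x + f x * (-μ * ψ x)) * (f x / ψ x)
        + f x * deriv ψ x * ((deriv f x * ψ x - f x * deriv ψ x) / ψ x ^ 2)) x := fun x hx hxL =>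
    ((hfd x).mul (h.hasDerivAt_deriv x)).mul ((hfd x).div (h.hasDerivAt x) (h.pos x hx hxL).ne')
  have hcont : ContinuousOn G (Icc 0 L) := by
    intro x hx
    rcases hx.1.eq_or_lt with rfl | hx0
    · have hr : Filter.Tendsto (fun x => f x / ψ x) (nhdsWithin 0 {0}ᶜ) (nhds (deriv f 0)) := by
        have h1 := (hfd 0).tendsto_slope
        have h2 := (h.hasDerivAt 0).tendsto_slope
        have h3 := h1.div h2 (by rw [h.deriv_zero]; exact one_ne_zero)
        rw [h.deriv_zero, div_one] at h3
        refine h3.congr' ?_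
        filter_upwards [self_mem_nhdsWithin] with y hy
        have hy' : y ≠ 0 := hy
        simp only [Pi.div_apply, slope_def_field, h0, h.zero, sub_zero]
        exact div_div_div_cancel_right₀ hy' _ _
      have hc : Filter.Tendsto (fun x => f x * deriv ψ x) (nhdsWithin 0 {0}ᶜ) (nhds 0) := by
        have : Continuous fun x => f x * deriv ψ x :=
          hf.continuous.mul h.contDiff_deriv.continuous
        have h4 := this.tendsto 0
        simp only [h0, zero_mul] at h4
        exact h4.mono_left nhdsWithin_le_nhds
      have hG0 : Filter.Tendsto G (nhdsWithin 0 {0}ᶜ) (nhds (G 0)) := by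
        have := hc.mul hr
        rw [zero_mul] at this
        simpa [G, h0] using this
      exact (continuousAt_iff_punctured_nhds.2 hG0).continuousWithinAt
    · exact (hG x hx0 hx.2).continuousAt.continuousWithinAt
  have key := intervalIntegral.sub_le_integral_of_hasDeriv_right_of_le hL.le hcont
    (fun x hx => (hG x hx.1 hx.2.le).hasDerivWithinAt)
    (φ := fun x => deriv f x ^ 2 - μ * f x ^ 2)
    ((by have := hf.continuous; fun_prop : Continuous fun x => deriv f x ^ 2 - μ * f x ^ 2).integrableOn_Icc)
    (fun x hx => by
      have hp := h.pos x hx.1 hx.2.le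
      have : deriv f x ^ 2 - μ * f x ^ 2 - ((deriv f x * deriv ψ x + f x * (-μ * ψ x)) * (f x / ψ x)
          + f x * deriv ψ x * ((deriv f x * ψ x - f x * deriv ψ x) / ψ x ^ 2))
          = (deriv f x - f x * deriv ψ x / ψ x) ^ 2 := by
        field_simp
        ring
      have h2 := sq_nonneg (deriv f x - f x * deriv ψ x / ψ x)
      linarith)
  have hGL : G L = a * f L ^ 2 := by
    have hp := h.pos L hL le_rfl
    simp only [G, h.robin]
    field_simp
  have hG0 : G 0 = 0 := by simp [G, h0]
  rw [hGL, hG0, sub_zero, intervalIntegral.integral_sub, intervalIntegral.integral_const_mul] at key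
  · linarith
  · exact (hf'.pow 2).intervalIntegrable _ _
  · exact ((hf.continuous.pow 2).const_mul μ).intervalIntegrable _ _

end IsOddMode

end

noncomputable section

/-! ### The sharp spectral inequality on an interval -/

theorem hasDerivAt_cosh_mul (k t : ℝ) :
    HasDerivAt (fun t => Real.cosh (k * t)) (k * Real.sinh (k * t)) t := by
  have h1 : HasDerivAt (fun x : ℝ => k * x) k t := by simpa using (hasDerivAt_id t).const_mul k
  refine h1.cosh.congr_deriv ?_
  ring

theorem hasDerivAt_sinh_mul (k t : ℝ) :
    HasDerivAt (fun t => k * Real.sinh (k * t)) (k ^ 2 * Real.cosh (k * t)) t := by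
  have h1 : HasDerivAt (fun x : ℝ => k * x) k t := by simpa using (hasDerivAt_id t).const_mul k
  refine (h1.sinh.const_mul k).congr_deriv ?_
  ring

theorem contDiff_cosh_mul {m : WithTop ℕ∞} (k : ℝ) :
    ContDiff ℝ m (fun t : ℝ => Real.cosh (k * t)) :=
  Real.contDiff_cosh.comp (contDiff_const.mul contDiff_id)

/-- Integration by parts against the ground state. -/
theorem IsGroundRate.integral_deriv_mul {a L k : ℝ} (hk : IsGroundRate a L k) {f : ℝ → ℝ}
    (hf : ContDiff ℝ 1 f) :
    ∫ t in (-L)..L, deriv f t * (k * Real.sinh (k * t))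
      = a * Real.cosh (k * L) * (f L + f (-L))
        - k ^ 2 * ∫ t in (-L)..L, f t * Real.cosh (k * t) := by
  have hfd : ∀ x, HasDerivAt f (deriv f x) x := fun x =>
    (hf.differentiable one_ne_zero x).hasDerivAt
  have hf' : Continuous (deriv f) := hf.continuous_deriv le_rfl
  have hfc := hf.continuous
  have := intervalIntegral.integral_mul_deriv_eq_deriv_mul (a := -L) (b := L)
    (fun x _ => hfd x) (fun x _ => hasDerivAt_sinh_mul k x)
    (hf'.intervalIntegrable _ _) (Continuous.intervalIntegrable (by fun_prop) _ _)
  have e : ∫ t in (-L)..L, f t * (k ^ 2 * Real.cosh (k * t))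
      = k ^ 2 * ∫ t in (-L)..L, f t * Real.cosh (k * t) := by
    rw [← intervalIntegral.integral_const_mul]
    exact intervalIntegral.integral_congr fun t _ => by ring
  have hr := hk.robin
  rw [e] at this
  simp only [mul_neg, Real.sinh_neg] at this
  rw [hr] at this
  linarith

namespace IsOddMode

variable {a L μ : ℝ} {ψ : ℝ → ℝ}

theorem inequality_of_zero (h : IsOddMode a L μ ψ) (hL : 0 < L) {f : ℝ → ℝ}
    (hf : ContDiff ℝ 1 f) (h0 : f 0 = 0) :
    μ * ∫ x in (-L)..L, f x ^ 2
      ≤ (∫ x in (-L)..L, deriv f x ^ 2) - a * (f L ^ 2 + f (-L) ^ 2) := by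
  have hf' : Continuous (deriv f) := hf.continuous_deriv le_rfl
  have hfc := hf.continuous
  have h1 := h.half_inequality hL hf h0
  have h2 := h.half_inequality hL (f := fun x => f (-x)) (hf.comp contDiff_neg) (by simpa using h0)
  have hd : ∀ x, deriv (fun x => f (-x)) x = - deriv f (-x) := fun x => deriv_comp_neg f x
  simp only [hd, neg_sq] at h2
  rw [intervalIntegral.integral_comp_neg (fun x => f x ^ 2),
    intervalIntegral.integral_comp_neg (fun x => deriv f x ^ 2), neg_zero] at h2
  rw [← intervalIntegral.integral_add_adjacent_intervals (a := -L) (b := 0) (c := L)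
      (f := fun x => f x ^ 2) (Continuous.intervalIntegrable (by fun_prop) _ _)
      (Continuous.intervalIntegrable (by fun_prop) _ _),
    ← intervalIntegral.integral_add_adjacent_intervals (a := -L) (b := 0) (c := L)
      (f := fun x => deriv f x ^ 2) (Continuous.intervalIntegrable (by fun_prop) _ _)
      (Continuous.intervalIntegrable (by fun_prop) _ _)]
  linarith

/-- Subtracting c cosh (k x) with c = f(0) produces a function vanishing at 0, to which the previous
inequality applies. As cosh (k x) solves the Robin problem, the energy changes only by -k² times the
change in squared norm. The residual norm for this c is at least the minimal one, attained at c =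
X/N, and the gap multiplying it is positive, so the projection defect may replace it. -/
theorem symm_inequality (h : IsOddMode a L μ ψ) {k : ℝ} (hk : IsGroundRate a L k) (hL : 0 < L)
    {f : ℝ → ℝ} (hf : ContDiff ℝ 1 f) :
    -k ^ 2 * (∫ x in (-L)..L, f x ^ 2) + (μ + k ^ 2) * ((∫ x in (-L)..L, f x ^ 2)
        - (∫ x in (-L)..L, f x * Real.cosh (k * x)) ^ 2 / ∫ x in (-L)..L, Real.cosh (k * x) ^ 2)
      ≤ (∫ x in (-L)..L, deriv f x ^ 2) - a * (f L ^ 2 + f (-L) ^ 2) := by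
  have hfd : ∀ x, HasDerivAt f (deriv f x) x := fun x =>
    (hf.differentiable one_ne_zero x).hasDerivAt
  have hf' : Continuous (deriv f) := hf.continuous_deriv le_rfl
  have hfc := hf.continuous
  set c := f 0
  set F := ∫ x in (-L)..L, f x ^ 2
  set X := ∫ x in (-L)..L, f x * Real.cosh (k * x) with hX
  set N := ∫ x in (-L)..L, Real.cosh (k * x) ^ 2 with hN
  have hNpos : 0 < N := by
    refine intervalIntegral.intervalIntegral_pos_of_pos
      (Continuous.intervalIntegrable (by fun_prop) _ _) (fun x => ?_) (by linarith)
    have := Real.cosh_pos (k * x)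
    positivity
  let g : ℝ → ℝ := fun x => f x - c * Real.cosh (k * x)
  have hg : ContDiff ℝ 1 g := hf.sub (contDiff_const.mul (contDiff_cosh_mul k))
  have hgd : ∀ x, deriv g x = deriv f x - c * (k * Real.sinh (k * x)) := fun x =>
    ((hfd x).sub ((hasDerivAt_cosh_mul k x).const_mul c)).deriv
  have hint : ∀ {u : ℝ → ℝ}, Continuous u → IntervalIntegrable u volume (-L) L := fun hu =>
    hu.intervalIntegrable _ _
  have key := h.inequality_of_zero hL hg (by simp [g, c])
  have e1 : ∫ x in (-L)..L, g x ^ 2 = F - 2 * c * X + c ^ 2 * N := by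
    have : ∀ x, g x ^ 2 = f x ^ 2 - 2 * c * (f x * Real.cosh (k * x))
        + c ^ 2 * Real.cosh (k * x) ^ 2 := fun x => by simp only [g]; ring
    simp_rw [this]
    rw [intervalIntegral.integral_add (hint (by fun_prop)) (hint (by fun_prop)),
      intervalIntegral.integral_sub (hint (by fun_prop)) (hint (by fun_prop)),
      intervalIntegral.integral_const_mul, intervalIntegral.integral_const_mul]
  have e2 : ∫ x in (-L)..L, deriv g x ^ 2 = (∫ x in (-L)..L, deriv f x ^ 2)
      - 2 * c * (∫ x in (-L)..L, deriv f x * (k * Real.sinh (k * x)))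
      + c ^ 2 * ∫ x in (-L)..L, (k * Real.sinh (k * x)) * (k * Real.sinh (k * x)) := by
    have : ∀ x, deriv g x ^ 2 = deriv f x ^ 2 - 2 * c * (deriv f x * (k * Real.sinh (k * x)))
        + c ^ 2 * ((k * Real.sinh (k * x)) * (k * Real.sinh (k * x))) := fun x => by
      rw [hgd]; ring
    simp_rw [this]
    rw [intervalIntegral.integral_add (hint (by fun_prop)) (hint (by fun_prop)),
      intervalIntegral.integral_sub (hint (by fun_prop)) (hint (by fun_prop)),
      intervalIntegral.integral_const_mul, intervalIntegral.integral_const_mul]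
  have e3 : ∫ x in (-L)..L, (k * Real.sinh (k * x)) * (k * Real.sinh (k * x))
      = a * Real.cosh (k * L) * (2 * Real.cosh (k * L)) - k ^ 2 * N := by
    have := hk.integral_deriv_mul (f := fun t => Real.cosh (k * t)) (contDiff_cosh_mul k)
    have hd : deriv (fun t => Real.cosh (k * t)) = fun t => k * Real.sinh (k * t) :=
      funext fun t => (hasDerivAt_cosh_mul k t).deriv
    simp only [hd, mul_neg, Real.cosh_neg, ← sq] at this
    simp only [← sq]
    rw [this]
    ring
  rw [e1, e2, hk.integral_deriv_mul hf, ← hX, e3] at key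
  simp only [g, mul_neg, Real.cosh_neg] at key
  have hgap := h.gap_pos hk hL
  have hsq : F - X ^ 2 / N ≤ F - 2 * c * X + c ^ 2 * N := by
    have : F - 2 * c * X + c ^ 2 * N - (F - X ^ 2 / N) = (c * N - X) ^ 2 / N := by
      field_simp
      ring
    have h2 : 0 ≤ (c * N - X) ^ 2 / N := by positivity
    linarith
  have := mul_le_mul_of_nonneg_left hsq hgap.le
  nlinarith

/-- The sharp spectral inequality on the interval `(l, u)`. -/
theorem interval_inequality {l u : ℝ} (h : IsOddMode a ((u - l) / 2) μ ψ) {k : ℝ}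
    (hk : IsGroundRate a ((u - l) / 2) k) (hlu : l < u) {f : ℝ → ℝ} (hf : ContDiff ℝ 1 f) :
    -k ^ 2 * (∫ x in l..u, f x ^ 2) + (μ + k ^ 2) * ((∫ x in l..u, f x ^ 2)
        - (∫ x in l..u, f x * Real.cosh (k * (x - (l + u) / 2))) ^ 2
          / ∫ x in l..u, Real.cosh (k * (x - (l + u) / 2)) ^ 2)
      ≤ (∫ x in l..u, deriv f x ^ 2) - a * (f u ^ 2 + f l ^ 2) := by
  have hs : ∀ F : ℝ → ℝ, ∫ x in l..u, F x
      = ∫ x in (-((u - l) / 2))..((u - l) / 2), F (x + (l + u) / 2) := fun F => by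
    rw [intervalIntegral.integral_comp_add_right]
    congr 1 <;> ring
  have key := h.symm_inequality hk (by linarith) (f := fun x => f (x + (l + u) / 2))
    (hf.comp (contDiff_id.add contDiff_const))
  simp only [deriv_comp_add_const] at key
  rw [hs, hs, hs, hs]
  simp only [add_sub_cancel_right]
  have e1 : (u - l) / 2 + (l + u) / 2 = u := by ring
  have e2 : -((u - l) / 2) + (l + u) / 2 = l := by ring
  rw [e1, e2] at key
  exact key

end IsOddMode

theorem cauchy_interval {l u : ℝ} (hlu : l < u) {f φ : ℝ → ℝ} (hf : Continuous f)
    (hφ : Continuous φ) (hpos : ∀ x, 0 < φ x) :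
    0 ≤ (∫ x in l..u, f x ^ 2) - (∫ x in l..u, f x * φ x) ^ 2 / ∫ x in l..u, φ x ^ 2 := by
  have hN : 0 < ∫ x in l..u, φ x ^ 2 := by
    refine intervalIntegral.intervalIntegral_pos_of_pos
      (Continuous.intervalIntegrable (by fun_prop) _ _) (fun x => ?_) hlu
    have := hpos x
    positivity
  set N := ∫ x in l..u, φ x ^ 2
  set X := ∫ x in l..u, f x * φ x
  have e : ∫ x in l..u, (f x - X / N * φ x) ^ 2
      = (∫ x in l..u, f x ^ 2) - 2 * (X / N) * X + (X / N) ^ 2 * N := by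
    have : ∀ x, (f x - X / N * φ x) ^ 2
        = f x ^ 2 - 2 * (X / N) * (f x * φ x) + (X / N) ^ 2 * φ x ^ 2 := fun x => by ring
    simp_rw [this]
    rw [intervalIntegral.integral_add (Continuous.intervalIntegrable (by fun_prop) _ _)
        (Continuous.intervalIntegrable (by fun_prop) _ _),
      intervalIntegral.integral_sub (Continuous.intervalIntegrable (by fun_prop) _ _)
        (Continuous.intervalIntegrable (by fun_prop) _ _),
      intervalIntegral.integral_const_mul, intervalIntegral.integral_const_mul]
  have h0 : 0 ≤ ∫ x in l..u, (f x - X / N * φ x) ^ 2 :=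
    intervalIntegral.integral_nonneg hlu.le fun x _ => sq_nonneg _
  rw [e] at h0
  have : 2 * (X / N) * X - (X / N) ^ 2 * N = X ^ 2 / N := by
    field_simp
    ring
  linarith

/-! ### Dependence of the ground state energy on the length -/

/-- The quotient sinh t / t is nondecreasing: its derivative has the sign of t cosh t - sinh t,
which grows from 0. This is the source of the concavity of log (tanh (exp t)). -/
theorem sinh_mul_le {x y : ℝ} (hx : 0 < x) (hxy : x ≤ y) :
    y * Real.sinh x ≤ x * Real.sinh y := by
  have hd : ∀ t, HasDerivAt (fun t => t * Real.cosh t - Real.sinh t) (t * Real.sinh t) t :=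
    fun t => (((hasDerivAt_id t).mul (Real.hasDerivAt_cosh t)).sub
      (Real.hasDerivAt_sinh t)).congr_deriv (by simp)
  have hm : MonotoneOn (fun t => t * Real.cosh t - Real.sinh t) (Ici 0) := by
    refine monotoneOn_of_deriv_nonneg (convex_Ici 0)
      (fun t _ => (hd t).continuousAt.continuousWithinAt)
      (fun t _ => (hd t).differentiableAt.differentiableWithinAt) fun t ht => ?_
    rw [interior_Ici] at ht
    rw [(hd t).deriv]
    exact mul_nonneg (le_of_lt ht) (Real.sinh_nonneg_iff.2 (le_of_lt ht))
  have hq : ∀ t ∈ Ici x, HasDerivAt (fun t => Real.sinh t / t)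
      ((Real.cosh t * t - Real.sinh t * 1) / t ^ 2) t := fun t ht =>
    (Real.hasDerivAt_sinh t).div (hasDerivAt_id t) (hx.trans_le ht).ne'
  have hm2 : MonotoneOn (fun t => Real.sinh t / t) (Ici x) := by
    refine monotoneOn_of_deriv_nonneg (convex_Ici x)
      (fun t ht => (hq t ht).continuousAt.continuousWithinAt)
      (fun t ht => (hq t (interior_subset ht)).differentiableAt.differentiableWithinAt)
      fun t ht => ?_
    rw [(hq t (interior_subset ht)).deriv]
    have ht0 : 0 ≤ t := hx.le.trans (interior_subset ht)
    have := hm self_mem_Ici ht0 ht0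
    simp only [zero_mul, Real.sinh_zero, sub_zero] at this
    exact div_nonneg (by linarith) (sq_nonneg _)
  have := hm2 self_mem_Ici (mem_Ici.2 hxy) hxy
  simp only at this
  rw [div_le_div_iff₀ hx (hx.trans_le hxy)] at this
  linarith

/-- `t ↦ log (tanh (exp t))` lies below its tangent at `t = log q`. -/
theorem log_tanh_tangent {p q : ℝ} (hp : 0 < p) (hq : 0 < q) :
    Real.log (Real.sinh p / Real.cosh p) - 2 * q / Real.sinh (2 * q) * Real.log p
      ≤ Real.log (Real.sinh q / Real.cosh q) - 2 * q / Real.sinh (2 * q) * Real.log q := by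
  set θ := 2 * q / Real.sinh (2 * q) with hθ
  -- The derivative of log (tanh t) with respect to log t is 2 t / sinh (2 t), which is
  -- nonincreasing. Hence the function minus its tangent of slope θ increases up to q and decreases
  -- afterwards.
  have hd : ∀ t, 0 < t → HasDerivAt (fun t => Real.log (Real.sinh t / Real.cosh t) - θ * Real.log t)
      ((2 * t / Real.sinh (2 * t) - θ) / t) t := fun t ht => by
    have hs := Real.sinh_pos_iff.2 ht
    have hc := Real.cosh_pos t
    have h1 := ((Real.hasDerivAt_sinh t).div (Real.hasDerivAt_cosh t) hc.ne').log
      (div_pos hs hc).ne'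
    refine (h1.sub ((Real.hasDerivAt_log ht.ne').const_mul θ)).congr_deriv ?_
    rw [Real.sinh_two_mul]
    have := Real.cosh_sq t
    field_simp
    simp only [Pi.div_apply]
    field_simp
    rw [this]
    ring
  have hmono : ∀ s t, 0 < s → s ≤ t →
      2 * t / Real.sinh (2 * t) ≤ 2 * s / Real.sinh (2 * s) := fun s t hs hst => by
    have h1 := Real.sinh_pos_iff.2 (show 0 < 2 * s by linarith)
    have h2 := Real.sinh_pos_iff.2 (show 0 < 2 * t by linarith)
    rw [div_le_div_iff₀ h2 h1]
    exact sinh_mul_le (by linarith) (by linarith)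
  rcases le_total p q with hpq | hpq
  · have hm : MonotoneOn (fun t => Real.log (Real.sinh t / Real.cosh t) - θ * Real.log t)
        (Icc p q) := by
      refine monotoneOn_of_deriv_nonneg (convex_Icc p q)
        (fun t ht => (hd t (hp.trans_le ht.1)).continuousAt.continuousWithinAt)
        (fun t ht => (hd t (hp.trans_le (interior_subset ht).1)).differentiableAt.differentiableWithinAt)
        fun t ht => ?_
      have ht' := interior_subset ht
      have ht0 : 0 < t := hp.trans_le ht'.1
      rw [(hd t ht0).deriv]
      exact div_nonneg (sub_nonneg.2 (hmono t q ht0 ht'.2)) ht0.le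
    exact hm (left_mem_Icc.2 hpq) (right_mem_Icc.2 hpq) hpq
  · have hm : AntitoneOn (fun t => Real.log (Real.sinh t / Real.cosh t) - θ * Real.log t)
        (Icc q p) := by
      refine antitoneOn_of_deriv_nonpos (convex_Icc q p)
        (fun t ht => (hd t (hq.trans_le ht.1)).continuousAt.continuousWithinAt)
        (fun t ht => (hd t (hq.trans_le (interior_subset ht).1)).differentiableAt.differentiableWithinAt)
        fun t ht => ?_
      have ht' := interior_subset ht
      have ht0 : 0 < t := hq.trans_le ht'.1
      rw [(hd t ht0).deriv]
      exact div_nonpos_of_nonpos_of_nonneg (sub_nonpos.2 (hmono q t hq ht'.1)) ht0.le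
    exact hm (left_mem_Icc.2 hpq) (right_mem_Icc.2 hpq) hpq

theorem IsGroundRate.pos {a L k : ℝ} (hk : IsGroundRate a L k) (ha : 0 < a) : 0 < k := by
  refine hk.nonneg.lt_of_ne fun h0 => ?_
  have := hk.robin
  rw [← h0] at this
  simp at this
  exact ha.ne' this.symm

theorem IsGroundRate.log_eq {a L k : ℝ} (hk : IsGroundRate a L k) (ha : 0 < a) (hL : 0 < L) :
    Real.log (Real.sinh (k * L) / Real.cosh (k * L)) = Real.log a - Real.log k := by
  have hk0 := hk.pos ha
  have hc := Real.cosh_pos (k * L)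
  have hs := Real.sinh_pos_iff.2 (mul_pos hk0 hL)
  rw [← Real.log_div ha.ne' hk0.ne']
  congr 1
  have := hk.robin
  field_simp
  linarith

theorem IsGroundRate.zero {L k : ℝ} (hk : IsGroundRate 0 L k) (hL : 0 < L) : k = 0 := by
  by_contra h
  have h0 : 0 < k := hk.nonneg.lt_of_ne (Ne.symm h)
  have := hk.robin
  have hs := Real.sinh_pos_iff.2 (mul_pos h0 hL)
  nlinarith

/-- The ground state energy lies below its tangent as a function of the logarithm of the length. -/
theorem exists_tangent {a M q : ℝ} (ha : 0 ≤ a) (hM : 0 < M) (hq : IsGroundRate a M q) :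
    ∃ c, 0 ≤ c ∧ ∀ L k, 0 < L → IsGroundRate a L k →
      -k ^ 2 ≤ -q ^ 2 + c * (Real.log L - Real.log M) := by
  rcases ha.eq_or_lt with rfl | ha
  · refine ⟨0, le_rfl, fun L k hL hk => ?_⟩
    rw [hk.zero hL, hq.zero hM]
    simp
  have hq0 := hq.pos ha
  set θ := 2 * (q * M) / Real.sinh (2 * (q * M)) with hθ
  have hθ0 : 0 ≤ θ := by
    have := Real.sinh_pos_iff.2 (show 0 < 2 * (q * M) by positivity)
    positivity
  refine ⟨2 * (θ / (1 + θ)) * q ^ 2, by positivity, fun L k hL hk => ?_⟩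
  have hk0 := hk.pos ha
  have h1 := log_tanh_tangent (mul_pos hk0 hL) (mul_pos hq0 hM)
  rw [hk.log_eq ha hL, hq.log_eq ha hM, Real.log_mul hk0.ne' hL.ne',
    Real.log_mul hq0.ne' hM.ne', ← hθ] at h1
  -- Inserting log (tanh (k L)) = log a - log k in the tangent inequality leaves (1 + θ)(log k - log
  -- q) ≥ -θ (log L - log M). Then exp x ≥ 1 + x with x = 2 (log k - log q) passes to k², which
  -- produces the slope 2 q² θ/(1 + θ).
  have h2 : -(θ / (1 + θ)) * (Real.log L - Real.log M) ≤ Real.log k - Real.log q := by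
    rw [neg_mul, div_mul_eq_mul_div, ← neg_div, div_le_iff₀ (by positivity)]
    linarith
  have h3 := Real.add_one_le_exp (2 * (Real.log k - Real.log q))
  have h4 : q ^ 2 * Real.exp (2 * (Real.log k - Real.log q)) = k ^ 2 := by
    rw [show 2 * (Real.log k - Real.log q) = (Real.log k - Real.log q) + (Real.log k - Real.log q)
      by ring, Real.exp_add, Real.exp_sub, Real.exp_log hk0, Real.exp_log hq0]
    field_simp
  have h5 : q ^ 2 * (2 * (Real.log k - Real.log q) + 1) ≤ k ^ 2 := by
    rw [← h4]
    gcongr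
  have h6 : q ^ 2 * (-(θ / (1 + θ)) * (Real.log L - Real.log M))
      ≤ q ^ 2 * (Real.log k - Real.log q) := by gcongr
  nlinarith

end

noncomputable section

/-! ### Tensorization by commuting projections -/

/-- For commuting orthogonal projections, the defect of the product is at most the sum of the
defects. -/
theorem defect_prod_le {V ι : Type*} [AddCommGroup V] [Module ℝ V] (b : LinearMap.BilinForm ℝ V)
    (hpsd : ∀ v, 0 ≤ b v v) (P : ι → Module.End ℝ V)
    (hadj : ∀ i v w, b (P i v) w = b v (P i w)) (hidem : ∀ i v, P i (P i v) = P i v)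
    (hcomm : ∀ i j v, P i (P j v) = P j (P i v)) (l : List ι) (v : V) :
    b v v - b ((l.map P).prod v) ((l.map P).prod v)
      ≤ (l.map fun i => b v v - b (P i v) (P i v)).sum := by
  have hdef : ∀ i v, b v v - b (P i v) (P i v) = b (v - P i v) (v - P i v) := fun i v => by
    have h1 : b (P i v) v = b (P i v) (P i v) := by
      rw [hadj i v (P i v), hidem, hadj]
    have h2 : b v (P i v) = b (P i v) (P i v) := by rw [← hadj, h1]
    simp only [map_sub, LinearMap.sub_apply, h1, h2]
    ring
  have hcontr : ∀ i v, b (P i v) (P i v) ≤ b v v := fun i v => by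
    have := hpsd (v - P i v)
    rw [← hdef] at this
    linarith
  have hprod : ∀ (l : List ι) (i : ι) (v : V),
      (l.map P).prod (P i v) = P i ((l.map P).prod v) := fun l i => by
    induction l with
    | nil => intro v; simp
    | cons j l ih => intro v; simp [Module.End.mul_apply, ih, hcomm j i]
  induction l generalizing v with
  | nil => simp
  | cons i l ih =>
    -- Telescoping: the defect of the product is the defect of P_i at v plus that of the remaining
    -- product at P_i v. By commutation the latter's single defects are squared norms of P_i (v -
    -- P_j v), and P_i is a contraction.
    have h1 := ih (P i v)
    simp only [List.map_cons, List.prod_cons, List.sum_cons, Module.End.mul_apply]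
    rw [hprod] at h1
    have h2 : (l.map fun j => b (P i v) (P i v) - b (P j (P i v)) (P j (P i v))).sum
        ≤ (l.map fun j => b v v - b (P j v) (P j v)).sum := by
      refine List.sum_le_sum fun j _ => ?_
      rw [hdef, hdef, hcomm j i, ← map_sub]
      exact hcontr _ _
    linarith

/-- Orthogonal projection, in the `i`-th variable, onto the multiples of `φ`. -/
def coordProj {n : ℕ} (B : BoxIntegral.Box (Fin n)) (φ : C(ℝ, ℝ)) (i : Fin n) :
    Module.End ℝ C(Fin n → ℝ, ℝ) where
  toFun v := ⟨fun x => φ (x i) * sliceIntegral B i (fun y => v y * φ (y i)) x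
      / ∫ t in (B.lower i)..(B.upper i), φ t ^ 2, by
    have := continuous_sliceIntegral B i (f := fun y => v y * φ (y i)) (by fun_prop)
    fun_prop⟩
  map_add' v w := by
    ext x
    simp only [ContinuousMap.coe_mk, ContinuousMap.add_apply, sliceIntegral]
    rw [← add_div, ← mul_add, ← intervalIntegral.integral_add]
    · congr 2
      exact intervalIntegral.integral_congr fun t _ => by ring
    all_goals exact Continuous.intervalIntegrable (by fun_prop) _ _
  map_smul' c v := by
    ext x
    simp only [ContinuousMap.coe_mk, ContinuousMap.smul_apply, sliceIntegral, smul_eq_mul,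
      RingHom.id_apply, mul_assoc, intervalIntegral.integral_const_mul]
    ring

variable {n : ℕ} (B : BoxIntegral.Box (Fin n))

theorem sliceIntegral_update (i : Fin n) (f : (Fin n → ℝ) → ℝ) (x : Fin n → ℝ) (t : ℝ) :
    sliceIntegral B i f (Function.update x i t) = sliceIntegral B i f x := by
  simp [sliceIntegral]

theorem coordProj_apply (φ : C(ℝ, ℝ)) (i : Fin n) (v : C(Fin n → ℝ, ℝ)) (x : Fin n → ℝ) :
    coordProj B φ i v x = φ (x i) * sliceIntegral B i (fun y => v y * φ (y i)) x
      / ∫ t in (B.lower i)..(B.upper i), φ t ^ 2 := rfl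

theorem coordProj_update (φ : C(ℝ, ℝ)) (i : Fin n) (v : C(Fin n → ℝ, ℝ)) (x : Fin n → ℝ) (t : ℝ) :
    coordProj B φ i v (Function.update x i t) = φ t * sliceIntegral B i (fun y => v y * φ (y i)) x
      / ∫ t in (B.lower i)..(B.upper i), φ t ^ 2 := by
  rw [coordProj_apply, sliceIntegral_update, Function.update_self]

theorem edge_sq_pos {φ : C(ℝ, ℝ)} (hφ : ∀ t, 0 < φ t) (i : Fin n) :
    0 < ∫ t in (B.lower i)..(B.upper i), φ t ^ 2 := by
  refine intervalIntegral.intervalIntegral_pos_of_pos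
    (Continuous.intervalIntegrable (by fun_prop) _ _) (fun x => ?_) (B.lower_lt_upper i)
  have := hφ x
  positivity

/-- Fixed points of the coordinate projection are the functions proportional to `φ` in the
`i`-th variable. -/
theorem coordProj_eq_self {φ : C(ℝ, ℝ)} (hφ : ∀ t, 0 < φ t) (i : Fin n) (v : C(Fin n → ℝ, ℝ))
    (hv : ∀ x t, v (Function.update x i t) * φ (x i) = v x * φ t) : coordProj B φ i v = v := by
  ext x
  have hN := edge_sq_pos B hφ i
  rw [coordProj_apply, div_eq_iff hN.ne', sliceIntegral, ← intervalIntegral.integral_const_mul,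
    ← intervalIntegral.integral_const_mul]
  refine intervalIntegral.integral_congr fun t _ => ?_
  have := hv x t
  simp only [Function.update_self]
  linear_combination φ t * this

theorem coordProj_idem {φ : C(ℝ, ℝ)} (hφ : ∀ t, 0 < φ t) (i : Fin n) (v : C(Fin n → ℝ, ℝ)) :
    coordProj B φ i (coordProj B φ i v) = coordProj B φ i v := by
  refine coordProj_eq_self B hφ i _ fun x t => ?_
  rw [coordProj_update, coordProj_apply]
  ring

/-- On each line both integrals equal the product of the coefficients of v and w against φ, divided
by the squared norm of φ. -/
theorem coordProj_adj (φ : C(ℝ, ℝ)) (i : Fin n) (v w : C(Fin n → ℝ, ℝ)) :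
    ∫ x, coordProj B φ i v x * w x ∂(boxMeasure B)
      = ∫ x, v x * coordProj B φ i w x ∂(boxMeasure B) := by
  rw [integral_boxMeasure B i (B.lower i) (by fun_prop),
    integral_boxMeasure B i (B.lower i) (by fun_prop)]
  refine integral_congr_ae (.of_forall fun x => ?_)
  set N := ∫ t in (B.lower i)..(B.upper i), φ t ^ 2 with hN
  set S := sliceIntegral B i (fun y => v y * φ (y i)) x with hS
  set R := sliceIntegral B i (fun y => w y * φ (y i)) x with hR
  have e1 : sliceIntegral B i (fun x => coordProj B φ i v x * w x) x = S / N * R := by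
    rw [hR]
    unfold sliceIntegral
    rw [← intervalIntegral.integral_const_mul]
    refine intervalIntegral.integral_congr fun t _ => ?_
    simp only [coordProj_update, Function.update_self, ← hS, ← hN]
    ring
  have e2 : sliceIntegral B i (fun x => v x * coordProj B φ i w x) x = R / N * S := by
    rw [hS]
    unfold sliceIntegral
    rw [← intervalIntegral.integral_const_mul]
    refine intervalIntegral.integral_congr fun t _ => ?_
    simp only [coordProj_update, Function.update_self, ← hR, ← hN]
    ring
  rw [e1, e2]
  ring

/-- For distinct directions both orders give the same double integral against the product of the two
factors, by Fubini. -/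
theorem coordProj_comm (φ : Fin n → C(ℝ, ℝ)) (i j : Fin n) (v : C(Fin n → ℝ, ℝ)) :
    coordProj B (φ i) i (coordProj B (φ j) j v) = coordProj B (φ j) j (coordProj B (φ i) i v) := by
  rcases eq_or_ne i j with rfl | hij
  · rfl
  ext x
  have key : ∀ i j : Fin n, i ≠ j → coordProj B (φ i) i (coordProj B (φ j) j v) x
      = φ i (x i) * φ j (x j) / ((∫ t in (B.lower i)..(B.upper i), φ i t ^ 2)
        * (∫ t in (B.lower j)..(B.upper j), φ j t ^ 2))
        * ∫ t in (B.lower i)..(B.upper i), ∫ s in (B.lower j)..(B.upper j),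
          v (Function.update (Function.update x i t) j s) * φ j s * φ i t := by
    intro i j hij
    rw [coordProj_apply, sliceIntegral]
    simp only [coordProj_apply, sliceIntegral, Function.update_self, Function.update_of_ne hij.symm]
    simp only [intervalIntegral.integral_mul_const]
    rw [← intervalIntegral.integral_const_mul, ← intervalIntegral.integral_div,
      ← intervalIntegral.integral_const_mul]
    refine intervalIntegral.integral_congr fun t _ => ?_
    field_simp
  rw [key i j hij, key j i hij.symm, intervalIntegral_intervalIntegral_swap]
  · rw [mul_comm (φ i (x i)), mul_comm (∫ t in (B.lower i)..(B.upper i), φ i t ^ 2)]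
    congr 1
    refine intervalIntegral.integral_congr fun t _ => intervalIntegral.integral_congr fun s _ => ?_
    rw [Function.update_comm hij]
    ring
  · have hc : Continuous (Function.uncurry fun t s =>
        v (Function.update (Function.update x i t) j s) * φ j s * φ i t) := by
      refine ((v.continuous.comp ?_).mul ((φ j).continuous.comp continuous_snd)).mul
        ((φ i).continuous.comp continuous_fst)
      have h1 : Continuous fun p : ℝ × ℝ => Function.update x i p.1 :=
        continuous_const.update i continuous_fst
      exact h1.update j continuous_snd
    refine (hc.continuousOn.integrableOn_compact
      (isCompact_uIcc.prod isCompact_uIcc)).mono_set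
      (prod_mono uIoc_subset_uIcc uIoc_subset_uIcc)

/-- A function that is invariant under changes of single coordinates is constant. -/
theorem eq_of_update_invariant {h : (Fin n → ℝ) → ℝ}
    (hh : ∀ x i t, h (Function.update x i t) = h x) (x y : Fin n → ℝ) : h x = h y := by
  have : ∀ s : Finset (Fin n), h (s.piecewise x y) = h y := fun s => by
    induction s using Finset.induction_on with
    | empty => simp
    | insert i s _ ih => rw [Finset.piecewise_insert, hh, ih]
  simpa using this Finset.univ

/-- The function `x ↦ ∏ φ i (x i)`. -/
def tensor (φ : Fin n → C(ℝ, ℝ)) : C(Fin n → ℝ, ℝ) := ⟨fun x => ∏ i, φ i (x i), by fun_prop⟩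

theorem tensor_apply (φ : Fin n → C(ℝ, ℝ)) (x : Fin n → ℝ) : tensor φ x = ∏ i, φ i (x i) := rfl

theorem tensor_update (φ : Fin n → C(ℝ, ℝ)) (x : Fin n → ℝ) (i : Fin n) (t : ℝ) :
    tensor φ (Function.update x i t) = φ i t * ∏ j ∈ Finset.univ.erase i, φ j (x j) := by
  rw [tensor_apply, ← Finset.mul_prod_erase _ _ (Finset.mem_univ i), Function.update_self]
  congr 1
  refine Finset.prod_congr rfl fun j hj => ?_
  rw [Function.update_of_ne (Finset.ne_of_mem_erase hj)]

theorem tensor_eq_mul_erase (φ : Fin n → C(ℝ, ℝ)) (x : Fin n → ℝ) (i : Fin n) :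
    tensor φ x = φ i (x i) * ∏ j ∈ Finset.univ.erase i, φ j (x j) :=
  (Finset.mul_prod_erase _ _ (Finset.mem_univ i)).symm

/-- The `L²` inner product of the box on continuous functions. -/
def boxForm : LinearMap.BilinForm ℝ C(Fin n → ℝ, ℝ) :=
  LinearMap.mk₂ ℝ (fun f g => ∫ x, f x * g x ∂(boxMeasure B))
    (fun f f' g => by
      simp only [ContinuousMap.add_apply, add_mul]
      exact integral_add ((carried_box B).integrable (by fun_prop))
        ((carried_box B).integrable (by fun_prop)))
    (fun c f g => by
      simp only [ContinuousMap.smul_apply, smul_eq_mul, mul_assoc]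
      exact integral_const_mul _ _)
    (fun f g g' => by
      simp only [ContinuousMap.add_apply, mul_add]
      exact integral_add ((carried_box B).integrable (by fun_prop))
        ((carried_box B).integrable (by fun_prop)))
    (fun c f g => by
      simp only [ContinuousMap.smul_apply, smul_eq_mul, mul_left_comm _ c]
      exact integral_const_mul _ _)

theorem boxForm_apply (f g : C(Fin n → ℝ, ℝ)) :
    boxForm B f g = ∫ x, f x * g x ∂(boxMeasure B) := rfl

/-- Tensorized defect inequality for functions orthogonal to the product function. -/
theorem norm_sq_le_sum_defect {φ : Fin n → C(ℝ, ℝ)} (hφ : ∀ i t, 0 < φ i t)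
    (v : C(Fin n → ℝ, ℝ)) (hv : ∫ x, v x * tensor φ x ∂(boxMeasure B) = 0) :
    ∫ x, v x ^ 2 ∂(boxMeasure B)
      ≤ ∑ i, (∫ x, v x ^ 2 ∂(boxMeasure B) - ∫ x, coordProj B (φ i) i v x ^ 2 ∂(boxMeasure B)) := by
  let P : Fin n → Module.End ℝ C(Fin n → ℝ, ℝ) := fun i => coordProj B (φ i) i
  have hadj : ∀ i v w, boxForm B (P i v) w = boxForm B v (P i w) := fun i v w =>
    coordProj_adj B (φ i) i v w
  have hidem : ∀ i v, P i (P i v) = P i v := fun i v => coordProj_idem B (hφ i) i v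
  have hcomm : ∀ i j v, P i (P j v) = P j (P i v) := fun i j v => coordProj_comm B φ i j v
  have hpsd : ∀ v, 0 ≤ boxForm B v v := fun v => integral_nonneg fun x => mul_self_nonneg _
  have main := defect_prod_le (boxForm B) hpsd P hadj hidem hcomm (List.finRange n) v
  rw [← Fin.sum_univ_def] at main
  set Q := ((List.finRange n).map P).prod with hQ
  have hfix : ∀ (l : List (Fin n)) (i : Fin n), i ∈ l →
      P i ((l.map P).prod v) = (l.map P).prod v := fun l i hi => by
    induction l with
    | nil => simp at hi
    | cons j l ih =>
      simp only [List.map_cons, List.prod_cons, Module.End.mul_apply]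
      rcases List.mem_cons.1 hi with rfl | hi
      · exact hidem _ _
      · rw [hcomm, ih hi]
  have hwpos : ∀ x, 0 < tensor φ x := fun x => by
    rw [tensor_apply]
    exact Finset.prod_pos fun i _ => hφ i _
  -- Being fixed by every projection, Q v is proportional to φ i in each variable. Its quotient by
  -- the positive function `tensor φ` is thus unaffected by moving any single coordinate, hence
  -- constant.
  have hconst : ∀ x, Q v x = (Q v 0 / tensor φ 0) * tensor φ x := fun x => by
    have := eq_of_update_invariant (h := fun x => Q v x / tensor φ x) (fun x i t => ?_) x 0
    · rw [← this, div_mul_cancel₀ _ (hwpos x).ne']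
    · rw [div_eq_div_iff (hwpos _).ne' (hwpos _).ne', ← hfix _ i (List.mem_finRange i),
        tensor_update, tensor_eq_mul_erase φ x i]
      simp only [P]
      rw [coordProj_update, coordProj_apply]
      ring
  have hw : ∀ i, P i (tensor φ) = tensor φ := fun i =>
    coordProj_eq_self B (hφ i) i _ fun x t => by
      rw [tensor_update, tensor_eq_mul_erase φ x i]
      ring
  have horth : ∀ l : List (Fin n), boxForm B ((l.map P).prod v) (tensor φ) = 0 := fun l => by
    induction l with
    | nil => simpa [boxForm_apply] using hv
    | cons j l ih =>
      simp only [List.map_cons, List.prod_cons, Module.End.mul_apply]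
      rw [hadj, hw, ih]
  -- Q v is a multiple of `tensor φ` and orthogonal to it, so nothing is subtracted on the left of
  -- the defect inequality.
  have hQ0 : boxForm B (Q v) (Q v) = 0 := by
    have e : Q v = (Q v 0 / tensor φ 0) • tensor φ := by
      ext x
      rw [hconst x]
      rfl
    conv_lhs => arg 2; rw [e]
    rw [map_smul, horth, smul_zero]
  rw [hQ0, sub_zero] at main
  simp only [boxForm_apply, ← sq] at main
  exact main

/-! ### The spectral inequality for smooth functions on the box -/

/-- Half the length of the `i`-th edge. -/
def halfEdge (i : Fin n) : ℝ := (B.upper i - B.lower i) / 2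

theorem halfEdge_pos (i : Fin n) : 0 < halfEdge B i := by
  have := B.lower_lt_upper i
  unfold halfEdge
  linarith

/-- The Robin ground state of the `i`-th edge. -/
def groundFactor (k : Fin n → ℝ) (i : Fin n) : C(ℝ, ℝ) :=
  ⟨fun t => Real.cosh (k i * (t - (B.lower i + B.upper i) / 2)), by fun_prop⟩

theorem groundFactor_pos (k : Fin n → ℝ) (i : Fin n) (t : ℝ) : 0 < groundFactor B k i t :=
  Real.cosh_pos _

theorem deriv_comp_update {v : (Fin n → ℝ) → ℝ} (hv : ContDiff ℝ 1 v) (i : Fin n)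
    (x : Fin n → ℝ) (t : ℝ) : deriv (fun s => v (Function.update x i s)) t
      = fderiv ℝ v (Function.update x i t) (Pi.single i 1) :=
  (hasDerivAt_comp_update (hv.differentiable one_ne_zero) i x t).deriv

theorem contDiff_comp_update {v : (Fin n → ℝ) → ℝ} (hv : ContDiff ℝ 1 v) (i : Fin n)
    (x : Fin n → ℝ) : ContDiff ℝ 1 fun s => v (Function.update x i s) :=
  hv.comp (contDiff_update 1 x i)

theorem sliceIntegral_coordProj_sq {φ : C(ℝ, ℝ)} (hφ : ∀ t, 0 < φ t) (i : Fin n)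
    (v : C(Fin n → ℝ, ℝ)) (x : Fin n → ℝ) :
    sliceIntegral B i (fun y => coordProj B φ i v y ^ 2) x
      = (∫ t in (B.lower i)..(B.upper i), v (Function.update x i t) * φ t) ^ 2
        / ∫ t in (B.lower i)..(B.upper i), φ t ^ 2 := by
  have hN := edge_sq_pos B hφ i
  rw [sliceIntegral]
  simp only [coordProj_update]
  set N := ∫ t in (B.lower i)..(B.upper i), φ t ^ 2 with hNdef
  have e : sliceIntegral B i (fun y => v y * φ (y i)) x
      = ∫ t in (B.lower i)..(B.upper i), v (Function.update x i t) * φ t := by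
    simp [sliceIntegral]
  rw [e]
  set X := ∫ t in (B.lower i)..(B.upper i), v (Function.update x i t) * φ t
  have : ∀ t, (φ t * X / N) ^ 2 = X ^ 2 / N ^ 2 * φ t ^ 2 := fun t => by ring
  simp_rw [this]
  rw [intervalIntegral.integral_const_mul, ← hNdef]
  field_simp

theorem coordProj_defect_nonneg {φ : C(ℝ, ℝ)} (hφ : ∀ t, 0 < φ t) (i : Fin n)
    (v : C(Fin n → ℝ, ℝ)) :
    0 ≤ ∫ x, v x ^ 2 ∂(boxMeasure B) - ∫ x, coordProj B φ i v x ^ 2 ∂(boxMeasure B) := by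
  have c1 : Continuous fun x => v x ^ 2 := by fun_prop
  have c2 : Continuous fun x => coordProj B φ i v x ^ 2 := by fun_prop
  have hI : ∀ {f : (Fin n → ℝ) → ℝ}, Continuous f →
      Integrable (sliceIntegral B i f) (faceMeasure B i (B.lower i)) := fun hf =>
    (carried_face B i (lower_mem B i)).integrable (continuous_sliceIntegral B i hf)
  rw [integral_boxMeasure B i (B.lower i) c1, integral_boxMeasure B i (B.lower i) c2,
    ← integral_sub (hI c1) (hI c2)]
  refine integral_nonneg fun x => ?_
  simp only [Pi.zero_apply]
  rw [sliceIntegral_coordProj_sq B hφ]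
  exact cauchy_interval (B.lower_lt_upper i)
    (v.continuous.comp (continuous_const.update i continuous_id)) φ.continuous hφ

/-- The sharp interval inequality on each line parallel to the i-th axis, integrated over a face.
The quotient X²/N in it is the slice integral of the squared projection. -/
theorem direction_inequality {a : ℝ} {k μ : Fin n → ℝ} {ψ : Fin n → ℝ → ℝ} (i : Fin n)
    (hψ : IsOddMode a (halfEdge B i) (μ i) (ψ i)) (hk : IsGroundRate a (halfEdge B i) (k i))
    (v : C(Fin n → ℝ, ℝ)) (hv : ContDiff ℝ 1 v) :
    -k i ^ 2 * (∫ x, v x ^ 2 ∂(boxMeasure B)) + (μ i + k i ^ 2) * (∫ x, v x ^ 2 ∂(boxMeasure B)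
        - ∫ x, coordProj B (groundFactor B k i) i v x ^ 2 ∂(boxMeasure B))
      ≤ (∫ x, partialC v hv i x ^ 2 ∂(boxMeasure B))
        - a * (∫ x, v x ^ 2 ∂(faceMeasure B i (B.lower i))
          + ∫ x, v x ^ 2 ∂(faceMeasure B i (B.upper i))) := by
  have c1 : Continuous fun x => v x ^ 2 := by fun_prop
  have c2 : Continuous fun x => coordProj B (groundFactor B k i) i v x ^ 2 := by fun_prop
  have c3 : Continuous fun x => partialC v hv i x ^ 2 := by fun_prop
  have hIc : ∀ {f : (Fin n → ℝ) → ℝ}, Continuous f →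
      Integrable f (faceMeasure B i (B.lower i)) := fun hf =>
    (carried_face B i (lower_mem B i)).integrable hf
  have hI : ∀ {f : (Fin n → ℝ) → ℝ}, Continuous f →
      Integrable (sliceIntegral B i f) (faceMeasure B i (B.lower i)) := fun hf =>
    hIc (continuous_sliceIntegral B i hf)
  have hu : ∀ s : ℝ, Continuous fun x : Fin n → ℝ => v (Function.update x i s) ^ 2 := fun s =>
    c1.comp (continuous_id.update i continuous_const)
  have hI12 : Integrable (fun x => sliceIntegral B i (fun x => v x ^ 2) x
      - sliceIntegral B i (fun x => coordProj B (groundFactor B k i) i v x ^ 2) x)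
      (faceMeasure B i (B.lower i)) := (hI c1).sub (hI c2)
  have hU : Integrable (fun x => v (Function.update x i (B.lower i)) ^ 2
      + v (Function.update x i (B.upper i)) ^ 2) (faceMeasure B i (B.lower i)) :=
    (hIc (hu _)).add (hIc (hu _))
  rw [integral_boxMeasure B i (B.lower i) c1, integral_boxMeasure B i (B.lower i) c2,
    integral_boxMeasure B i (B.lower i) c3, integral_faceMeasure B i (B.upper i) (B.lower i) c1,
    integral_faceMeasure B i (B.lower i) (B.lower i) c1,
    ← integral_sub (hI c1) (hI c2), ← integral_const_mul, ← integral_const_mul,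
    ← integral_add ((hI c1).const_mul _) (hI12.const_mul _),
    ← integral_add (hIc (hu _)) (hIc (hu _)), ← integral_const_mul,
    ← integral_sub (hI c3) (hU.const_mul _)]
  refine integral_mono (((hI c1).const_mul _).add (hI12.const_mul _))
    ((hI c3).sub (hU.const_mul _)) fun x => ?_
  simp only
  rw [sliceIntegral_coordProj_sq B (groundFactor_pos B k i)]
  have := hψ.interval_inequality hk (B.lower_lt_upper i) (contDiff_comp_update hv i x)
  simp only [deriv_comp_update hv] at this
  rw [add_comm (v (Function.update x i (B.lower i)) ^ 2)]
  exact this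

/-- Spectral data of all edges of the box. -/
structure IsEdgeData (a : ℝ) (k μ : Fin n → ℝ) (ψ : Fin n → ℝ → ℝ) : Prop where
  ground : ∀ i, IsGroundRate a (halfEdge B i) (k i)
  mode : ∀ i, IsOddMode a (halfEdge B i) (μ i) (ψ i)

theorem exists_isEdgeData {a : ℝ} (ha : 0 ≤ a) : ∃ k μ ψ, IsEdgeData B a k μ ψ := by
  choose k hk using fun i => exists_isGroundRate ha (halfEdge_pos B i)
  choose μ ψ h using fun i => exists_isOddMode ha (halfEdge_pos B i)
  exact ⟨k, μ, ψ, hk, h⟩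

variable {B}

/-- Sum of the directional inequalities, discarding the defects, which are nonnegative and carry
positive gaps. -/
theorem IsEdgeData.ground_inequality {a : ℝ} {k μ : Fin n → ℝ} {ψ : Fin n → ℝ → ℝ}
    (h : IsEdgeData B a k μ ψ) (v : C(Fin n → ℝ, ℝ)) (hv : ContDiff ℝ 1 v) :
    (-∑ i, k i ^ 2) * ‖boxLp B v‖ ^ 2
      ≤ ∑ i, ‖boxLp B (partialC v hv i)‖ ^ 2 - a * ‖bdryLp B v‖ ^ 2 := by
  simp only [norm_boxLp_sq, norm_bdryLp_sq]
  rw [integral_surfaceMeasure B ((carried_surface B).integrable (by fun_prop)),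
    Finset.mul_sum, ← Finset.sum_sub_distrib, ← Finset.sum_neg_distrib, Finset.sum_mul]
  refine Finset.sum_le_sum fun i _ => ?_
  have h1 := direction_inequality B i (h.mode i) (h.ground i) v hv
  have h2 := coordProj_defect_nonneg B (groundFactor_pos B k i) i v
  have h3 := mul_nonneg ((h.mode i).gap_pos (h.ground i) (halfEdge_pos B i)).le h2
  linarith

/-- Here the defects are kept with common weight γ, at most every gap. Orthogonality to the ground
state makes their sum at least the full squared norm. -/
theorem IsEdgeData.gap_inequality {a : ℝ} {k μ : Fin n → ℝ} {ψ : Fin n → ℝ → ℝ}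
    (h : IsEdgeData B a k μ ψ) {γ : ℝ} (hγ : 0 ≤ γ) (hγ' : ∀ i, γ ≤ μ i + k i ^ 2)
    (v : C(Fin n → ℝ, ℝ)) (hv : ContDiff ℝ 1 v)
    (horth : inner ℝ (boxLp B v) (boxLp B (tensor (groundFactor B k))) = 0) :
    (-∑ i, k i ^ 2 + γ) * ‖boxLp B v‖ ^ 2
      ≤ ∑ i, ‖boxLp B (partialC v hv i)‖ ^ 2 - a * ‖bdryLp B v‖ ^ 2 := by
  rw [inner_boxLp_boxLp] at horth
  have hdef := mul_le_mul_of_nonneg_left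
    (norm_sq_le_sum_defect B (fun i => groundFactor_pos B k i) v horth) hγ
  rw [add_mul]
  simp only [norm_boxLp_sq, norm_bdryLp_sq]
  refine (add_le_add_right hdef _).trans ?_
  rw [integral_surfaceMeasure B ((carried_surface B).integrable (by fun_prop)),
    Finset.mul_sum, Finset.mul_sum, ← Finset.sum_sub_distrib, ← Finset.sum_neg_distrib,
    Finset.sum_mul, ← Finset.sum_add_distrib]
  refine Finset.sum_le_sum fun i _ => ?_
  have h1 := direction_inequality B i (h.mode i) (h.ground i) v hv
  have h2 := coordProj_defect_nonneg B (groundFactor_pos B k i) i v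
  have h3 := mul_le_mul_of_nonneg_right (hγ' i) h2
  linarith

end

noncomputable section

/-! ### Cutoff functions -/

/-- A smooth step: `0` on `(-∞, 1]` and `1` on `[2, ∞)`. -/
def step (s : ℝ) : ℝ := Real.smoothTransition (s - 1)

theorem contDiff_step : ContDiff ℝ ∞ step :=
  Real.smoothTransition.contDiff.comp (contDiff_id.sub contDiff_const)

theorem step_of_le {s : ℝ} (h : s ≤ 1) : step s = 0 :=
  Real.smoothTransition.zero_of_nonpos (by linarith)

theorem step_of_ge {s : ℝ} (h : 2 ≤ s) : step s = 1 :=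
  Real.smoothTransition.one_of_one_le (by linarith)

theorem abs_step_le (s : ℝ) : |step s| ≤ 1 := by
  rw [step, abs_of_nonneg (Real.smoothTransition.nonneg _)]
  exact Real.smoothTransition.le_one _

theorem hasDerivAt_step (s : ℝ) : HasDerivAt step (deriv step s) s :=
  (contDiff_step.differentiable (by simp) s).hasDerivAt

theorem deriv_step_of_lt {s : ℝ} (h : s < 1) : deriv step s = 0 := by
  have : step =ᶠ[nhds s] fun _ => 0 := by
    filter_upwards [gt_mem_nhds h] with t ht using step_of_le (le_of_lt ht)
  rw [this.deriv_eq, deriv_const]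

theorem deriv_step_of_gt {s : ℝ} (h : 2 < s) : deriv step s = 0 := by
  have : step =ᶠ[nhds s] fun _ => 1 := by
    filter_upwards [lt_mem_nhds h] with t ht using step_of_ge (le_of_lt ht)
  rw [this.deriv_eq, deriv_const]

theorem exists_step_bound : ∃ C, ∀ s, |s * deriv step s| ≤ C := by
  have hc : Continuous fun s => s * deriv step s :=
    continuous_id.mul (contDiff_step.continuous_deriv (by simp))
  obtain ⟨C, hC⟩ := (isCompact_Icc (a := (1:ℝ)) (b := 2)).exists_bound_of_continuousOn
    hc.continuousOn
  have hC0 : 0 ≤ C := (norm_nonneg _).trans (hC 1 (by norm_num))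
  refine ⟨C, fun s => ?_⟩
  rcases lt_or_ge s 1 with h | h
  · simpa [deriv_step_of_lt h] using hC0
  rcases lt_or_ge 2 s with h' | h'
  · simpa [deriv_step_of_gt h'] using hC0
  · exact hC s ⟨h, h'⟩

/-- A smooth cutoff function of the interval `(l, u)`. -/
def cutoff (l u m t : ℝ) : ℝ := step (m * (t - l)) * step (m * (u - t))

theorem contDiff_cutoff (l u m : ℝ) : ContDiff ℝ ∞ (cutoff l u m) :=
  (contDiff_step.comp (contDiff_const.mul (contDiff_id.sub contDiff_const))).mul
    (contDiff_step.comp (contDiff_const.mul (contDiff_const.sub contDiff_id)))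

theorem abs_cutoff_le (l u m t : ℝ) : |cutoff l u m t| ≤ 1 := by
  rw [cutoff, abs_mul]
  exact mul_le_one₀ (abs_step_le _) (abs_nonneg _) (abs_step_le _)

theorem hasDerivAt_cutoff (l u m t : ℝ) : HasDerivAt (cutoff l u m)
    (deriv step (m * (t - l)) * m * step (m * (u - t))
      + step (m * (t - l)) * (deriv step (m * (u - t)) * -m)) t := by
  have h1 : HasDerivAt (fun t : ℝ => m * (t - l)) m t := by
    simpa using ((hasDerivAt_id t).sub_const l).const_mul m
  have h2 : HasDerivAt (fun t : ℝ => m * (u - t)) (-m) t := by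
    simpa using ((hasDerivAt_id t).const_sub u).const_mul m
  exact ((hasDerivAt_step _).comp t h1).mul ((hasDerivAt_step _).comp t h2)

theorem mem_of_cutoff_ne_zero {l u m t : ℝ} (hm : 0 < m) (h : cutoff l u m t ≠ 0) :
    t ∈ Icc (l + 1 / m) (u - 1 / m) := by
  unfold cutoff at h
  have h1 : 1 < m * (t - l) := by
    by_contra hcon
    exact h (by rw [step_of_le (not_lt.1 hcon), zero_mul])
  have h2 : 1 < m * (u - t) := by
    by_contra hcon
    exact h (by rw [step_of_le (not_lt.1 hcon), mul_zero])
  have h1' : 1 / m < t - l := by rw [div_lt_iff₀ hm]; linarith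
  have h2' : 1 / m < u - t := by rw [div_lt_iff₀ hm]; linarith
  constructor <;> linarith

theorem eventually_cutoff {l u t : ℝ} (ht : t ∈ Ioo l u) :
    ∀ᶠ m : ℕ in Filter.atTop,
      cutoff l u ((m : ℝ) + 1) t = 1 ∧ deriv (cutoff l u ((m : ℝ) + 1)) t = 0 := by
  have hlim : Filter.Tendsto (fun m : ℕ => (m : ℝ) + 1) Filter.atTop Filter.atTop :=
    Filter.tendsto_atTop_add_const_right _ _ tendsto_natCast_atTop_atTop
  have e1 := (hlim.atTop_mul_const (sub_pos.2 ht.1)).eventually_gt_atTop 2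
  have e2 := (hlim.atTop_mul_const (sub_pos.2 ht.2)).eventually_gt_atTop 2
  filter_upwards [e1, e2] with m h1 h2
  refine ⟨?_, ?_⟩
  · rw [cutoff, step_of_ge h1.le, step_of_ge h2.le, one_mul]
  · rw [(hasDerivAt_cutoff _ _ _ _).deriv, deriv_step_of_gt h1, deriv_step_of_gt h2]
    ring

/-- The derivative of the cutoff is of size m near the ends, but s step'(s) is bounded, so a factor
dominated by the distance to the ends absorbs it uniformly in m. This is what permits dominated
convergence. -/
theorem exists_cutoff_deriv_bound : ∃ C, ∀ l u m t d y : ℝ, l < t → t < u → 0 ≤ d →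
    |y| ≤ d * (t - l) → |y| ≤ d * (u - t) → |y * deriv (cutoff l u m) t| ≤ d * C := by
  obtain ⟨C, hC⟩ := exists_step_bound
  refine ⟨C + C, fun l u m t d y hl hu hd h1 h2 => ?_⟩
  rw [(hasDerivAt_cutoff _ _ _ _).deriv, mul_add, mul_add]
  refine (abs_add_le _ _).trans (add_le_add ?_ ?_)
  · have e : |y * (deriv step (m * (t - l)) * m * step (m * (u - t)))|
        = |y| * |deriv step (m * (t - l)) * m| * |step (m * (u - t))| := by
      rw [abs_mul, abs_mul, mul_assoc]
    rw [e]
    calc |y| * |deriv step (m * (t - l)) * m| * |step (m * (u - t))|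
        ≤ d * (t - l) * |deriv step (m * (t - l)) * m| * 1 := by
          gcongr
          exact abs_step_le _
      _ = d * |m * (t - l) * deriv step (m * (t - l))| := by
          rw [abs_mul, abs_mul, abs_mul, abs_of_pos (sub_pos.2 hl)]; ring
      _ ≤ d * C := by gcongr; exact hC _
  · have e : |y * (step (m * (t - l)) * (deriv step (m * (u - t)) * -m))|
        = |y| * |deriv step (m * (u - t)) * m| * |step (m * (t - l))| := by
      rw [abs_mul, abs_mul, mul_neg, abs_neg]; ring
    rw [e]
    calc |y| * |deriv step (m * (u - t)) * m| * |step (m * (t - l))|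
        ≤ d * (u - t) * |deriv step (m * (u - t)) * m| * 1 := by
          gcongr
          exact abs_step_le _
      _ = d * |m * (u - t) * deriv step (m * (u - t))| := by
          rw [abs_mul, abs_mul, abs_mul, abs_of_pos (sub_pos.2 hu)]; ring
      _ ≤ d * C := by gcongr; exact hC _

/-! ### Derivatives of product functions -/

variable {n : ℕ}

theorem contDiff_tensor {m : WithTop ℕ∞} {φ : Fin n → C(ℝ, ℝ)} (hφ : ∀ i, ContDiff ℝ m (φ i)) :
    ContDiff ℝ m (tensor φ) := by
  have h : ContDiff ℝ m fun x : Fin n → ℝ => ∏ i, φ i (x i) :=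
    contDiff_prod fun i _ => (hφ i).comp (contDiff_apply ℝ ℝ i)
  exact h

theorem fderiv_tensor {φ : Fin n → C(ℝ, ℝ)} (hφ : ∀ i, ContDiff ℝ 1 (φ i)) (i : Fin n)
    (x : Fin n → ℝ) : fderiv ℝ (tensor φ) x (Pi.single i 1)
      = deriv (φ i) (x i) * ∏ j ∈ Finset.univ.erase i, φ j (x j) := by
  have h1 := hasDerivAt_comp_update ((contDiff_tensor hφ).differentiable one_ne_zero) i x (x i)
  rw [Function.update_eq_self] at h1
  simp only [tensor_update] at h1
  exact h1.unique (((hφ i).differentiable one_ne_zero (x i)).hasDerivAt.mul_const _)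

theorem fderiv_tensor_update {φ : Fin n → C(ℝ, ℝ)} (hφ : ∀ i, ContDiff ℝ 1 (φ i)) (i : Fin n)
    {χ : C(ℝ, ℝ)} (hχ : ∀ t, deriv (φ i) t = χ t) (x : Fin n → ℝ) :
    fderiv ℝ (tensor φ) x (Pi.single i 1) = tensor (Function.update φ i χ) x := by
  rw [fderiv_tensor hφ, tensor_eq_mul_erase _ x i, Function.update_self, hχ]
  congr 1
  refine Finset.prod_congr rfl fun j hj => ?_
  rw [Function.update_of_ne (Finset.ne_of_mem_erase hj)]

/-! ### Testing weak gradients with functions vanishing on two opposite faces -/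

/-- The cutoff function of the box. -/
def boxCutoff (B : BoxIntegral.Box (Fin n)) (m : ℕ) : C(Fin n → ℝ, ℝ) :=
  tensor fun i => ⟨cutoff (B.lower i) (B.upper i) ((m : ℝ) + 1), (contDiff_cutoff _ _ _).continuous⟩

theorem contDiff_boxCutoff (B : BoxIntegral.Box (Fin n)) (m : ℕ) :
    ContDiff ℝ ∞ (boxCutoff B m) := contDiff_tensor fun _ => contDiff_cutoff _ _ _

theorem abs_prod_cutoff_le (B : BoxIntegral.Box (Fin n)) (m : ℝ) (s : Finset (Fin n))
    (x : Fin n → ℝ) : |∏ j ∈ s, cutoff (B.lower j) (B.upper j) m (x j)| ≤ 1 := by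
  rw [Finset.abs_prod]
  exact Finset.prod_le_one (fun _ _ => abs_nonneg _) fun _ _ => abs_cutoff_le _ _ _ _

theorem abs_boxCutoff_le (B : BoxIntegral.Box (Fin n)) (m : ℕ) (x : Fin n → ℝ) :
    |boxCutoff B m x| ≤ 1 :=
  abs_prod_cutoff_le B ((m : ℝ) + 1) Finset.univ x

theorem tsupport_boxCutoff (B : BoxIntegral.Box (Fin n)) (m : ℕ) :
    HasCompactSupport (boxCutoff B m) ∧ tsupport (boxCutoff B m) ⊆ BoxIntegral.Box.Ioo B := by
  have hm : (0:ℝ) < (m : ℝ) + 1 := by positivity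
  let K : Set (Fin n → ℝ) := univ.pi fun i =>
    Icc (B.lower i + 1 / ((m : ℝ) + 1)) (B.upper i - 1 / ((m : ℝ) + 1))
  have hK : IsCompact K := isCompact_univ_pi fun _ => isCompact_Icc
  have hs : Function.support (boxCutoff B m) ⊆ K := fun x hx i _ => by
    refine mem_of_cutoff_ne_zero hm fun h0 => hx ?_
    exact Finset.prod_eq_zero (Finset.mem_univ i) h0
  have ht : tsupport (boxCutoff B m) ⊆ K := closure_minimal hs hK.isClosed
  refine ⟨hK.of_isClosed_subset (isClosed_tsupport _) ht, ht.trans fun x hx i _ => ?_⟩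
  have h1 := hx i trivial
  have : 0 < 1 / ((m : ℝ) + 1) := by positivity
  exact ⟨by linarith [h1.1], by linarith [h1.2]⟩

theorem box_ae_mem (B : BoxIntegral.Box (Fin n)) :
    ∀ᵐ x ∂(boxMeasure B), ∀ i, x i ∈ Ioo (B.lower i) (B.upper i) := by
  have hopen : IsOpen (BoxIntegral.Box.Ioo B : Set (Fin n → ℝ)) :=
    isOpen_set_pi finite_univ fun _ _ => isOpen_Ioo
  have hm : ∀ᵐ x ∂(boxMeasure B), x ∈ (BoxIntegral.Box.Ioo B : Set (Fin n → ℝ)) := by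
    unfold boxMeasure
    exact ae_restrict_mem hopen.measurableSet
  filter_upwards [hm] with x hx i using hx i trivial

/-- A `C¹` function vanishing on the two faces orthogonal to the `i`-th axis is bounded by the
distance to these faces. -/
theorem exists_distance_bound (B : BoxIntegral.Box (Fin n)) (i : Fin n) {φ : (Fin n → ℝ) → ℝ}
    (hφ : ContDiff ℝ 1 φ) (hlo : ∀ x, φ (Function.update x i (B.lower i)) = 0)
    (hup : ∀ x, φ (Function.update x i (B.upper i)) = 0) :
    ∃ d, 0 ≤ d ∧ ∀ x ∈ closedBox B,
      |φ x| ≤ d * (x i - B.lower i) ∧ |φ x| ≤ d * (B.upper i - x i) := by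
  obtain ⟨d, hd⟩ := (isCompact_closedBox B).exists_bound_of_continuousOn
    (continuous_partial hφ i).continuousOn
  refine ⟨max d 0, le_max_right _ _, fun x hx => ?_⟩
  have hb : ∀ t ∈ Icc (B.lower i) (B.upper i),
      ‖fderiv ℝ φ (Function.update x i t) (Pi.single i 1)‖ ≤ max d 0 := fun t ht => by
    refine (hd _ fun j _ => ?_).trans (le_max_left _ _)
    rcases eq_or_ne j i with rfl | hj
    · simpa using ht
    · simpa [Function.update_of_ne hj] using hx j trivial
  have key := fun s t => (convex_Icc (B.lower i) (B.upper i)).norm_image_sub_le_of_norm_hasDerivWithin_le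
    (f := fun s => φ (Function.update x i s)) (x := s) (y := t)
    (fun t _ => (hasDerivAt_comp_update (hφ.differentiable one_ne_zero) i x t).hasDerivWithinAt) hb
  have hxi := hx i trivial
  have k1 := key _ _ (lower_mem B i) hxi
  have k2 := key _ _ (upper_mem B i) hxi
  simp only [Function.update_eq_self, hlo, hup, sub_zero, Real.norm_eq_abs] at k1 k2
  rw [abs_of_nonneg (sub_nonneg.2 hxi.1)] at k1
  rw [abs_sub_comm (x i), abs_of_nonneg (sub_nonneg.2 hxi.2)] at k2
  exact ⟨k1, k2⟩

/-- The function is multiplied by cutoffs of the box and the limit is taken. Only the i-th cutoff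
factor is differentiated, so vanishing on the two faces orthogonal to the i-th axis suffices; no
condition is needed on the other faces. -/
theorem IsWeakGradient.test_of_zero_on_faces {B : BoxIntegral.Box (Fin n)} {u : L2 B}
    {g : Fin n → L2 B} (h : IsWeakGradient u g) (i : Fin n) {φ : (Fin n → ℝ) → ℝ}
    (hφ : ContDiff ℝ ∞ φ) (hlo : ∀ x, φ (Function.update x i (B.lower i)) = 0)
    (hup : ∀ x, φ (Function.update x i (B.upper i)) = 0) :
    ∫ x, u x * fderiv ℝ φ x (Pi.single i 1) ∂(boxMeasure B)
      = - ∫ x, g i x * φ x ∂(boxMeasure B) := by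
  have hφ1 : ContDiff ℝ 1 φ := hφ.of_le (by exact_mod_cast le_top)
  obtain ⟨d, hd0, hd⟩ := exists_distance_bound B i hφ1 hlo hup
  obtain ⟨C, hC⟩ := exists_cutoff_deriv_bound
  obtain ⟨D, hD⟩ := (isCompact_closedBox B).exists_bound_of_continuousOn
    (continuous_partial hφ1 i).continuousOn
  obtain ⟨E, hE⟩ := (isCompact_closedBox B).exists_bound_of_continuousOn hφ1.continuous.continuousOn
  have hder : ∀ m x, fderiv ℝ (fun x => φ x * boxCutoff B m x) x (Pi.single i 1)
      = fderiv ℝ φ x (Pi.single i 1) * boxCutoff B m x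
        + φ x * deriv (cutoff (B.lower i) (B.upper i) ((m : ℝ) + 1)) (x i)
          * ∏ j ∈ Finset.univ.erase i, cutoff (B.lower j) (B.upper j) ((m : ℝ) + 1) (x j) := by
    intro m x
    rw [fderiv_fun_mul (hφ1.differentiable one_ne_zero x)
      ((contDiff_boxCutoff B m).differentiable (by simp) x)]
    simp only [add_apply, smul_apply, smul_eq_mul]
    rw [boxCutoff, fderiv_tensor fun _ => (contDiff_cutoff _ _ _).of_le (by exact_mod_cast le_top)]
    simp only [ContinuousMap.coe_mk]
    ring
  have hid : ∀ m : ℕ, ∫ x, u x * fderiv ℝ (fun x => φ x * boxCutoff B m x) x (Pi.single i 1)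
      ∂(boxMeasure B) = - ∫ x, g i x * (φ x * boxCutoff B m x) ∂(boxMeasure B) := fun m => by
    refine h i _ (hφ.mul (contDiff_boxCutoff B m)) (tsupport_boxCutoff B m).1.mul_left ?_
    exact (tsupport_mul_subset_right).trans (tsupport_boxCutoff B m).2
  have hu : Integrable u (boxMeasure B) := (Lp.memLp u).integrable one_le_two
  have hg : Integrable (g i) (boxMeasure B) := (Lp.memLp (g i)).integrable one_le_two
  have hev : ∀ x : Fin n → ℝ, (∀ i, x i ∈ Ioo (B.lower i) (B.upper i)) → ∀ᶠ m : ℕ in Filter.atTop,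
      boxCutoff B m x = 1 ∧
        deriv (cutoff (B.lower i) (B.upper i) ((m : ℝ) + 1)) (x i) = 0 := fun x hx => by
    have := Filter.eventually_all.2 fun j => eventually_cutoff (hx j)
    filter_upwards [this] with m hm
    refine ⟨?_, (hm i).2⟩
    rw [boxCutoff, tensor_apply]
    exact Finset.prod_eq_one fun j _ => (hm j).1
  have L1 : Filter.Tendsto (fun m : ℕ => ∫ x, u x *
      fderiv ℝ (fun x => φ x * boxCutoff B m x) x (Pi.single i 1) ∂(boxMeasure B)) Filter.atTop
      (nhds (∫ x, u x * fderiv ℝ φ x (Pi.single i 1) ∂(boxMeasure B))) := by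
    refine tendsto_integral_of_dominated_convergence (fun x => ‖u x‖ * (D + d * C))
      (fun m => ?_) (hu.norm.mul_const _) (fun m => ?_) ?_
    · exact hu.aestronglyMeasurable.mul (continuous_partial
        (hφ1.mul ((contDiff_boxCutoff B m).of_le (by exact_mod_cast le_top))) i).aestronglyMeasurable
    · filter_upwards [box_ae_mem B] with x hx
      have hx' : x ∈ closedBox B := fun j _ => Ioo_subset_Icc_self (hx j)
      rw [norm_mul, hder]
      refine mul_le_mul_of_nonneg_left ((norm_add_le _ _).trans (add_le_add ?_ ?_)) (norm_nonneg _)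
      · rw [norm_mul]
        refine (mul_le_mul (hD x hx') (abs_boxCutoff_le B m x) (abs_nonneg _)
          ((norm_nonneg _).trans (hD x hx'))).trans (mul_one D).le
      · rw [norm_mul]
        have := hC _ _ ((m : ℝ) + 1) _ d (φ x) (hx i).1 (hx i).2 hd0 (hd x hx').1 (hd x hx').2
        refine (mul_le_mul this (abs_prod_cutoff_le B _ _ x) (abs_nonneg _)
          ((abs_nonneg _).trans this)).trans (mul_one _).le
    · filter_upwards [box_ae_mem B] with x hx
      refine tendsto_const_nhds.congr' ?_
      filter_upwards [hev x hx] with m hm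
      rw [hder, hm.1, hm.2]
      ring
  have L2 : Filter.Tendsto (fun m : ℕ => - ∫ x, g i x * (φ x * boxCutoff B m x) ∂(boxMeasure B))
      Filter.atTop (nhds (- ∫ x, g i x * φ x ∂(boxMeasure B))) := by
    refine (tendsto_integral_of_dominated_convergence (fun x => ‖g i x‖ * E)
      (fun m => ?_) (hg.norm.mul_const _) (fun m => ?_) ?_).neg
    · exact hg.aestronglyMeasurable.mul
        (hφ1.continuous.mul (boxCutoff B m).continuous).aestronglyMeasurable
    · filter_upwards [box_ae_mem B] with x hx
      have hx' : x ∈ closedBox B := fun j _ => Ioo_subset_Icc_self (hx j)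
      rw [norm_mul, norm_mul]
      refine mul_le_mul_of_nonneg_left ?_ (norm_nonneg _)
      exact (mul_le_mul (hE x hx') (abs_boxCutoff_le B m x) (abs_nonneg _)
        ((norm_nonneg _).trans (hE x hx'))).trans (mul_one E).le
    · filter_upwards [box_ae_mem B] with x hx
      refine tendsto_const_nhds.congr' ?_
      filter_upwards [hev x hx] with m hm
      rw [hm.1, mul_one]
  simp_rw [hid] at L1
  exact tendsto_nhds_unique L1 L2

end

noncomputable section

variable {n : ℕ}

/-! ### Completeness of the products of cosines -/

/-- The Neumann mode `cos (m π (t - l) / (u - l))` of the `i`-th edge. -/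
def cosFactor (B : BoxIntegral.Box (Fin n)) (i : Fin n) (m : ℤ) : C(ℝ, ℝ) :=
  ⟨fun t => Real.cos (m * (Real.pi * ((t - B.lower i) / (B.upper i - B.lower i)))), by fun_prop⟩

/-- The frequency of the Neumann mode. -/
def cosFreq (B : BoxIntegral.Box (Fin n)) (i : Fin n) (m : ℤ) : ℝ :=
  m * (Real.pi / (B.upper i - B.lower i))

/-- The derivative of the Neumann mode. -/
def cosFactorDeriv (B : BoxIntegral.Box (Fin n)) (i : Fin n) (m : ℤ) : C(ℝ, ℝ) :=
  ⟨fun t => -(cosFreq B i m)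
    * Real.sin (m * (Real.pi * ((t - B.lower i) / (B.upper i - B.lower i)))), by fun_prop⟩

theorem hasDerivAt_phase (B : BoxIntegral.Box (Fin n)) (i : Fin n) (m : ℤ) (t : ℝ) :
    HasDerivAt (fun t => (m : ℝ) * (Real.pi * ((t - B.lower i) / (B.upper i - B.lower i))))
      (cosFreq B i m) t := by
  refine (((((hasDerivAt_id t).sub_const (B.lower i)).div_const
    (B.upper i - B.lower i)).const_mul Real.pi).const_mul (m : ℝ)).congr_deriv ?_
  unfold cosFreq
  ring

theorem deriv_cosFactor (B : BoxIntegral.Box (Fin n)) (i : Fin n) (m : ℤ) (t : ℝ) :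
    deriv (cosFactor B i m) t = cosFactorDeriv B i m t := by
  have := (hasDerivAt_phase B i m t).cos
  refine this.deriv.trans ?_
  simp only [cosFactorDeriv, ContinuousMap.coe_mk]
  ring

theorem deriv_cosFactorDeriv (B : BoxIntegral.Box (Fin n)) (i : Fin n) (m : ℤ) (t : ℝ) :
    deriv (cosFactorDeriv B i m) t = (-(cosFreq B i m) ^ 2 • cosFactor B i m) t := by
  have := (hasDerivAt_phase B i m t).sin.const_mul (-(cosFreq B i m))
  refine this.deriv.trans ?_
  simp only [cosFactor, ContinuousMap.coe_smul, ContinuousMap.coe_mk, Pi.smul_apply, smul_eq_mul]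
  ring

theorem contDiff_cosFactor (B : BoxIntegral.Box (Fin n)) (i : Fin n) (m : ℤ) :
    ContDiff ℝ ∞ (cosFactor B i m) :=
  Real.contDiff_cos.comp (contDiff_const.mul (contDiff_const.mul
    ((contDiff_id.sub contDiff_const).div_const _)))

theorem contDiff_cosFactorDeriv (B : BoxIntegral.Box (Fin n)) (i : Fin n) (m : ℤ) :
    ContDiff ℝ ∞ (cosFactorDeriv B i m) :=
  contDiff_const.mul (Real.contDiff_sin.comp (contDiff_const.mul (contDiff_const.mul
    ((contDiff_id.sub contDiff_const).div_const _))))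

theorem cosFactorDeriv_lower (B : BoxIntegral.Box (Fin n)) (i : Fin n) (m : ℤ) :
    cosFactorDeriv B i m (B.lower i) = 0 := by
  simp [cosFactorDeriv]

theorem cosFactorDeriv_upper (B : BoxIntegral.Box (Fin n)) (i : Fin n) (m : ℤ) :
    cosFactorDeriv B i m (B.upper i) = 0 := by
  have := B.lower_lt_upper i
  have h : (B.upper i - B.lower i) / (B.upper i - B.lower i) = 1 := div_self (by linarith)
  simp [cosFactorDeriv, h]

/-- A product of Neumann modes. -/
def cosTensor (B : BoxIntegral.Box (Fin n)) (m : Fin n → ℤ) : C(Fin n → ℝ, ℝ) :=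
  tensor fun i => cosFactor B i (m i)

theorem contDiff_cosTensor (B : BoxIntegral.Box (Fin n)) (m : Fin n → ℤ) :
    ContDiff ℝ ∞ (cosTensor B m) := contDiff_tensor fun _ => contDiff_cosFactor B _ _

/-- The product-to-sum formula in every variable, expanded over all choices of sign. Integer
frequencies keep the differences inside the family, so the span is an algebra. -/
theorem cosTensor_mul (B : BoxIntegral.Box (Fin n)) (m m' : Fin n → ℤ) :
    cosTensor B m * cosTensor B m' = ∑ p : Fin n → Bool, ((1 / 2 : ℝ) ^ n) •
      cosTensor B fun i => if p i then m i + m' i else m i - m' i := by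
  ext x
  rw [ContinuousMap.mul_apply, ContinuousMap.sum_apply]
  simp only [ContinuousMap.smul_apply, smul_eq_mul, cosTensor, tensor_apply]
  rw [← Finset.prod_mul_distrib, ← Finset.mul_sum]
  have h1 : ∀ i, cosFactor B i (m i) (x i) * cosFactor B i (m' i) (x i)
      = 1 / 2 * ∑ b : Bool, cosFactor B i (if b then m i + m' i else m i - m' i) (x i) := fun i => by
    simp only [Fintype.sum_bool, cosFactor, ContinuousMap.coe_mk, if_true, Bool.false_eq_true,
      if_false]
    push_cast
    rw [add_mul, sub_mul, Real.cos_add, Real.cos_sub]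
    ring
  simp_rw [h1]
  rw [Finset.prod_mul_distrib, Finset.prod_const, Finset.card_univ, Fintype.card_fin,
    Finset.prod_univ_sum, Fintype.piFinset_univ]

/-- The algebra of cosine polynomials. -/
def cosAlgebra (B : BoxIntegral.Box (Fin n)) : Subalgebra ℝ C(Fin n → ℝ, ℝ) :=
  (Submodule.span ℝ (range (cosTensor B))).toSubalgebra
    (Submodule.subset_span ⟨0, by
      ext x
      simp [cosTensor, tensor_apply, cosFactor]⟩)
    (fun f g hf hg => by
      induction hf, hg using Submodule.span_induction₂ with
      | mem_mem f g hf hg =>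
        obtain ⟨m, rfl⟩ := hf
        obtain ⟨m', rfl⟩ := hg
        rw [cosTensor_mul]
        exact Submodule.sum_mem _ fun p _ => Submodule.smul_mem _ _ (Submodule.subset_span ⟨_, rfl⟩)
      | zero_left g _ => rw [zero_mul]; exact Submodule.zero_mem _
      | zero_right f _ => rw [mul_zero]; exact Submodule.zero_mem _
      | add_left f f' g _ _ _ h1 h2 => rw [add_mul]; exact Submodule.add_mem _ h1 h2
      | add_right f g g' _ _ _ h1 h2 => rw [mul_add]; exact Submodule.add_mem _ h1 h2
      | smul_left c f g _ _ h => rw [smul_mul_assoc]; exact Submodule.smul_mem _ _ h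
      | smul_right c f g _ _ h => rw [mul_smul_comm]; exact Submodule.smul_mem _ _ h)

theorem mem_cosAlgebra {B : BoxIntegral.Box (Fin n)} {f : C(Fin n → ℝ, ℝ)} :
    f ∈ cosAlgebra B ↔ f ∈ Submodule.span ℝ (range (cosTensor B)) := Iff.rfl

/-- Stone–Weierstrass on the closed box. Points are separated since the phase of the first mode in
direction i runs through [0, π], where the cosine is injective. -/
theorem exists_cosAlgebra_near (B : BoxIntegral.Box (Fin n)) (f : C(Fin n → ℝ, ℝ)) {ε : ℝ}
    (hε : 0 < ε) : ∃ g ∈ cosAlgebra B, ∀ x ∈ closedBox B, |g x - f x| < ε := by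
  have : CompactSpace (closedBox B) := isCompact_iff_compactSpace.1 (isCompact_closedBox B)
  let ι : C(closedBox B, Fin n → ℝ) := ⟨Subtype.val, continuous_subtype_val⟩
  let A : Subalgebra ℝ C(closedBox B, ℝ) := (cosAlgebra B).map (ContinuousMap.compRightAlgHom ℝ ℝ ι)
  have hsep : A.SeparatesPoints := fun x y hxy => by
    obtain ⟨i, hi⟩ : ∃ i, x.1 i ≠ y.1 i := by
      by_contra hcon
      push Not at hcon
      exact hxy (Subtype.ext (funext hcon))
    have hval : ∀ z : Fin n → ℝ, cosTensor B (Pi.single i 1) z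
        = Real.cos (Real.pi * ((z i - B.lower i) / (B.upper i - B.lower i))) := fun z => by
      rw [cosTensor, tensor_eq_mul_erase _ z i, Finset.prod_eq_one, mul_one]
      · simp [cosFactor]
      · intro j hj
        simp [cosFactor, Pi.single_eq_of_ne (Finset.ne_of_mem_erase hj)]
    refine ⟨_, ⟨_, ⟨cosTensor B (Pi.single i 1), Submodule.subset_span ⟨_, rfl⟩, rfl⟩, rfl⟩, ?_⟩
    change cosTensor B (Pi.single i 1) x.1 ≠ cosTensor B (Pi.single i 1) y.1
    rw [hval, hval]
    intro hcos
    have hlt := sub_pos.2 (B.lower_lt_upper i)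
    have hmem : ∀ z ∈ closedBox B,
        Real.pi * ((z i - B.lower i) / (B.upper i - B.lower i)) ∈ Icc 0 Real.pi := fun z hz => by
      have h1 := hz i trivial
      have h2 : 0 ≤ (z i - B.lower i) / (B.upper i - B.lower i) :=
        div_nonneg (by linarith [h1.1]) hlt.le
      have h3 : (z i - B.lower i) / (B.upper i - B.lower i) ≤ 1 := by
        rw [div_le_one hlt]
        linarith [h1.2]
      have := Real.pi_pos
      exact ⟨by positivity, by nlinarith⟩
    have := Real.injOn_cos (hmem _ x.2) (hmem _ y.2) hcos
    have h4 := mul_left_cancel₀ Real.pi_ne_zero this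
    rw [div_left_inj' hlt.ne'] at h4
    exact hi (by linarith)
  obtain ⟨⟨g, hg⟩, hgf⟩ := ContinuousMap.exists_mem_subalgebra_near_continuousMap_of_separatesPoints
    A hsep (f.comp ι) ε hε
  obtain ⟨g', hg', rfl⟩ := hg
  refine ⟨g', hg', fun x hx => ?_⟩
  exact (ContinuousMap.norm_lt_iff _ hε).1 hgf ⟨x, hx⟩

/-- An `L²` function orthogonal to all products of cosines vanishes. -/
theorem eq_zero_of_orthogonal_cosTensor {B : BoxIntegral.Box (Fin n)} {u : L2 B}
    (h : ∀ m, inner ℝ u (boxLp B (cosTensor B m)) = 0) : u = 0 := by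
  have hu : Integrable u (boxMeasure B) := (Lp.memLp u).integrable one_le_two
  have hspan : ∀ f ∈ cosAlgebra B, inner ℝ u (boxLp B f) = 0 := fun f hf => by
    rw [mem_cosAlgebra] at hf
    induction hf using Submodule.span_induction with
    | mem f hf => obtain ⟨m, rfl⟩ := hf; exact h m
    | zero => rw [← zero_smul ℝ (0 : C(Fin n → ℝ, ℝ)), boxLp_smul, zero_smul, inner_zero_right]
    | add f g _ _ hf hg => rw [boxLp_add, inner_add_right, hf, hg, add_zero]
    | smul c f _ hf => rw [boxLp_smul, inner_smul_right, hf, mul_zero]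
  have hall : ∀ f : C(Fin n → ℝ, ℝ), ∫ x, u x * f x ∂(boxMeasure B) = 0 := fun f => by
    set I := ∫ x, ‖u x‖ ∂(boxMeasure B) with hI
    have hI0 : 0 ≤ I := integral_nonneg fun x => norm_nonneg _
    have hb : ∀ ε : ℝ, 0 < ε → |∫ x, u x * f x ∂(boxMeasure B)| ≤ ε * I := fun ε hε => by
      obtain ⟨g, hg, hgf⟩ := exists_cosAlgebra_near B f hε
      have e : ∫ x, u x * f x ∂(boxMeasure B) = ∫ x, u x * (f - g) x ∂(boxMeasure B) := by
        rw [← inner_boxLp_right, ← inner_boxLp_right, boxLp_sub, inner_sub_right, hspan g hg,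
          sub_zero]
      rw [e, hI, ← integral_const_mul, ← Real.norm_eq_abs]
      refine norm_integral_le_of_norm_le (hu.norm.const_mul ε) ?_
      filter_upwards [(carried_box B).ae_mem] with x hx
      rw [norm_mul, mul_comm]
      refine mul_le_mul_of_nonneg_right ?_ (norm_nonneg _)
      have := (hgf x hx).le
      rw [abs_sub_comm] at this
      exact this
    by_contra hne
    have hpos := abs_pos.2 hne
    have := hb (|∫ x, u x * f x ∂(boxMeasure B)| / (2 * (I + 1))) (by positivity)
    have h2 : |∫ x, u x * f x ∂(boxMeasure B)| / (2 * (I + 1)) * I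
        < |∫ x, u x * f x ∂(boxMeasure B)| := by
      rw [div_mul_eq_mul_div, div_lt_iff₀ (by positivity)]
      nlinarith
    linarith
  rw [Lp.eq_zero_iff_ae_eq_zero]
  refine ae_eq_zero_of_integral_contDiff_smul_eq_zero (L2.locallyIntegrable u) fun φ hφ _ => ?_
  simp only [smul_eq_mul, mul_comm (φ _)]
  exact hall ⟨φ, hφ.continuous⟩

/-! ### Density of smooth functions in the Sobolev space -/

/-- Pairs consisting of a function and a candidate for its gradient. -/
abbrev GraphSpace (B : BoxIntegral.Box (Fin n)) : Type :=
  PiLp 2 fun _ : Option (Fin n) => L2 B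

/-- In this form each test function imposes the vanishing of a continuous linear functional of the
pair, which makes the graph a closed subspace. -/
theorem isWeakGradient_iff {B : BoxIntegral.Box (Fin n)} {u : L2 B} {g : Fin n → L2 B} :
    IsWeakGradient u g ↔ ∀ (i : Fin n) (φ : (Fin n → ℝ) → ℝ) (hφ : ContDiff ℝ 1 φ),
      ContDiff ℝ ∞ φ → HasCompactSupport φ → tsupport φ ⊆ BoxIntegral.Box.Ioo B →
      inner ℝ u (boxLp B (partialC φ hφ i)) + inner ℝ (g i) (boxLp B ⟨φ, hφ.continuous⟩) = 0 := by
  simp only [inner_boxLp_right, ← eq_neg_iff_add_eq_zero]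
  constructor
  · intro h i φ _ hφ hc hs
    exact h i φ hφ hc hs
  · intro h i φ hφ hc hs
    exact h i φ (hφ.of_le (by exact_mod_cast le_top)) hφ hc hs

/-- The graph of the weak gradient. -/
def gradientGraph (B : BoxIntegral.Box (Fin n)) : Submodule ℝ (GraphSpace B) where
  carrier := {z | IsWeakGradient (z none) fun i => z (some i)}
  add_mem' {y z} hy hz := by
    rw [mem_ofPred_eq, isWeakGradient_iff] at *
    intro i φ h1 h2 h3 h4
    have e1 := hy i φ h1 h2 h3 h4
    have e2 := hz i φ h1 h2 h3 h4
    simp only [PiLp.add_apply, inner_add_left]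
    linarith
  zero_mem' := by
    rw [mem_ofPred_eq, isWeakGradient_iff]
    intro i φ h1 h2 h3 h4
    simp
  smul_mem' c z hz := by
    rw [mem_ofPred_eq, isWeakGradient_iff] at *
    intro i φ h1 h2 h3 h4
    simp only [PiLp.smul_apply, inner_smul_left]
    rw [← mul_add, hz i φ h1 h2 h3 h4, mul_zero]

theorem mem_gradientGraph {B : BoxIntegral.Box (Fin n)} {z : GraphSpace B} :
    z ∈ gradientGraph B ↔ IsWeakGradient (z none) fun i => z (some i) := Iff.rfl

theorem isClosed_gradientGraph (B : BoxIntegral.Box (Fin n)) :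
    IsClosed (gradientGraph B : Set (GraphSpace B)) := by
  have : (gradientGraph B : Set (GraphSpace B)) = ⋂ (i : Fin n) (φ : (Fin n → ℝ) → ℝ)
      (hφ : ContDiff ℝ 1 φ) (_ : ContDiff ℝ ∞ φ) (_ : HasCompactSupport φ)
      (_ : tsupport φ ⊆ BoxIntegral.Box.Ioo B), {z : GraphSpace B |
        inner ℝ (z none) (boxLp B (partialC φ hφ i))
          + inner ℝ (z (some i)) (boxLp B ⟨φ, hφ.continuous⟩) = 0} := by
    ext z
    simp only [SetLike.mem_coe, mem_gradientGraph, isWeakGradient_iff, mem_iInter, mem_ofPred_eq]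
  rw [this]
  refine isClosed_iInter fun i => isClosed_iInter fun φ => isClosed_iInter fun hφ =>
    isClosed_iInter fun _ => isClosed_iInter fun _ => isClosed_iInter fun _ => ?_
  exact isClosed_eq (by fun_prop) continuous_const

/-- The graph element of a `C¹` function. -/
def smoothGraph (B : BoxIntegral.Box (Fin n)) (v : C(Fin n → ℝ, ℝ)) (hv : ContDiff ℝ 1 v) :
    GraphSpace B :=
  WithLp.toLp 2 fun o => o.elim (boxLp B v) fun i => boxLp B (partialC v hv i)

theorem smoothGraph_mem (B : BoxIntegral.Box (Fin n)) (v : C(Fin n → ℝ, ℝ))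
    (hv : ContDiff ℝ 1 v) : smoothGraph B v hv ∈ gradientGraph B :=
  isWeakGradient_boxLp B v hv

theorem partialC_add {f g : C(Fin n → ℝ, ℝ)} (hf : ContDiff ℝ 1 f) (hg : ContDiff ℝ 1 g)
    (h : ContDiff ℝ 1 (f + g : C(Fin n → ℝ, ℝ))) (i : Fin n) :
    partialC (f + g : C(Fin n → ℝ, ℝ)) h i = partialC f hf i + partialC g hg i := by
  ext x
  simp only [partialC, ContinuousMap.coe_mk, ContinuousMap.add_apply, ContinuousMap.coe_add]
  rw [fderiv_add (hf.differentiable one_ne_zero x) (hg.differentiable one_ne_zero x)]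
  simp

theorem partialC_smul {f : C(Fin n → ℝ, ℝ)} (hf : ContDiff ℝ 1 f) (c : ℝ)
    (h : ContDiff ℝ 1 (c • f : C(Fin n → ℝ, ℝ))) (i : Fin n) :
    partialC (c • f : C(Fin n → ℝ, ℝ)) h i = c • partialC f hf i := by
  ext x
  simp only [partialC, ContinuousMap.coe_mk, ContinuousMap.smul_apply, ContinuousMap.coe_smul]
  rw [fderiv_const_smul (hf.differentiable one_ne_zero x)]
  simp

/-- The graph elements of `C¹` functions. -/
def smoothGraphs (B : BoxIntegral.Box (Fin n)) : Submodule ℝ (GraphSpace B) where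
  carrier := {z | ∃ v hv, z = smoothGraph B v hv}
  add_mem' := by
    rintro _ _ ⟨v, hv, rfl⟩ ⟨w, hw, rfl⟩
    refine ⟨v + w, hv.add hw, ?_⟩
    ext1 o
    cases o with
    | none => exact (boxLp_add B v w).symm
    | some i =>
      change _ = boxLp B (partialC _ _ i)
      rw [partialC_add hv hw, boxLp_add]
      rfl
  zero_mem' := by
    have h0 : ContDiff ℝ 1 (0 : C(Fin n → ℝ, ℝ)) := contDiff_const
    have h0' : ContDiff ℝ 1 ((0 : ℝ) • (0 : C(Fin n → ℝ, ℝ)) : C(Fin n → ℝ, ℝ)) := by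
      rw [zero_smul]; exact h0
    refine ⟨(0 : ℝ) • 0, h0', ?_⟩
    ext1 o
    cases o with
    | none =>
      change 0 = boxLp B _
      rw [boxLp_smul, zero_smul]
    | some i =>
      change 0 = boxLp B (partialC _ _ i)
      rw [partialC_smul h0, boxLp_smul, zero_smul]
  smul_mem' := by
    rintro c _ ⟨v, hv, rfl⟩
    refine ⟨c • v, contDiff_const.smul hv, ?_⟩
    ext1 o
    cases o with
    | none => exact (boxLp_smul B c v).symm
    | some i =>
      change _ = boxLp B (partialC _ _ i)
      rw [partialC_smul hv, boxLp_smul]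
      rfl

/-- A weak gradient pair orthogonal to all smooth pairs vanishes. -/
theorem eq_zero_of_mem_orthogonal {B : BoxIntegral.Box (Fin n)} {z : GraphSpace B}
    (hz : z ∈ gradientGraph B) (horth : z ∈ (smoothGraphs B)ᗮ) : z = 0 := by
  rw [mem_gradientGraph] at hz
  have hu : z none = 0 := by
    refine eq_zero_of_orthogonal_cosTensor fun m => ?_
    have hv1 : ContDiff ℝ 1 (cosTensor B m) :=
      (contDiff_cosTensor B m).of_le (by exact_mod_cast le_top)
    have h0 := (Submodule.mem_orthogonal' _ _).1 horth _ ⟨cosTensor B m, hv1, rfl⟩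
    rw [PiLp.inner_apply, Fintype.sum_option] at h0
    change inner ℝ (z none) (boxLp B (cosTensor B m))
      + ∑ i, inner ℝ (z (some i)) (boxLp B (partialC (cosTensor B m) hv1 i)) = 0 at h0
    -- The i-th derivative of a cosine product carries a sine in the i-th variable, so it vanishes
    -- on both faces and is an admissible test function; a second derivative returns -ω_i² times the
    -- cosine product. Orthogonality then reads (1 + ∑ ω_i²) ⟨u, cosine product⟩ = 0, and
    -- completeness gives u = 0.
    have hi : ∀ i, inner ℝ (z (some i)) (boxLp B (partialC (cosTensor B m) hv1 i))
        = cosFreq B i (m i) ^ 2 * inner ℝ (z none) (boxLp B (cosTensor B m)) := fun i => by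
      have hfac : ∀ j, ContDiff ℝ ∞ (Function.update (fun j => cosFactor B j (m j)) i
          (cosFactorDeriv B i (m i)) j) := fun j => by
        rcases eq_or_ne j i with rfl | hj
        · rw [Function.update_self]; exact contDiff_cosFactorDeriv B _ _
        · rw [Function.update_of_ne hj]; exact contDiff_cosFactor B _ _
      set φ := tensor (Function.update (fun j => cosFactor B j (m j)) i
          (cosFactorDeriv B i (m i))) with hφ
      have e1 : partialC (cosTensor B m) hv1 i = φ := by
        ext x
        exact fderiv_tensor_update (fun j => (contDiff_cosFactor B j (m j)).of_le
          (by exact_mod_cast le_top)) i (deriv_cosFactor B i (m i)) x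
      have htest := hz.test_of_zero_on_faces i (contDiff_tensor hfac)
        (fun x => by
          rw [tensor_update, Function.update_self, cosFactorDeriv_lower, zero_mul])
        (fun x => by
          rw [tensor_update, Function.update_self, cosFactorDeriv_upper, zero_mul])
      have e2 : ∀ x, fderiv ℝ φ x (Pi.single i 1)
          = (-(cosFreq B i (m i)) ^ 2 • cosTensor B m) x := fun x => by
        rw [hφ, fderiv_tensor_update (fun j => (hfac j).of_le (by exact_mod_cast le_top)) i
          (χ := -(cosFreq B i (m i)) ^ 2 • cosFactor B i (m i)) (fun t => by
            rw [Function.update_self]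
            exact deriv_cosFactorDeriv B i (m i) t), Function.update_idem,
          tensor_eq_mul_erase _ x i, Function.update_self, ContinuousMap.smul_apply,
          ContinuousMap.smul_apply, smul_eq_mul, smul_eq_mul, cosTensor, tensor_eq_mul_erase _ x i,
          mul_assoc]
        congr 2
        refine Finset.prod_congr rfl fun j hj => ?_
        rw [Function.update_of_ne (Finset.ne_of_mem_erase hj)]
      simp only [← hφ, e2] at htest
      rw [← inner_boxLp_right, ← inner_boxLp_right, boxLp_smul, inner_smul_right] at htest
      rw [e1]
      linarith
    simp only [hi, ← Finset.sum_mul] at h0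
    have h1 : (1 + ∑ i, cosFreq B i (m i) ^ 2)
        * inner ℝ (z none) (boxLp B (cosTensor B m)) = 0 := by linarith
    have h2 : 0 < 1 + ∑ i, cosFreq B i (m i) ^ 2 := by positivity
    exact (mul_eq_zero.1 h1).resolve_left h2.ne'
  have hg : (fun i => z (some i)) = 0 := by
    refine isWeakGradient_unique (u := z none) hz ?_
    rw [hu, isWeakGradient_iff]
    intro i φ _ _ _ _
    simp
  ext1 o
  cases o with
  | none => exact hu
  | some i => exact congrFun hg i

/-- Projection theorem: the closure of the smooth graphs lies in the closed gradient graph, so the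
component of z orthogonal to it is again in the graph and must vanish. -/
theorem gradientGraph_le_closure (B : BoxIntegral.Box (Fin n)) :
    gradientGraph B ≤ (smoothGraphs B).topologicalClosure := by
  intro z hz
  set K := (smoothGraphs B).topologicalClosure with hK
  have hKle : K ≤ gradientGraph B := by
    refine Submodule.topologicalClosure_minimal _ ?_ (isClosed_gradientGraph B)
    rintro _ ⟨v, hv, rfl⟩
    exact smoothGraph_mem B v hv
  have : CompleteSpace K := (Submodule.isClosed_topologicalClosure _).completeSpace_coe
  obtain ⟨y, hy, r, hr, rfl⟩ := K.exists_add_mem_mem_orthogonal z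
  have hrG : r ∈ gradientGraph B := by
    have := (gradientGraph B).sub_mem hz (hKle hy)
    simpa using this
  have hr' : r ∈ (smoothGraphs B)ᗮ :=
    Submodule.orthogonal_le (Submodule.le_topologicalClosure _) hr
  rw [eq_zero_of_mem_orthogonal hrG hr', add_zero]
  exact hy

/-- Smooth functions are dense in the Sobolev space. -/
theorem IsWeakGradient.exists_approx {B : BoxIntegral.Box (Fin n)} {u : L2 B}
    {g : Fin n → L2 B} (h : IsWeakGradient u g) :
    ∃ (v : ℕ → C(Fin n → ℝ, ℝ)) (hv : ∀ m, ContDiff ℝ 1 (v m)),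
      Filter.Tendsto (fun m => boxLp B (v m)) Filter.atTop (nhds u) ∧
      ∀ i, Filter.Tendsto (fun m => boxLp B (partialC (v m) (hv m) i)) Filter.atTop
        (nhds (g i)) := by
  let z : GraphSpace B := WithLp.toLp 2 fun o => o.elim u g
  have hz : z ∈ closure (smoothGraphs B : Set (GraphSpace B)) :=
    gradientGraph_le_closure B (show z ∈ gradientGraph B from h)
  obtain ⟨s, hs, hlim⟩ := mem_closure_iff_seq_limit.1 hz
  choose v hv hsv using hs
  refine ⟨v, hv, ?_, fun i => ?_⟩
  · have := ((PiLp.continuous_apply 2 _ none).tendsto z).comp hlim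
    refine this.congr fun m => ?_
    simp only [Function.comp, hsv]
    rfl
  · have := ((PiLp.continuous_apply 2 _ (some i)).tendsto z).comp hlim
    refine this.congr fun m => ?_
    simp only [Function.comp, hsv]
    rfl

end

noncomputable section

variable {n : ℕ}

/-! ### Traces of Sobolev functions -/

theorem partialC_sub {f g : C(Fin n → ℝ, ℝ)} (hf : ContDiff ℝ 1 f) (hg : ContDiff ℝ 1 g)
    (h : ContDiff ℝ 1 (f - g : C(Fin n → ℝ, ℝ))) (i : Fin n) :
    partialC (f - g : C(Fin n → ℝ, ℝ)) h i = partialC f hf i - partialC g hg i := by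
  ext x
  simp only [partialC, ContinuousMap.coe_mk, ContinuousMap.sub_apply, ContinuousMap.coe_sub]
  rw [fderiv_sub (hf.differentiable one_ne_zero x) (hg.differentiable one_ne_zero x)]
  simp

theorem bdryLp_smul (B : BoxIntegral.Box (Fin n)) (c : ℝ) (f : C(Fin n → ℝ, ℝ)) :
    bdryLp B (c • f) = c • bdryLp B f := MemLp.toLp_const_smul _ _

theorem abs_integral_bdry_le {B : BoxIntegral.Box (Fin n)} (S : L2Boundary B)
    {ν : Measure (Fin n → ℝ)} (hν : ν ≤ surfaceMeasure B) (f : C(Fin n → ℝ, ℝ)) :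
    |∫ x, S x * f x ∂ν| ≤ ‖S‖ * ‖bdryLp B |f|‖ := by
  have hint := bdry_integrable_mul S le_rfl f
  calc |∫ x, S x * f x ∂ν| ≤ ∫ x, ‖S x * f x‖ ∂ν := norm_integral_le_integral_norm (μ := ν) fun x => S x * f x
    _ ≤ ∫ x, ‖S x * f x‖ ∂(surfaceMeasure B) :=
        integral_mono_measure hν (.of_forall fun x => norm_nonneg _) hint.norm
    _ = inner ℝ |S| (bdryLp B |f|) := by
        rw [inner_eq_integral]
        refine integral_congr_ae ?_
        filter_upwards [coeFn_bdryLp B |f|, Lp.coeFn_abs S] with x h1 h2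
        rw [h1, h2, norm_mul]
        rfl
    _ ≤ ‖|S|‖ * ‖bdryLp B |f|‖ := real_inner_le_norm _ _
    _ = ‖S‖ * ‖bdryLp B |f|‖ := by rw [norm_abs_eq_norm]

theorem tendsto_integral_bdry {B : BoxIntegral.Box (Fin n)} {S : ℕ → L2Boundary B}
    {T : L2Boundary B} (hS : Filter.Tendsto S Filter.atTop (nhds T))
    {ν : Measure (Fin n → ℝ)} (hν : ν ≤ surfaceMeasure B) (f : C(Fin n → ℝ, ℝ)) :
    Filter.Tendsto (fun m => ∫ x, S m x * f x ∂ν) Filter.atTop (nhds (∫ x, T x * f x ∂ν)) := by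
  rw [tendsto_iff_norm_sub_tendsto_zero]
  have h0 : Filter.Tendsto (fun m => ‖S m - T‖ * ‖bdryLp B |f|‖) Filter.atTop (nhds 0) := by
    have := (tendsto_iff_norm_sub_tendsto_zero.1 hS).mul_const ‖bdryLp B |f|‖
    rwa [zero_mul] at this
  refine squeeze_zero (fun _ => norm_nonneg _) (fun m => ?_) h0
  have e : ∫ x, S m x * f x ∂ν - ∫ x, T x * f x ∂ν = ∫ x, (S m - T : L2Boundary B) x * f x ∂ν := by
    rw [← integral_sub (bdry_integrable_mul _ hν f) (bdry_integrable_mul _ hν f)]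
    refine integral_congr_ae ?_
    filter_upwards [(Measure.absolutelyContinuous_of_le hν).ae_le (Lp.coeFn_sub (S m) T)] with x hx
    rw [hx, Pi.sub_apply, sub_mul]
  rw [e]
  exact abs_integral_bdry_le _ hν f

/-- `v` is a sequence of `C¹` functions converging to `u`, together with the gradients and the
boundary values. -/
structure Approximates {B : BoxIntegral.Box (Fin n)} (v : ℕ → C(Fin n → ℝ, ℝ))
    (hv : ∀ m, ContDiff ℝ 1 (v m)) (u : L2 B) (g : Fin n → L2 B) (T : L2Boundary B) : Prop where
  tendsto : Filter.Tendsto (fun m => boxLp B (v m)) Filter.atTop (nhds u)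
  partials : ∀ i, Filter.Tendsto (fun m => boxLp B (partialC (v m) (hv m) i)) Filter.atTop
    (nhds (g i))
  boundary : Filter.Tendsto (fun m => bdryLp B (v m)) Filter.atTop (nhds T)

/-- The ground inequality with a = 1 is a trace inequality: the squared boundary norm is at most the
squared gradient norm plus ∑ k_i² times the squared norm. Applied to differences of smooth
approximations, it makes their boundary values Cauchy, and the limit inherits the Gauss–Green
formula. -/
theorem exists_isTrace {B : BoxIntegral.Box (Fin n)} {u : L2 B} {g : Fin n → L2 B}
    (h : IsWeakGradient u g) :
    ∃ v hv T, IsTrace u T ∧ Approximates (B := B) v hv u g T := by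
  obtain ⟨v, hv, hu, hg⟩ := h.exists_approx
  obtain ⟨k, μ, ψ, hdata⟩ := exists_isEdgeData B zero_le_one
  have hcauchy : CauchySeq fun m => bdryLp B (v m) := by
    rw [cauchySeq_iff_tendsto_dist_atTop_0]
    let D : ℕ × ℕ → ℝ := fun p => ∑ i, dist (boxLp B (partialC (v p.1) (hv p.1) i))
      (boxLp B (partialC (v p.2) (hv p.2) i)) ^ 2
      + (∑ i, k i ^ 2) * dist (boxLp B (v p.1)) (boxLp B (v p.2)) ^ 2
    have hD : Filter.Tendsto D Filter.atTop (nhds 0) := by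
      have e1 := cauchySeq_iff_tendsto_dist_atTop_0.1 hu.cauchySeq
      have e2 := fun i => cauchySeq_iff_tendsto_dist_atTop_0.1 (hg i).cauchySeq
      have := (tendsto_finsetSum Finset.univ fun i _ => (e2 i).pow 2).add
        ((e1.pow 2).const_mul (∑ i, k i ^ 2))
      simpa using this
    have hsq : Filter.Tendsto (fun p => Real.sqrt (D p)) Filter.atTop (nhds 0) := by
      have := (Real.continuous_sqrt.tendsto 0).comp hD
      rwa [Real.sqrt_zero] at this
    refine squeeze_zero (fun _ => dist_nonneg) (fun p => Real.le_sqrt_of_sq_le ?_) hsq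
    have hsub : ContDiff ℝ 1 (v p.1 - v p.2 : C(Fin n → ℝ, ℝ)) := (hv p.1).sub (hv p.2)
    have key := hdata.ground_inequality (v p.1 - v p.2) hsub
    simp only [partialC_sub (hv p.1) (hv p.2) hsub, boxLp_sub, bdryLp_sub] at key
    simp only [D, dist_eq_norm]
    linarith
  obtain ⟨T, hT⟩ := cauchySeq_tendsto_of_complete hcauchy
  refine ⟨v, hv, T, fun i φ hφ => ?_, hu, hg, hT⟩
  rw [weakGradient_eq h]
  have hφ1 : ContDiff ℝ 1 φ := hφ.of_le (by exact_mod_cast le_top)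
  let φc : C(Fin n → ℝ, ℝ) := ⟨φ, hφ.continuous⟩
  have l1 := (hu.inner (𝕜 := ℝ) (tendsto_const_nhds (x := boxLp B (partialC φ hφ1 i)))).add
    ((hg i).inner (𝕜 := ℝ) (tendsto_const_nhds (x := boxLp B φc)))
  have l2 := (tendsto_integral_bdry hT (faceMeasure_upper_le B i) φc).sub
    (tendsto_integral_bdry hT (faceMeasure_lower_le B i) φc)
  simp only [inner_boxLp_right] at l1
  refine tendsto_nhds_unique l1 (l2.congr fun m => ?_)
  have := isTrace_boxLp B (v m) (hv m) i φ hφ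
  rw [weakGradient_eq (isWeakGradient_boxLp B (v m) (hv m))] at this
  exact this.symm

/-- The approximations need not be orthogonal to `w`, but the coefficients of their projections tend
to ⟨u, w⟩/‖w‖² = 0, so removing these projections does not disturb the limits. -/
theorem Approximates.orthogonalize {B : BoxIntegral.Box (Fin n)} {v : ℕ → C(Fin n → ℝ, ℝ)}
    {hv : ∀ m, ContDiff ℝ 1 (v m)} {u : L2 B} {g : Fin n → L2 B} {T : L2Boundary B}
    (h : Approximates v hv u g T) {w : C(Fin n → ℝ, ℝ)} (hw : ContDiff ℝ 1 w)
    (hw0 : boxLp B w ≠ 0) (horth : inner ℝ u (boxLp B w) = 0) :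
    ∃ v' hv', Approximates (B := B) v' hv' u g T ∧
      ∀ m, inner ℝ (boxLp B (v' m)) (boxLp B w) = 0 := by
  let c : ℕ → ℝ := fun m => inner ℝ (boxLp B (v m)) (boxLp B w) / ‖boxLp B w‖ ^ 2
  have hc : Filter.Tendsto c Filter.atTop (nhds 0) := by
    have := (h.tendsto.inner (𝕜 := ℝ) (tendsto_const_nhds (x := boxLp B w))).div_const (‖boxLp B w‖ ^ 2)
    rwa [horth, zero_div] at this
  have hz : ∀ {X : Type} [NormedAddCommGroup X] [NormedSpace ℝ X] {s : ℕ → X} {l z : X},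
      Filter.Tendsto s Filter.atTop (nhds l) →
      Filter.Tendsto (fun m => s m - c m • z) Filter.atTop (nhds l) := fun {X} _ _ {s l z} hs => by
    have := hs.sub (hc.smul_const z)
    rwa [zero_smul, sub_zero] at this
  have hcw : ∀ m, ContDiff ℝ 1 (c m • w : C(Fin n → ℝ, ℝ)) := fun m => contDiff_const.smul hw
  refine ⟨fun m => v m - c m • w, fun m => (hv m).sub (hcw m), ⟨?_, fun i => ?_, ?_⟩, fun m => ?_⟩
  · simp only [boxLp_sub, boxLp_smul]
    exact hz h.tendsto
  · simp only [partialC_sub (hv _) (hcw _), partialC_smul hw, boxLp_sub, boxLp_smul]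
    exact hz (h.partials i)
  · simp only [bdryLp_sub, bdryLp_smul]
    exact hz h.boundary
  · have hne : ‖boxLp B w‖ ≠ 0 := norm_ne_zero_iff.2 hw0
    rw [boxLp_sub, boxLp_smul, inner_sub_left, inner_smul_left, real_inner_self_eq_norm_sq]
    simp only [c, RCLike.conj_to_real]
    field_simp
    ring

/-! ### Spectral inequalities for Sobolev functions -/

theorem contDiff_groundFactor (B : BoxIntegral.Box (Fin n)) (k : Fin n → ℝ) (i : Fin n) :
    ContDiff ℝ ∞ (groundFactor B k i) :=
  Real.contDiff_cosh.comp (contDiff_const.mul (contDiff_id.sub contDiff_const))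

/-- The Robin ground state of the box. -/
def groundState (B : BoxIntegral.Box (Fin n)) (k : Fin n → ℝ) : C(Fin n → ℝ, ℝ) :=
  tensor (groundFactor B k)

theorem contDiff_groundState (B : BoxIntegral.Box (Fin n)) (k : Fin n → ℝ) :
    ContDiff ℝ ∞ (groundState B k) := contDiff_tensor (contDiff_groundFactor B k)

theorem boxLp_ne_zero (B : BoxIntegral.Box (Fin n)) (f : C(Fin n → ℝ, ℝ)) {x : Fin n → ℝ}
    (hx : ∀ i, x i ∈ Ioo (B.lower i) (B.upper i)) (hf : f x ≠ 0) : boxLp B f ≠ 0 := by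
  intro h
  have hopen : IsOpen (BoxIntegral.Box.Ioo B : Set (Fin n → ℝ)) :=
    isOpen_set_pi finite_univ fun _ _ => isOpen_Ioo
  have hae : f =ᵐ[boxMeasure B] fun _ => 0 := by
    refine (coeFn_boxLp B f).symm.trans ?_
    rw [h]
    exact Lp.coeFn_zero _ _ _
  exact hf (Measure.eqOn_open_of_ae_eq hae hopen f.continuous.continuousOn continuousOn_const
    fun i _ => hx i)

theorem center_mem (B : BoxIntegral.Box (Fin n)) (i : Fin n) :
    (B.lower i + B.upper i) / 2 ∈ Ioo (B.lower i) (B.upper i) := by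
  have := B.lower_lt_upper i
  constructor <;> linarith

theorem groundState_ne_zero (B : BoxIntegral.Box (Fin n)) (k : Fin n → ℝ) :
    boxLp B (groundState B k) ≠ 0 :=
  boxLp_ne_zero B _ (center_mem B) (by
    rw [groundState, tensor_apply]
    exact (Finset.prod_pos fun i _ => groundFactor_pos B k i _).ne')

theorem Approximates.energy {B : BoxIntegral.Box (Fin n)} {v : ℕ → C(Fin n → ℝ, ℝ)}
    {hv : ∀ m, ContDiff ℝ 1 (v m)} {u : L2 B} {g : Fin n → L2 B} {T : L2Boundary B}
    (h : Approximates v hv u g T) {a c : ℝ}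
    (hineq : ∀ m, c * ‖boxLp B (v m)‖ ^ 2
      ≤ ∑ i, ‖boxLp B (partialC (v m) (hv m) i)‖ ^ 2 - a * ‖bdryLp B (v m)‖ ^ 2) :
    c * ‖u‖ ^ 2 ≤ ∑ i, ‖g i‖ ^ 2 - a * ‖T‖ ^ 2 :=
  le_of_tendsto_of_tendsto' ((h.tendsto.norm.pow 2).const_mul c)
    ((tendsto_finsetSum Finset.univ fun i _ => (h.partials i).norm.pow 2).sub
      ((h.boundary.norm.pow 2).const_mul a)) hineq

namespace IsEdgeData

variable {B : BoxIntegral.Box (Fin n)} {a : ℝ} {k μ : Fin n → ℝ} {ψ : Fin n → ℝ → ℝ}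

theorem le_rayleigh (h : IsEdgeData B a k μ ψ) {u : L2 B} (hu : MemH1 u) (hu0 : u ≠ 0) :
    -∑ i, k i ^ 2 ≤ rayleigh (-a) u := by
  obtain ⟨g, hg⟩ := hu
  obtain ⟨v, hv, T, hT, happ⟩ := exists_isTrace hg
  have hpos : 0 < ‖u‖ ^ 2 := by have := norm_pos_iff.2 hu0; positivity
  rw [rayleigh_eq _ hg hT, le_div_iff₀ hpos, neg_mul a, ← sub_eq_add_neg]
  exact happ.energy fun m => h.ground_inequality (v m) (hv m)

theorem le_rayleigh_of_orthogonal (h : IsEdgeData B a k μ ψ) {γ : ℝ} (hγ : 0 ≤ γ)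
    (hγ' : ∀ i, γ ≤ μ i + k i ^ 2) {u : L2 B} (hu : MemH1 u) (hu0 : u ≠ 0)
    (horth : inner ℝ u (boxLp B (groundState B k)) = 0) :
    -∑ i, k i ^ 2 + γ ≤ rayleigh (-a) u := by
  obtain ⟨g, hg⟩ := hu
  obtain ⟨v, hv, T, hT, happ⟩ := exists_isTrace hg
  obtain ⟨v', hv', happ', horth'⟩ := happ.orthogonalize
    ((contDiff_groundState B k).of_le (by exact_mod_cast le_top)) (groundState_ne_zero B k) horth
  have hpos : 0 < ‖u‖ ^ 2 := by have := norm_pos_iff.2 hu0; positivity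
  rw [rayleigh_eq _ hg hT, le_div_iff₀ hpos, neg_mul a, ← sub_eq_add_neg]
  exact happ'.energy fun m => h.gap_inequality hγ hγ' (v' m) (hv' m) (horth' m)

end IsEdgeData

/-- The values in the minimax formula for the `k`-th eigenvalue. -/
def minimaxSet (k : ℕ) (B : BoxIntegral.Box (Fin n)) (α : ℝ) : Set ℝ :=
  {M : ℝ | ∃ U : Submodule ℝ (L2 B), (∀ u ∈ U, MemH1 u) ∧ Module.finrank ℝ U = k ∧
    IsGreatest {r : ℝ | ∃ u ∈ U, u ≠ 0 ∧ r = rayleigh α u} M}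

theorem robinEigenvalue_eq (k : ℕ) (B : BoxIntegral.Box (Fin n)) (α : ℝ) :
    robinEigenvalue k B α = sInf (minimaxSet k B α) := rfl

/-- Without a lower bound the infimum would take its default value, and membership in the set would
not bound the eigenvalue from above. -/
theorem IsEdgeData.bddBelow {B : BoxIntegral.Box (Fin n)} {a : ℝ} {k μ : Fin n → ℝ}
    {ψ : Fin n → ℝ → ℝ} (h : IsEdgeData B a k μ ψ) (j : ℕ) : BddBelow (minimaxSet j B (-a)) := by
  refine ⟨-∑ i, k i ^ 2, ?_⟩
  rintro M ⟨U, hU, _, hM⟩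
  obtain ⟨u, hu, hu0, rfl⟩ := hM.1
  exact h.le_rayleigh (hU u hu) hu0

/-- The Courant–Fischer argument: a linear functional on a plane has a nonzero kernel vector, here
one orthogonal to the ground state, and its quotient is at most the maximum over the plane. -/
theorem IsEdgeData.le_of_mem_minimaxSet {B : BoxIntegral.Box (Fin n)} {a : ℝ} {k μ : Fin n → ℝ}
    {ψ : Fin n → ℝ → ℝ} (h : IsEdgeData B a k μ ψ) {γ : ℝ} (hγ : 0 ≤ γ)
    (hγ' : ∀ i, γ ≤ μ i + k i ^ 2) {M : ℝ} (hM : M ∈ minimaxSet 2 B (-a)) :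
    -∑ i, k i ^ 2 + γ ≤ M := by
  obtain ⟨U, hU, hdim, hM⟩ := hM
  -- An infinite-dimensional subspace has `finrank` 0, so the value 2 excludes it.
  have hfin : FiniteDimensional ℝ U := .of_finrank_pos (by omega)
  let ℓ : U →ₗ[ℝ] ℝ := (innerₛₗ ℝ (boxLp B (groundState B k))).comp U.subtype
  have hker : LinearMap.ker ℓ ≠ ⊥ := by
    intro hbot
    have := LinearMap.finrank_le_finrank_of_injective (LinearMap.ker_eq_bot.1 hbot)
    rw [hdim, Module.finrank_self] at this
    omega
  obtain ⟨u, hu, hu0⟩ := Submodule.exists_mem_ne_zero_of_ne_bot hker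
  have hu1 : (u : L2 B) ≠ 0 := fun h => hu0 (Subtype.ext h)
  have horth : inner ℝ (u : L2 B) (boxLp B (groundState B k)) = 0 := by
    rw [real_inner_comm]
    exact hu
  exact (h.le_rayleigh_of_orthogonal hγ hγ' (hU u u.2) hu1 horth).trans
    (hM.2 ⟨u, u.2, hu1, rfl⟩)

end

noncomputable section

variable {n : ℕ}

/-! ### Products of one-dimensional modes -/

/-- `f` solves the Robin eigenvalue problem on the `i`-th edge with eigenvalue `lam`. -/
structure IsEdgeMode (B : BoxIntegral.Box (Fin n)) (a : ℝ) (i : Fin n) (lam : ℝ) (f : C(ℝ, ℝ)) :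
    Prop where
  contDiff : ContDiff ℝ ∞ f
  ode : ∀ t, deriv (deriv f) t = -lam * f t
  upper : deriv f (B.upper i) = a * f (B.upper i)
  lower : deriv f (B.lower i) = -(a * f (B.lower i))

theorem IsGroundRate.isEdgeMode {B : BoxIntegral.Box (Fin n)} {a : ℝ} {i : Fin n}
    {k : Fin n → ℝ} (h : IsGroundRate a (halfEdge B i) (k i)) :
    IsEdgeMode B a i (-k i ^ 2) (groundFactor B k i) := by
  set c := (B.lower i + B.upper i) / 2 with hc
  have h1 : deriv (groundFactor B k i) = fun t => k i * Real.sinh (k i * (t - c)) :=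
    funext fun t => ((hasDerivAt_cosh_mul (k i) (t - c)).comp_sub_const t c).deriv
  have h2 : ∀ t, deriv (fun t => k i * Real.sinh (k i * (t - c))) t
      = k i ^ 2 * Real.cosh (k i * (t - c)) := fun t =>
    ((hasDerivAt_sinh_mul (k i) (t - c)).comp_sub_const t c).deriv
  have e1 : B.upper i - c = halfEdge B i := by rw [hc, halfEdge]; ring
  have e2 : B.lower i - c = -halfEdge B i := by rw [hc, halfEdge]; ring
  refine ⟨contDiff_groundFactor B k i, fun t => ?_, ?_, ?_⟩
  · rw [h1, h2]
    simp only [groundFactor, ContinuousMap.coe_mk]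
    ring
  · rw [h1]
    simp only [groundFactor, ContinuousMap.coe_mk, ← hc, e1]
    exact h.robin
  · rw [h1]
    simp only [groundFactor, ContinuousMap.coe_mk, ← hc, e2, mul_neg, Real.sinh_neg,
      Real.cosh_neg]
    rw [h.robin]

/-- The odd mode of the `i`-th edge. -/
def oddFactor (B : BoxIntegral.Box (Fin n)) (i : Fin n) {a L μ : ℝ} {ψ : ℝ → ℝ}
    (h : IsOddMode a L μ ψ) : C(ℝ, ℝ) :=
  ⟨fun t => ψ (t - (B.lower i + B.upper i) / 2), by
    have := h.contDiff.continuous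
    fun_prop⟩

theorem IsOddMode.isEdgeMode {B : BoxIntegral.Box (Fin n)} {a μ : ℝ} {i : Fin n}
    {ψ : ℝ → ℝ} (h : IsOddMode a (halfEdge B i) μ ψ) :
    IsEdgeMode B a i μ (oddFactor B i h) := by
  set c := (B.lower i + B.upper i) / 2 with hc
  have h1 : deriv (oddFactor B i h) = fun t => deriv ψ (t - c) :=
    funext fun t => ((h.hasDerivAt (t - c)).comp_sub_const t c).deriv
  have h2 : ∀ t, deriv (fun t => deriv ψ (t - c)) t = -μ * ψ (t - c) := fun t =>
    ((h.hasDerivAt_deriv (t - c)).comp_sub_const t c).deriv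
  have e1 : B.upper i - c = halfEdge B i := by rw [hc, halfEdge]; ring
  have e2 : B.lower i - c = -halfEdge B i := by rw [hc, halfEdge]; ring
  refine ⟨h.contDiff.comp (contDiff_id.sub contDiff_const), fun t => ?_, ?_, ?_⟩
  · rw [h1, h2]
    rfl
  · rw [h1]
    simp only [oddFactor, ContinuousMap.coe_mk, ← hc, e1]
    exact h.robin
  · rw [h1]
    simp only [oddFactor, ContinuousMap.coe_mk, ← hc, e2, h.deriv_even, h.odd]
    rw [h.robin]
    ring

theorem inner_bdryLp_bdryLp (B : BoxIntegral.Box (Fin n)) (f g : C(Fin n → ℝ, ℝ)) :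
    inner ℝ (bdryLp B f) (bdryLp B g) = ∑ i, (∫ x, f x * g x ∂(faceMeasure B i (B.lower i))
      + ∫ x, f x * g x ∂(faceMeasure B i (B.upper i))) := by
  rw [← integral_surfaceMeasure B ((carried_surface B).integrable (by fun_prop)),
    inner_eq_integral]
  refine integral_congr_ae ?_
  filter_upwards [coeFn_bdryLp B f, coeFn_bdryLp B g] with x h1 h2
  rw [h1, h2]

/-- Green's formula for a product of modes. -/
theorem green_tensor {B : BoxIntegral.Box (Fin n)} {a : ℝ} {lam : Fin n → ℝ} {f : Fin n → C(ℝ, ℝ)}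
    (h : ∀ i, IsEdgeMode B a i (lam i) (f i)) (v : C(Fin n → ℝ, ℝ)) (hv : ContDiff ℝ 1 v)
    (hF : ContDiff ℝ 1 (tensor f)) :
    ∑ i, inner ℝ (boxLp B (partialC v hv i)) (boxLp B (partialC (tensor f) hF i))
        - a * inner ℝ (bdryLp B v) (bdryLp B (tensor f))
      = (∑ i, lam i) * inner ℝ (boxLp B v) (boxLp B (tensor f)) := by
  rw [inner_bdryLp_bdryLp, Finset.mul_sum, ← Finset.sum_sub_distrib, Finset.sum_mul]
  refine Finset.sum_congr rfl fun i _ => ?_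
  have hf1 : ∀ j, ContDiff ℝ 1 (f j) := fun j => (h j).contDiff.of_le (by exact_mod_cast le_top)
  have hdf : ContDiff ℝ ∞ (deriv (f i)) := (contDiff_infty_iff_deriv.1 (h i).contDiff).2
  let f' : C(ℝ, ℝ) := ⟨deriv (f i), hdf.continuous⟩
  -- G is the i-th derivative of the product. The edge equation gives ∂_i G = -λ_i times the
  -- product, and the Robin conditions make G equal to ±a times the product on the two faces, so
  -- integrating by parts against v yields the i-th term.
  set G := tensor (Function.update f i f') with hG
  have hupd : ∀ j, ContDiff ℝ 1 (Function.update f i f' j) := fun j => by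
    rcases eq_or_ne j i with rfl | hj
    · rw [Function.update_self]; exact hdf.of_le (by exact_mod_cast le_top)
    · rw [Function.update_of_ne hj]; exact hf1 j
  have hG1 : ContDiff ℝ 1 G := contDiff_tensor hupd
  have e1 : partialC (tensor f) hF i = G := by
    ext x
    exact fderiv_tensor_update hf1 i (fun _ => rfl) x
  have hGx : ∀ x, G x = deriv (f i) (x i) * ∏ j ∈ Finset.univ.erase i, f j (x j) := fun x => by
    rw [← e1]
    exact fderiv_tensor hf1 i x
  have e2 : ∀ x, fderiv ℝ G x (Pi.single i 1) = -lam i * tensor f x := fun x => by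
    rw [hG, fderiv_tensor_update hupd i (χ := -lam i • f i) (fun t => by
      rw [Function.update_self]
      exact (h i).ode t), Function.update_idem, tensor_eq_mul_erase _ x i, Function.update_self,
      tensor_eq_mul_erase f x i, ContinuousMap.smul_apply, smul_eq_mul, mul_assoc]
    congr 2
    refine Finset.prod_congr rfl fun j hj => ?_
    rw [Function.update_of_ne (Finset.ne_of_mem_erase hj)]
  have key := gauss_green_mul B i hv hG1
  have k1 : ∫ x, v x * fderiv ℝ G x (Pi.single i 1) ∂(boxMeasure B)
      = -lam i * ∫ x, v x * tensor f x ∂(boxMeasure B) := by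
    rw [← integral_const_mul]
    refine integral_congr_ae (.of_forall fun x => ?_)
    simp only [e2]
    ring
  have k2 : ∫ x, v x * G x ∂(faceMeasure B i (B.upper i))
      = a * ∫ x, v x * tensor f x ∂(faceMeasure B i (B.upper i)) := by
    rw [← integral_const_mul]
    refine integral_congr_ae ?_
    filter_upwards [faceMeasure_ae_eq B i (B.upper i)] with x hx
    rw [hGx, tensor_eq_mul_erase f x i, hx, (h i).upper]
    ring
  have k3 : ∫ x, v x * G x ∂(faceMeasure B i (B.lower i))
      = -(a * ∫ x, v x * tensor f x ∂(faceMeasure B i (B.lower i))) := by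
    rw [← integral_const_mul, ← integral_neg]
    refine integral_congr_ae ?_
    filter_upwards [faceMeasure_ae_eq B i (B.lower i)] with x hx
    rw [hGx, tensor_eq_mul_erase f x i, hx, (h i).lower]
    ring
  rw [k1, k2, k3] at key
  rw [e1, inner_boxLp_boxLp, inner_boxLp_boxLp]
  change ∫ x, fderiv ℝ v x (Pi.single i 1) * G x ∂(boxMeasure B) - _ = _
  linarith

/-! ### The trial space -/

/-- Two orthogonal functions satisfying Green's formula span an admissible trial space. -/
theorem mem_minimaxSet_of_green {B : BoxIntegral.Box (Fin n)} {a l₁ l₂ : ℝ}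
    {w₁ w₂ : C(Fin n → ℝ, ℝ)} (h1 : ContDiff ℝ 1 w₁) (h2 : ContDiff ℝ 1 w₂) (hl : l₁ < l₂)
    (hw1 : boxLp B w₁ ≠ 0) (hw2 : boxLp B w₂ ≠ 0)
    (g1 : ∀ (v : C(Fin n → ℝ, ℝ)) (hv : ContDiff ℝ 1 v),
      ∑ i, inner ℝ (boxLp B (partialC v hv i)) (boxLp B (partialC w₁ h1 i))
        - a * inner ℝ (bdryLp B v) (bdryLp B w₁) = l₁ * inner ℝ (boxLp B v) (boxLp B w₁))
    (g2 : ∀ (v : C(Fin n → ℝ, ℝ)) (hv : ContDiff ℝ 1 v),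
      ∑ i, inner ℝ (boxLp B (partialC v hv i)) (boxLp B (partialC w₂ h2 i))
        - a * inner ℝ (bdryLp B v) (bdryLp B w₂) = l₂ * inner ℝ (boxLp B v) (boxLp B w₂)) :
    l₂ ∈ minimaxSet 2 B (-a) := by
  -- The energy form is symmetric, so testing each Green formula with the other function gives (l₂ -
  -- l₁) ⟨w₁, w₂⟩ = 0.
  have horth : inner ℝ (boxLp B w₁) (boxLp B w₂) = 0 := by
    have e1 := g1 w₂ h2
    have e2 := g2 w₁ h1
    simp only [real_inner_comm _ (boxLp B (partialC w₁ h1 _)), real_inner_comm _ (bdryLp B w₁),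
      real_inner_comm _ (boxLp B w₁)] at e2
    rw [e1, real_inner_comm] at e2
    have : (l₂ - l₁) * inner ℝ (boxLp B w₁) (boxLp B w₂) = 0 := by
      linarith
    exact (mul_eq_zero.1 this).resolve_left (sub_pos.2 hl).ne'
  have hsmul : ∀ (c : ℝ) {w : C(Fin n → ℝ, ℝ)}, ContDiff ℝ 1 w →
      ContDiff ℝ 1 (c • w : C(Fin n → ℝ, ℝ)) := fun c w hw => contDiff_const.smul hw
  have hcomb : ∀ c d : ℝ, ContDiff ℝ 1 (c • w₁ + d • w₂ : C(Fin n → ℝ, ℝ)) := fun c d =>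
    (hsmul c h1).add (hsmul d h2)
  have hLp : ∀ c d : ℝ, boxLp B (c • w₁ + d • w₂) = c • boxLp B w₁ + d • boxLp B w₂ := fun c d => by
    rw [boxLp_add, boxLp_smul, boxLp_smul]
  have hpart : ∀ c d i, boxLp B (partialC _ (hcomb c d) i)
      = c • boxLp B (partialC w₁ h1 i) + d • boxLp B (partialC w₂ h2 i) := fun c d i => by
    rw [partialC_add (hsmul c h1) (hsmul d h2), partialC_smul h1,
      partialC_smul h2, boxLp_add, boxLp_smul, boxLp_smul]
  have hbd : ∀ c d : ℝ, bdryLp B (c • w₁ + d • w₂) = c • bdryLp B w₁ + d • bdryLp B w₂ :=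
    fun c d => by
      rw [← bdryLp_smul, ← bdryLp_smul]
      exact MemLp.toLp_add _ _
  have hnorm : ∀ c d : ℝ, ‖boxLp B (c • w₁ + d • w₂)‖ ^ 2
      = c ^ 2 * ‖boxLp B w₁‖ ^ 2 + d ^ 2 * ‖boxLp B w₂‖ ^ 2 := fun c d => by
    rw [hLp, norm_add_sq_real, inner_smul_left, inner_smul_right, horth, norm_smul, norm_smul,
      mul_pow, mul_pow, Real.norm_eq_abs, Real.norm_eq_abs, sq_abs, sq_abs]
    simp
  have henergy : ∀ c d : ℝ, ∑ i, ‖boxLp B (partialC _ (hcomb c d) i)‖ ^ 2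
      - a * ‖bdryLp B (c • w₁ + d • w₂)‖ ^ 2
      = l₁ * (c ^ 2 * ‖boxLp B w₁‖ ^ 2) + l₂ * (d ^ 2 * ‖boxLp B w₂‖ ^ 2) := fun c d => by
    have e1 := g1 _ (hcomb c d)
    have e2 := g2 _ (hcomb c d)
    have p1 : ∀ i, ‖boxLp B (partialC _ (hcomb c d) i)‖ ^ 2
        = c * inner ℝ (boxLp B (partialC _ (hcomb c d) i)) (boxLp B (partialC w₁ h1 i))
          + d * inner ℝ (boxLp B (partialC _ (hcomb c d) i)) (boxLp B (partialC w₂ h2 i)) :=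
      fun i => by
        rw [← real_inner_self_eq_norm_sq]
        conv_lhs => arg 3; rw [hpart]
        rw [inner_add_right, inner_smul_right, inner_smul_right]
    have p2 : ‖bdryLp B (c • w₁ + d • w₂)‖ ^ 2
        = c * inner ℝ (bdryLp B (c • w₁ + d • w₂)) (bdryLp B w₁)
          + d * inner ℝ (bdryLp B (c • w₁ + d • w₂)) (bdryLp B w₂) := by
      rw [← real_inner_self_eq_norm_sq]
      conv_lhs => arg 3; rw [hbd]
      rw [inner_add_right, inner_smul_right, inner_smul_right]
    have q1 : inner ℝ (boxLp B (c • w₁ + d • w₂)) (boxLp B w₁) = c * ‖boxLp B w₁‖ ^ 2 := by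
      rw [hLp, inner_add_left, inner_smul_left, inner_smul_left, real_inner_self_eq_norm_sq,
        real_inner_comm, horth]
      simp
    have q2 : inner ℝ (boxLp B (c • w₁ + d • w₂)) (boxLp B w₂) = d * ‖boxLp B w₂‖ ^ 2 := by
      rw [hLp, inner_add_left, inner_smul_left, inner_smul_left, real_inner_self_eq_norm_sq, horth]
      simp
    rw [q1] at e1
    rw [q2] at e2
    simp only [p1, p2, Finset.sum_add_distrib, ← Finset.mul_sum]
    linear_combination c * e1 + d * e2
  -- Norm and energy are both diagonal in w₁, w₂, so the quotient is a weighted mean of l₁ and l₂;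
  -- its maximum l₂ is attained at w₂.
  have hray : ∀ c d : ℝ, rayleigh (-a) (boxLp B (c • w₁ + d • w₂))
      = (l₁ * (c ^ 2 * ‖boxLp B w₁‖ ^ 2) + l₂ * (d ^ 2 * ‖boxLp B w₂‖ ^ 2))
        / (c ^ 2 * ‖boxLp B w₁‖ ^ 2 + d ^ 2 * ‖boxLp B w₂‖ ^ 2) := fun c d => by
    rw [rayleigh_eq _ (isWeakGradient_boxLp B _ (hcomb c d)) (isTrace_boxLp B _ (hcomb c d)),
      neg_mul, ← sub_eq_add_neg, henergy, hnorm]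
  have hn1 : 0 < ‖boxLp B w₁‖ := norm_pos_iff.2 hw1
  have hn2 : 0 < ‖boxLp B w₂‖ := norm_pos_iff.2 hw2
  have hmem : ∀ u, u ∈ Submodule.span ℝ (range ![boxLp B w₁, boxLp B w₂]) ↔
      ∃ c d : ℝ, boxLp B (c • w₁ + d • w₂) = u := fun u => by
    rw [Matrix.range_cons_cons_empty, Submodule.mem_span_pair]
    simp only [hLp]
  refine ⟨Submodule.span ℝ (range ![boxLp B w₁, boxLp B w₂]), fun u hu => ?_, ?_, ?_, ?_⟩
  · obtain ⟨c, d, rfl⟩ := (hmem u).1 hu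
    exact ⟨_, isWeakGradient_boxLp B _ (hcomb c d)⟩
  · have hli : LinearIndependent ℝ ![boxLp B w₁, boxLp B w₂] := by
      rw [LinearIndependent.pair_iff]
      intro c d hcd
      have := hnorm c d
      rw [hLp, hcd, norm_zero] at this
      have t1 : 0 ≤ c ^ 2 * ‖boxLp B w₁‖ ^ 2 := by positivity
      have t2 : 0 ≤ d ^ 2 * ‖boxLp B w₂‖ ^ 2 := by positivity
      have s1 : c ^ 2 * ‖boxLp B w₁‖ ^ 2 = 0 := by linarith
      have s2 : d ^ 2 * ‖boxLp B w₂‖ ^ 2 = 0 := by linarith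
      constructor
      · simpa [hn1.ne'] using s1
      · simpa [hn2.ne'] using s2
    rw [finrank_span_eq_card hli, Fintype.card_fin]
  · refine ⟨boxLp B ((0:ℝ) • w₁ + (1:ℝ) • w₂), (hmem _).2 ⟨0, 1, rfl⟩, ?_, ?_⟩
    · rw [hLp, zero_smul, one_smul, zero_add]
      exact hw2
    · rw [hray]
      field_simp
      ring
  · rintro r ⟨u, hu, hu0, rfl⟩
    obtain ⟨c, d, rfl⟩ := (hmem u).1 hu
    have hpos : 0 < ‖boxLp B (c • w₁ + d • w₂)‖ ^ 2 := by
      have := norm_pos_iff.2 hu0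
      positivity
    rw [hnorm] at hpos
    rw [hray, div_le_iff₀ hpos]
    have t1 : 0 ≤ c ^ 2 * ‖boxLp B w₁‖ ^ 2 := by positivity
    nlinarith

/-- The trial plane is spanned by the ground state and the product with the odd mode in the j-th
factor. The direction `j` need not have the least gap; the comparison exploits this freedom by
taking a long edge. -/
theorem IsEdgeData.mem_minimaxSet {B : BoxIntegral.Box (Fin n)} {a : ℝ} {k μ : Fin n → ℝ}
    {ψ : Fin n → ℝ → ℝ} (h : IsEdgeData B a k μ ψ) (j : Fin n) :
    -∑ i, k i ^ 2 + (μ j + k j ^ 2) ∈ minimaxSet 2 B (-a) := by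
  have m1 : ∀ i, IsEdgeMode B a i (-k i ^ 2) (groundFactor B k i) := fun i =>
    (h.ground i).isEdgeMode
  have m2 : ∀ i, IsEdgeMode B a i (Function.update (fun i => -k i ^ 2) j (μ j) i)
      (Function.update (groundFactor B k) j (oddFactor B j (h.mode j)) i) := fun i => by
    rcases eq_or_ne i j with rfl | hij
    · rw [Function.update_self, Function.update_self]
      exact (h.mode i).isEdgeMode
    · rw [Function.update_of_ne hij, Function.update_of_ne hij]
      exact m1 i
  have c1 : ContDiff ℝ 1 (tensor (groundFactor B k)) :=
    contDiff_tensor fun i => (m1 i).contDiff.of_le (by exact_mod_cast le_top)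
  have c2 : ContDiff ℝ 1 (tensor (Function.update (groundFactor B k) j
      (oddFactor B j (h.mode j)))) :=
    contDiff_tensor fun i => (m2 i).contDiff.of_le (by exact_mod_cast le_top)
  have hs1 : ∑ i, -k i ^ 2 = -∑ i, k i ^ 2 := Finset.sum_neg_distrib _
  have hs2 : ∑ i, Function.update (fun i => -k i ^ 2) j (μ j) i
      = -∑ i, k i ^ 2 + (μ j + k j ^ 2) := by
    rw [Finset.sum_update_of_mem (Finset.mem_univ j), ← hs1,
      ← Finset.add_sum_erase Finset.univ (fun i => -k i ^ 2) (Finset.mem_univ j),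
      Finset.sdiff_singleton_eq_erase]
    ring
  have hgap := (h.mode j).gap_pos (h.ground j) (halfEdge_pos B j)
  refine mem_minimaxSet_of_green c1 c2 (l₁ := -∑ i, k i ^ 2) (by linarith)
    (groundState_ne_zero B k) ?_ (fun v hv => ?_) (fun v hv => ?_)
  · have hL := halfEdge_pos B j
    refine boxLp_ne_zero B _ (x := Function.update (fun i => (B.lower i + B.upper i) / 2) j
      ((B.lower j + B.upper j) / 2 + halfEdge B j / 2)) (fun i => ?_) ?_
    · rcases eq_or_ne i j with rfl | hij
      · rw [Function.update_self]
        unfold halfEdge at *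
        constructor <;> linarith
      · rw [Function.update_of_ne hij]
        exact center_mem B i
    · rw [tensor_update, Function.update_self]
      refine mul_ne_zero ?_ (Finset.prod_ne_zero_iff.2 fun i hi => ?_)
      · have := (h.mode j).pos (halfEdge B j / 2) (by linarith) (by linarith)
        simp only [oddFactor, ContinuousMap.coe_mk, add_sub_cancel_left]
        exact this.ne'
      · rw [Function.update_of_ne (Finset.ne_of_mem_erase hi)]
        exact (groundFactor_pos B k i _).ne'
  · rw [← hs1]
    exact green_tensor m1 v hv c1
  · rw [← hs2]
    exact green_tensor m2 v hv c2

end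

noncomputable section

variable {n : ℕ}

/-! ### Comparison of a box with the cube of the same volume -/

theorem isCube_of_halfEdge {B : BoxIntegral.Box (Fin n)} {M : ℝ} (h : ∀ i, halfEdge B i = M) :
    IsCube B := ⟨2 * M, fun i => by
  rw [← h i, halfEdge]
  ring⟩

/-- The second eigenvalue of a cube. -/
theorem robinEigenvalue_two_cube (hn : 1 ≤ n) {B : BoxIntegral.Box (Fin n)} {a M q μ : ℝ}
    {ψ : ℝ → ℝ} (hB : ∀ i, halfEdge B i = M) (hq : IsGroundRate a M q) (hψ : IsOddMode a M μ ψ) :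
    robinEigenvalue 2 B (-a) = -(n * q ^ 2) + (μ + q ^ 2) := by
  let j : Fin n := ⟨0, hn⟩
  have hdata : IsEdgeData B a (fun _ => q) (fun _ => μ) (fun _ => ψ) :=
    ⟨fun i => by rw [hB]; exact hq, fun i => by rw [hB]; exact hψ⟩
  have hM : 0 < M := by rw [← hB j]; exact halfEdge_pos B j
  have hmem := hdata.mem_minimaxSet j
  have hsum : ∑ _i : Fin n, q ^ 2 = n * q ^ 2 := by simp
  rw [hsum] at hmem
  rw [robinEigenvalue_eq]
  -- All edges share one gap, so the trial value and the lower bound coincide.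
  refine le_antisymm (csInf_le (hdata.bddBelow 2) hmem) (le_csInf ⟨_, hmem⟩ fun m hm => ?_)
  rw [← hsum]
  exact hdata.le_of_mem_minimaxSet (hψ.gap_pos hq hM).le (fun _ => le_rfl) hm

theorem volume_box_Ioo (B : BoxIntegral.Box (Fin n)) :
    volume (BoxIntegral.Box.Ioo B) = ENNReal.ofReal (∏ i, (2 * halfEdge B i)) := by
  have : (BoxIntegral.Box.Ioo B : Set (Fin n → ℝ))
      = univ.pi fun i => Ioo (B.lower i) (B.upper i) := rfl
  rw [this, Real.volume_pi_Ioo, ENNReal.ofReal_prod_of_nonneg]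
  · refine Finset.prod_congr rfl fun i _ => ?_
    congr 1
    unfold halfEdge
    ring
  · intro i _
    have := halfEdge_pos B i
    linarith

theorem sum_log_halfEdge {B C : BoxIntegral.Box (Fin n)}
    (h : volume (BoxIntegral.Box.Ioo B) = volume (BoxIntegral.Box.Ioo C)) :
    ∑ i, Real.log (halfEdge B i) = ∑ i, Real.log (halfEdge C i) := by
  have hpos : ∀ D : BoxIntegral.Box (Fin n), 0 < ∏ i, (2 * halfEdge D i) := fun D =>
    Finset.prod_pos fun i _ => mul_pos two_pos (halfEdge_pos D i)
  rw [volume_box_Ioo, volume_box_Ioo,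
    ENNReal.ofReal_eq_ofReal_iff (hpos B).le (hpos C).le] at h
  simp only [Finset.prod_mul_distrib] at h
  have h2 : (∏ _i : Fin n, (2:ℝ)) ≠ 0 := Finset.prod_ne_zero_iff.2 fun _ _ => two_ne_zero
  have h' := mul_left_cancel₀ h2 h
  rw [← Real.log_prod fun i _ => (halfEdge_pos B i).ne',
    ← Real.log_prod fun i _ => (halfEdge_pos C i).ne', h']

/-- A box whose edges are not longer than those of a cube of the same volume is a cube. -/
theorem halfEdge_eq_of_le {B : BoxIntegral.Box (Fin n)} {M : ℝ}
    (hsum : ∑ i, Real.log (halfEdge B i) = n * Real.log M) (hM : 0 < M)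
    (hle : ∀ i, halfEdge B i ≤ M) (i : Fin n) : halfEdge B i = M := by
  have h1 : ∑ i, (Real.log (halfEdge B i) - Real.log M) = 0 := by
    rw [Finset.sum_sub_distrib, hsum]
    simp
  have h2 := (Finset.sum_eq_zero_iff_of_nonpos fun i _ =>
    sub_nonpos.2 (Real.log_le_log (halfEdge_pos B i) (hle i))).1 h1 i (Finset.mem_univ i)
  exact Real.log_injOn_pos (halfEdge_pos B i) hM (sub_eq_zero.1 h2)

/-- A box with an edge longer than that of the cube of the same volume has a smaller second
eigenvalue. -/
theorem robinEigenvalue_two_lt {B : BoxIntegral.Box (Fin n)} {a M q μ : ℝ} {ψ : ℝ → ℝ}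
    (ha : 0 ≤ a) (hM : 0 < M) (hsum : ∑ i, Real.log (halfEdge B i) = n * Real.log M)
    (hq : IsGroundRate a M q) (hψ : IsOddMode a M μ ψ) {j : Fin n} (hj : M < halfEdge B j) :
    robinEigenvalue 2 B (-a) < -(n * q ^ 2) + (μ + q ^ 2) := by
  obtain ⟨k, μ', ψ', hdata⟩ := exists_isEdgeData B ha
  have hle : robinEigenvalue 2 B (-a) ≤ -∑ i, k i ^ 2 + (μ' j + k j ^ 2) :=
    csInf_le (hdata.bddBelow 2) (hdata.mem_minimaxSet j)
  have hμ := hψ.eigenvalue_lt (hdata.mode j) hM hj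
  obtain ⟨c, hc, htan⟩ := exists_tangent ha hM hq
  have hlog := Real.log_lt_log hM hj
  -- By the tangent inequality every summand is nonpositive, so the whole sum is at most its j-th
  -- term.
  have hsum1 : ∑ i, (-k i ^ 2 + q ^ 2 - c * (Real.log (halfEdge B i) - Real.log M))
      ≤ -k j ^ 2 + q ^ 2 - c * (Real.log (halfEdge B j) - Real.log M) := by
    rw [← Finset.add_sum_erase _ _ (Finset.mem_univ j)]
    have : ∑ i ∈ Finset.univ.erase j,
        (-k i ^ 2 + q ^ 2 - c * (Real.log (halfEdge B i) - Real.log M)) ≤ 0 :=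
      Finset.sum_nonpos fun i _ => by
        have := htan _ _ (halfEdge_pos B i) (hdata.ground i)
        linarith
    linarith
  -- Equality of volumes cancels the logarithmic terms.
  have hsum2 : ∑ i, (-k i ^ 2 + q ^ 2 - c * (Real.log (halfEdge B i) - Real.log M))
      = -∑ i, k i ^ 2 + n * q ^ 2 := by
    rw [Finset.sum_sub_distrib, Finset.sum_add_distrib, Finset.sum_neg_distrib, ← Finset.mul_sum,
      Finset.sum_sub_distrib, hsum]
    simp
  rw [hsum2] at hsum1
  have := mul_nonneg hc (sub_pos.2 hlog).le
  linarith

end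

end RobinBox

/-! ### Maximality of the cube and the equality case -/

theorem mainTheorem6 {n : ℕ} (hn : 1 ≤ n) (α : ℝ) (hα : α ≤ 0)
    (B C : BoxIntegral.Box (Fin n)) (hC : RobinBox.IsCube C)
    (hvol : volume (BoxIntegral.Box.Ioo B) = volume (BoxIntegral.Box.Ioo C)) :
    RobinBox.robinEigenvalue 2 B α ≤ RobinBox.robinEigenvalue 2 C α ∧
      (RobinBox.robinEigenvalue 2 B α = RobinBox.robinEigenvalue 2 C α ↔ RobinBox.IsCube B) := by
  obtain ⟨a, ha, rfl⟩ : ∃ a : ℝ, 0 ≤ a ∧ α = -a := ⟨-α, by linarith, by ring⟩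
  obtain ⟨l, hl⟩ := hC
  have hCM : ∀ i, RobinBox.halfEdge C i = l / 2 := fun i => by rw [RobinBox.halfEdge, hl]
  have hM : 0 < l / 2 := by
    rw [← hCM ⟨0, hn⟩]
    exact RobinBox.halfEdge_pos C _
  obtain ⟨q, hq⟩ := RobinBox.exists_isGroundRate ha hM
  obtain ⟨μ, ψ, hψ⟩ := RobinBox.exists_isOddMode ha hM
  have hsum : ∑ i, Real.log (RobinBox.halfEdge B i) = n * Real.log (l / 2) := by
    rw [RobinBox.sum_log_halfEdge hvol]
    simp [hCM]
  rw [RobinBox.robinEigenvalue_two_cube hn hCM hq hψ]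
  -- If no edge is longer than that of the cube, equal volume forces all edges to agree and the two
  -- eigenvalues coincide. Otherwise a longer edge yields strict inequality.
  by_cases hle : ∀ i, RobinBox.halfEdge B i ≤ l / 2
  · have hBM := RobinBox.halfEdge_eq_of_le hsum hM hle
    rw [RobinBox.robinEigenvalue_two_cube hn hBM hq hψ]
    exact ⟨le_rfl, fun _ => RobinBox.isCube_of_halfEdge hBM, fun _ => rfl⟩
  · push Not at hle
    obtain ⟨j, hj⟩ := hle
    have hlt := RobinBox.robinEigenvalue_two_lt ha hM hsum hq hψ hj
    refine ⟨hlt.le, fun h => absurd h hlt.ne, fun hB => ?_⟩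
    -- A cube of the same volume has the same edge, since n log (l'/2) = n log (l/2); this
    -- contradicts the longer edge j.
    obtain ⟨l', hl'⟩ := hB
    have hBM : ∀ i, RobinBox.halfEdge B i = l' / 2 := fun i => by rw [RobinBox.halfEdge, hl']
    have hn0 : (n : ℝ) ≠ 0 := by positivity
    have hlog : Real.log (l' / 2) = Real.log (l / 2) := by
      simp only [hBM, Finset.sum_const, Finset.card_univ, Fintype.card_fin, nsmul_eq_mul] at hsum
      exact mul_left_cancel₀ hn0 hsum
    rw [hBM] at hj
    exact absurd hlog (Real.log_lt_log hM hj).ne'
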